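/- Let $b\ge 2$ and $d\ge 1$ be integers. A deterministic Büchi automaton $\mathcal A=(Q,A,\delta,q_0,F)$ accepts an $\omega$-word if some state of $F$ occurs infinitely often in its run; it is \emph{weak} if $F$ is a union of strongly connected components (two states are in the same component if each can be reached from the other by a possibly empty word). Let $\Sigma=\{0,\dots,b-1\}$ and let $\star$ be a separator symbol. For $u\in\Sigma^*$ and $v\in\Sigma^\omega$ the word $u\star v$ denotes the real number $\sum_{i<|u|}b^{|u|-1-i}u[i]+\sum_{i\ge 0}b^{-i-1}v[i]$. A word $u\star v$ with $u\in(\Sigma^d)^*$ and $v\in(\Sigma^d)^\omega$ is a parallel encoding of the vector in $\mathbb R^d$ whose components are denoted by the $d$ component words. A language $L\subseteq\Sigma^*\star\Sigma^\omega$ is \emph{$d$-sequential} if $d$ divides $|u|$ for each $u\star v\in L$; its parallelization is the language over $\Sigma^d\cup\{\star\}$ obtained by grouping, in $u$ and in $v$, each $d$ consecutive digits into one letter of $\Sigma^d$. The automaton $\mathcal A$ over the alphabet $\Sigma\cup\{\star\}$ is a \emph{$d$-sequential RVA} (real vector automaton) if its language is $d$-sequential and the parallelization of its language is saturated, that is,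 contains all the parallel encodings in base $b$ of each vector of which it contains one parallel encoding. \textbf{Theorem.} There is an algorithm that, given $b\ge 2$, $d\ge 1$ and a weak deterministic Büchi automaton $\mathcal A$ over $\Sigma\cup\{\star\}$ with $n$ states, decides whether $\mathcal A$ is a $d$-sequential RVA, in time $O(nd\log(nd)\,b)$ and space $O(ndb)$. Here the algorithm is a fixed program with finitely many variables and arrays that hold natural numbers; evaluating a constant or variable, accessing an array cell, an addition, a (truncated) subtraction, a multiplication or a comparison takes one unit of time, as does each elementary statement or test, and a number takes one unit of space. The automaton is given by the table of $\delta$ and the array of Booleans for $F$. The constants in the bounds do not depend on $b,d,n,\mathcal A$; if $nd=1$, the factor $\log(nd)$ is read as $1$ (formally, $\log(nd)$ is replaced by $1+\log(nd)$, which changes nothing for $nd\ge 2$ up to a constant factor). -/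

import Mathlib

/-! ### Deterministic Büchi automata -/

/-- A deterministic Büchi automaton `(Q, A, δ, q₀, F)`; an `ω`-word over `A` is a `Stream' A`. -/
structure BuchiAutomaton (Q A : Type*) where
  /-- the transition function -/
  step : Q → A → Q
  /-- the initial state -/
  start : Q
  /-- the accepting states -/
  accept : Set Q

namespace BuchiAutomaton

variable {Q A : Type*} (M : BuchiAutomaton Q A)

/-- The (unique) run of the automaton on an `ω`-word. -/
def run (w : Stream' A) : ℕ → Q
  | 0 => M.start
  | i + 1 => M.step (run w i) (w.get i)

/-- The recognized language: some accepting state occurs infinitely often in the run. -/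
def language : Set (Stream' A) :=
  {w | ∃ q ∈ M.accept, {i : ℕ | M.run w i = q}.Infinite}

/-- `q` can be reached from `p` by reading some finite word. -/
def Reachable (p q : Q) : Prop := ∃ u : List A, u.foldl M.step p = q

/-- The strongly connected component of a state. -/
def component (q : Q) : Set Q := {p | M.Reachable q p ∧ M.Reachable p q}

/-- Weak automata: the set of accepting states is a union of strongly connected components. -/
def IsWeak : Prop := ∃ S : Set Q, M.accept = ⋃ q ∈ S, M.component q

end BuchiAutomaton

/-! ### Encodings of vectors of non-negative reals in base `b` -/

/-- The alphabet `X ∪ {⋆}`; the separator `⋆` is `none`. -/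
abbrev WithStar (X : Type*) := Option X

/-- The word `u ⋆ v`. -/
def dotWord {X : Type*} (u : List X) (v : Stream' X) : Stream' (WithStar X) :=
  (u.map some ++ [none]) ++ₛ v.map some

/-- The number `∑ b ^ (|u| - 1 - i) * u[i]` denoted by a natural part. -/
def natValue {b : ℕ} (u : List (Fin b)) : ℕ :=
  ∑ i : Fin u.length, b ^ (u.length - 1 - (i : ℕ)) * (u.get i : ℕ)

/-- The number `∑ b ^ (- i - 1) * v[i]` denoted by a fractional part. -/
noncomputable def fracValue {b : ℕ} (v : Stream' (Fin b)) : ℝ :=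
  ∑' i : ℕ, ((b : ℝ) ^ (i + 1))⁻¹ * ((v.get i : ℕ) : ℝ)

/-- The word `w` over `{0, …, b-1}^d ∪ {⋆}` has exactly one `⋆` and is a parallel encoding of the
vector `r`. -/
def ParEncodes {b d : ℕ} (w : Stream' (WithStar (Fin d → Fin b))) (r : Fin d → ℝ) : Prop :=
  ∃ (u : List (Fin d → Fin b)) (v : Stream' (Fin d → Fin b)), w = dotWord u v ∧
    ∀ f : Fin d, r f = (natValue (u.map fun a => a f) : ℝ) + fracValue (v.map fun a => a f)

/-- The set of vectors that admit an encoding in a parallel language. -/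
def parValues {b d : ℕ} (L : Set (Stream' (WithStar (Fin d → Fin b)))) : Set (Fin d → ℝ) :=
  {r | ∃ w ∈ L, ParEncodes w r}

/-- A parallel language is saturated if it contains all the encodings of each vector that it
contains one encoding of. -/
def ParSaturated {b d : ℕ} (L : Set (Stream' (WithStar (Fin d → Fin b)))) : Prop :=
  ∀ r ∈ parValues L, ∀ w, ParEncodes w r → w ∈ L

/-- Parallelization of a finite word of digits (whose length is a multiple of `d`). -/
def parList {b : ℕ} (d : ℕ) (u : List (Fin b)) : List (Fin d → Fin b) :=
  List.ofFn fun (i : Fin (u.length / d)) (j : Fin d) =>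
    u.get ⟨d * i + j, by
      have h1 : d * ((i : ℕ) + 1) ≤ d * (u.length / d) := Nat.mul_le_mul_left d i.isLt
      have h2 := Nat.mul_div_le u.length d
      have h3 := j.isLt
      rw [Nat.mul_add, Nat.mul_one] at h1
      omega⟩

/-- Parallelization of an infinite word of digits. -/
def parStream {b : ℕ} (d : ℕ) (v : Stream' (Fin b)) : Stream' (Fin d → Fin b) :=
  fun i j => v.get (d * i + j)

/-- `L` is a `d`-sequential language: its words are of the form `u ⋆ v`, where `u` is a finite word
of digits whose length is a multiple of `d` and `v` is an `ω`-word of digits. -/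
def IsSeqLanguage {b : ℕ} (d : ℕ) (L : Set (Stream' (WithStar (Fin b)))) : Prop :=
  ∀ w ∈ L, ∃ (u : List (Fin b)) (v : Stream' (Fin b)), d ∣ u.length ∧ w = dotWord u v

/-- The parallelization of a `d`-sequential language. -/
def parLanguage {b : ℕ} (d : ℕ) (L : Set (Stream' (WithStar (Fin b)))) :
    Set (Stream' (WithStar (Fin d → Fin b))) :=
  {w | ∃ (u : List (Fin b)) (v : Stream' (Fin b)), d ∣ u.length ∧ dotWord u v ∈ L ∧
    w = dotWord (parList d u) (parStream d v)}

/-- `M` is a `d`-sequential real vector automaton: it recognizes a `d`-sequential language, and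
this language is saturated. -/
def IsSeqRVA {Q : Type*} {b : ℕ} (d : ℕ) (M : BuchiAutomaton Q (WithStar (Fin b))) : Prop :=
  IsSeqLanguage d M.language ∧ ParSaturated (parLanguage d M.language)

/-! ### Random access programs with unit-cost arithmetic -/

namespace Ram

/-- Memory: variables and arrays that hold natural numbers. Both are named by numbers, and since
the names are written in the program, a program uses a fixed finite number of each. -/
structure Store where
  /-- the contents of the variables -/
  var : ℕ → ℕ
  /-- `arr a i` is the contents of cell `i` of array `a` -/
  arr : ℕ → ℕ → ℕ

/-- Arithmetic operations. -/
inductive BinOp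
  | add | sub | mul | lt | eq

/-- Subtraction is truncated; comparisons return `1` for true and `0` for false. -/
def BinOp.eval : BinOp → ℕ → ℕ → ℕ
  | add, x, y => x + y
  | sub, x, y => x - y
  | mul, x, y => x * y
  | lt, x, y => if x < y then 1 else 0
  | eq, x, y => if x = y then 1 else 0

/-- Expressions: constants, variables, array cells and arithmetic operations. -/
inductive Term
  | lit (c : ℕ)
  | var (x : ℕ)
  | read (a : ℕ) (e : Term)
  | bin (o : BinOp) (e₁ e₂ : Term)

/-- The value of an expression. -/
def Term.eval (σ : Store) : Term → ℕ
  | lit c => c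
  | var x => σ.var x
  | read a e => σ.arr a (e.eval σ)
  | bin o e₁ e₂ => o.eval (e₁.eval σ) (e₂.eval σ)

/-- The time to evaluate an expression: one unit for each operation, access and constant. -/
def Term.time : Term → ℕ
  | lit _ => 1
  | var _ => 1
  | read _ e => e.time + 1
  | bin _ e₁ e₂ => e₁.time + e₂.time + 1

/-- The least bound on (strictly above) the array addresses used to evaluate an expression. -/
def Term.space (σ : Store) : Term → ℕ
  | lit _ => 0
  | var _ => 0
  | read _ e => max (e.space σ) (e.eval σ + 1)
  | bin _ e₁ e₂ => max (e₁.space σ) (e₂.space σ)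

/-- Programs. The tests of `ite` and `loop` (a while loop) succeed if the value is not `0`. -/
inductive Program
  | skip
  | assign (x : ℕ) (e : Term)
  | write (a : ℕ) (e₁ e₂ : Term)
  | seq (p₁ p₂ : Program)
  | ite (e : Term) (p₁ p₂ : Program)
  | loop (e : Term) (p : Program)

/-- Set variable `x` to `k`. -/
def Store.setVar (σ : Store) (x k : ℕ) : Store :=
  { σ with var := Function.update σ.var x k }

/-- Set cell `i` of array `a` to `k`. -/
def Store.setArr (σ : Store) (a i k : ℕ) : Store :=
  { σ with arr := Function.update σ.arr a (Function.update (σ.arr a) i k) }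

/-- `Exec p σ τ t s`: started with memory `σ`, the program `p` halts with memory `τ` after exactly
`t` units of time, and `s` is the least bound on (strictly above) the array addresses that it reads
or writes. Each array thus needs at most `s` cells. -/
inductive Exec : Program → Store → Store → ℕ → ℕ → Prop
  | skip (σ : Store) : Exec .skip σ σ 1 0
  | assign (σ : Store) (x : ℕ) (e : Term) :
      Exec (.assign x e) σ (σ.setVar x (e.eval σ)) (e.time + 1) (e.space σ)
  | write (σ : Store) (a : ℕ) (e₁ e₂ : Term) :
      Exec (.write a e₁ e₂) σ (σ.setArr a (e₁.eval σ) (e₂.eval σ))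
        (e₁.time + e₂.time + 1) (max (max (e₁.space σ) (e₂.space σ)) (e₁.eval σ + 1))
  | seq {p₁ p₂ : Program} {σ₁ σ₂ σ₃ : Store} {t₁ t₂ s₁ s₂ : ℕ} :
      Exec p₁ σ₁ σ₂ t₁ s₁ → Exec p₂ σ₂ σ₃ t₂ s₂ →
      Exec (.seq p₁ p₂) σ₁ σ₃ (t₁ + t₂) (max s₁ s₂)
  | iteTrue {e : Term} {p₁ p₂ : Program} {σ τ : Store} {t s : ℕ} :
      e.eval σ ≠ 0 → Exec p₁ σ τ t s →
      Exec (.ite e p₁ p₂) σ τ (e.time + 1 + t) (max (e.space σ) s)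
  | iteFalse {e : Term} {p₁ p₂ : Program} {σ τ : Store} {t s : ℕ} :
      e.eval σ = 0 → Exec p₂ σ τ t s →
      Exec (.ite e p₁ p₂) σ τ (e.time + 1 + t) (max (e.space σ) s)
  | loopDone {e : Term} {p : Program} {σ : Store} :
      e.eval σ = 0 → Exec (.loop e p) σ σ (e.time + 1) (e.space σ)
  | loopStep {e : Term} {p : Program} {σ₁ σ₂ σ₃ : Store} {t₁ t₂ s₁ s₂ : ℕ} :
      e.eval σ₁ ≠ 0 → Exec p σ₁ σ₂ t₁ s₁ → Exec (.loop e p) σ₂ σ₃ t₂ s₂ →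
      Exec (.loop e p) σ₁ σ₃ (e.time + 1 + t₁ + t₂) (max (e.space σ₁) (max s₁ s₂))

/-- The letter with number `i`: the digits are numbered by themselves, the separator by `b`. -/
def letterOfNat (b i : ℕ) : WithStar (Fin b) := if h : i < b then some ⟨i, h⟩ else none

open Classical in
/-- The memory that presents `b`, `d` and an automaton with the states `0, …, n-1`: variables `0`
to `3` hold `b`, `d`, `n` and the initial state, cell `q * (b + 1) + a` of array `0` holds the
successor of state `q` under letter number `a`, cell `q` of array `1` tells whether `q` is
accepting, and everything else is `0`. -/
noncomputable def input (b d n : ℕ) (M : BuchiAutomaton (Fin n) (WithStar (Fin b))) : Store where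
  var := fun x =>
    match x with
    | 0 => b
    | 1 => d
    | 2 => n
    | 3 => M.start
    | _ => 0
  arr := fun a i =>
    match a with
    | 0 => if h : i / (b + 1) < n then
        (M.step ⟨i / (b + 1), h⟩ (letterOfNat b (i % (b + 1))) : ℕ) else 0
    | 1 => if h : i < n then (if (⟨i, h⟩ : Fin n) ∈ M.accept then 1 else 0) else 0
    | _ => 0

end Ram

/-! The question is reduced to whether two states of one weak automaton accept the same words; this
is decided by coloring the states and then running the union-find equivalence test of Hopcroft and
Karp.

Arithmetic. Two digit sequences have the same value only if they are equal or dual, that is, of the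
forms `x a 0 0 …` and `x (a-1) (b-1) (b-1) …` (`eq_or_dualAt_of_ofDigits_eq`). Two encodings of a
vector can be padded with zero vectors until their separators are at the same position, and then be
transformed into each other one component at a time. Hence a `d`-sequential language is saturated
iff it is invariant under adding and removing a leading zero vector and under switching one
component to its dual expansion (`saturated_iff`). Such a switch replaces some digit `j` by `j - 1`
and, from there on, each `d`-th digit `0` by `b - 1` (`flatDual_iff`), which an automaton can follow
with a counter modulo `d`.

Reduction. An automaton with `10 * n * d` states and `2 * b` letters has two start states whose
languages agree iff three tests succeed; the first letter selects the test. The tests compare the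
two results of a dual switch, the given language with its left quotient by a zero vector, and the
set of accepted words of the wrong shape with the empty set (`forall_accepts_iff_isSeqRVA`). The
kinds of states never decrease along transitions, so weakness is inherited (`weakSet_bigAccept`).

Equivalence. The states are colored such that colors never increase along transitions, the color of
a state on a cycle is odd iff the state is accepting, and no color exceeds what the alternations of
accepting and rejecting cycles force. Equivalent states then have equal colors
(`IsColoring.le_of_accepts`), so two states are equivalent iff every finite word leads them to
colors of equal parity. For such a condition on finite words no partition refinement is needed: it
suffices to merge the two start states, then the successors of each merged pair, and to check the
parities of the merged pairs (`CompareInv.result`).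

Cost. Let `N = 10 * n * d` and `K = 2 * b`. A path-based depth-first search completes strongly
connected components after their successors, and each completed component can be colored at once
(`Colored.extend`); a potential shows that this takes time `O(N K)` (`color_run`). The equivalence
test performs fewer than `N` merges, each followed by `K` pairs of find operations, and union by
size makes each of these logarithmic (`find_run`). All addresses stay below `N * K`, which gives the
bound on space. -/

namespace SeqRVA

/-! ### Two expansions of the same real number -/

theorem fracValue_eq_ofDigits {b : ℕ} (v : Stream' (Fin b)) : fracValue v = Real.ofDigits v.get := by
  simp only [fracValue, Real.ofDigits, Real.ofDigitsTerm, mul_comm]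

theorem ofDigits_eq_zero {b : ℕ} {x : ℕ → Fin b} (h : Real.ofDigits x = 0) (i : ℕ) :
    (x i : ℕ) = 0 := by
  have hs : HasSum (Real.ofDigitsTerm x) 0 := by
    rw [← h]; exact Real.summable_ofDigitsTerm.hasSum
  have h0 := (hasSum_zero_iff_of_nonneg fun _ => Real.ofDigitsTerm_nonneg).1 hs
  have h1 := congrFun h0 i
  have hb : (b : ℝ) ≠ 0 := by
    have := (x i).pos
    positivity
  simpa [Real.ofDigitsTerm, hb] using h1

theorem ofDigits_zero {b : ℕ} {x : ℕ → Fin b} (h : ∀ i, (x i : ℕ) = 0) : Real.ofDigits x = 0 := by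
  simp [Real.ofDigits, Real.ofDigitsTerm, h]

theorem ofDigits_one {b : ℕ} (hb : 2 ≤ b) {x : ℕ → Fin b} (h : ∀ i, (x i : ℕ) + 1 = b) :
    Real.ofDigits x = 1 := by
  rw [← Real.ofDigits_const_last_eq_one' (b := b) (by omega)]
  congr 1
  funext i
  ext
  simp [← h i]

/-- The constant sequence of the largest digit has value 1, and a smaller digit at any one place
makes the series strictly smaller. -/
theorem ofDigits_eq_one {b : ℕ} (hb : 2 ≤ b) {x : ℕ → Fin b} (h : Real.ofDigits x = 1) (i : ℕ) :
    (x i : ℕ) + 1 = b := by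
  by_contra hne
  have hlt : Real.ofDigits x < Real.ofDigits (fun _ => (⟨b - 1, by omega⟩ : Fin b)) := by
    refine Summable.tsum_lt_tsum (i := i) (fun j => ?_) ?_ Real.summable_ofDigitsTerm
      Real.summable_ofDigitsTerm
    · simp only [Real.ofDigitsTerm]
      gcongr
      have := (x j).isLt
      omega
    · simp only [Real.ofDigitsTerm]
      gcongr
      have := (x i).isLt
      omega
  rw [Real.ofDigits_const_last_eq_one' (by omega), h] at hlt
  exact lt_irrefl _ hlt

/-- `y` and `y'` are `x a 0 0 0 …` and `x (a - 1) (b - 1) (b - 1) …`, where `|x| = t`. -/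
def DualAt {b : ℕ} (t : ℕ) (y y' : ℕ → Fin b) : Prop :=
  (∀ i < t, y i = y' i) ∧ (y t : ℕ) = y' t + 1 ∧ ∀ i > t, (y i : ℕ) = 0 ∧ (y' i : ℕ) + 1 = b

/-- The common prefix cancels. Equality of values becomes a balance between the gap of the digits at
`t` and two tails with values in `[0, 1]`. -/
theorem ofDigits_sub {b : ℕ} {y y' : ℕ → Fin b} {t : ℕ} (h : ∀ i < t, y i = y' i) :
    Real.ofDigits y - Real.ofDigits y' = ((b : ℝ) ^ (t + 1))⁻¹ *
      (((y t : ℕ) : ℝ) + Real.ofDigits (fun i => y (i + (t + 1))) -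
        (((y' t : ℕ) : ℝ) + Real.ofDigits (fun i => y' (i + (t + 1))))) := by
  rw [Real.ofDigits_eq_sum_add_ofDigits y (t + 1), Real.ofDigits_eq_sum_add_ofDigits y' (t + 1),
    Finset.sum_range_succ, Finset.sum_range_succ]
  have : ∑ i ∈ Finset.range t, Real.ofDigitsTerm y i = ∑ i ∈ Finset.range t, Real.ofDigitsTerm y' i :=
    Finset.sum_congr rfl fun i hi => by simp [Real.ofDigitsTerm, h i (Finset.mem_range.mp hi)]
  rw [this]
  simp only [Real.ofDigitsTerm]
  ring

theorem DualAt.ofDigits_eq {b : ℕ} (hb : 2 ≤ b) {t : ℕ} {y y' : ℕ → Fin b} (h : DualAt t y y') :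
    Real.ofDigits y = Real.ofDigits y' := by
  have h1 := ofDigits_sub h.1
  have h0 : Real.ofDigits (fun i => y (i + (t + 1))) = 0 :=
    ofDigits_zero fun i => (h.2.2 _ (by omega)).1
  have h2 : Real.ofDigits (fun i => y' (i + (t + 1))) = 1 :=
    ofDigits_one hb fun i => (h.2.2 _ (by omega)).2
  rw [h0, h2, h.2.1] at h1
  push_cast at h1
  rw [← sub_eq_zero, h1]
  ring

/-- The gap at `t` is at least 1 and only the tails can make up for it. Since these lie in `[0, 1]`,
the gap is exactly 1 and the tails have the extreme values 0 and 1, which determine all their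
digits. -/
theorem dualAt_of_lt {b : ℕ} (hb : 2 ≤ b) {t : ℕ} {y y' : ℕ → Fin b} (h : ∀ i < t, y i = y' i)
    (hlt : (y' t : ℕ) < y t) (he : Real.ofDigits y = Real.ofDigits y') : DualAt t y y' := by
  have h1 := ofDigits_sub h
  rw [he, sub_self] at h1
  have hb0 : (b : ℝ) ≠ 0 := by positivity
  have h2 := (mul_eq_zero.1 h1.symm).resolve_left (by positivity)
  have h3 := Real.ofDigits_nonneg (fun i => y (i + (t + 1)))
  have h4 := Real.ofDigits_le_one (fun i => y' (i + (t + 1)))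
  have h5 : ((y' t : ℕ) : ℝ) + 1 ≤ (y t : ℕ) := by exact_mod_cast hlt
  have h6 : Real.ofDigits (fun i => y (i + (t + 1))) = 0 := by linarith
  have h7 : Real.ofDigits (fun i => y' (i + (t + 1))) = 1 := by linarith
  refine ⟨h, ?_, fun i hi => ?_⟩
  · have : ((y t : ℕ) : ℝ) = (y' t : ℕ) + 1 := by linarith
    exact_mod_cast this
  · obtain ⟨j, rfl⟩ : ∃ j, i = j + (t + 1) := ⟨i - (t + 1), by omega⟩
    exact ⟨ofDigits_eq_zero h6 j, ofDigits_eq_one hb h7 j⟩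

theorem eq_or_dualAt_of_ofDigits_eq {b : ℕ} (hb : 2 ≤ b) {y y' : ℕ → Fin b}
    (he : Real.ofDigits y = Real.ofDigits y') :
    y = y' ∨ ∃ t, DualAt t y y' ∨ DualAt t y' y := by
  classical
  by_cases hne : ∃ i, y i ≠ y' i
  · right
    have h : ∀ i < Nat.find hne, y i = y' i := fun i hi => not_not.1 (Nat.find_min hne hi)
    refine ⟨Nat.find hne, ?_⟩
    rcases lt_or_gt_of_ne (Fin.val_ne_of_ne (Nat.find_spec hne)) with hlt | hlt
    · exact Or.inr (dualAt_of_lt hb (fun i hi => (h i hi).symm) hlt he.symm)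
    · exact Or.inl (dualAt_of_lt hb h hlt he)
  · push Not at hne
    exact Or.inl (funext hne)

/-! ### Words with exactly one separator -/

/-- The word that consists of the digits `x`, with the separator inserted at position `m`. -/
def starAt {X : Type*} (m : ℕ) (x : Stream' X) : Stream' (WithStar X) := fun i =>
  if i < m then some (x i) else if i = m then none else some (x (i - 1))

/-- Treating a word as one stream of digits with a separator position pays off twice: the value
depends on the position only through a power of `b`, and a change of digits need not distinguish the
two sides of the separator. -/
theorem dotWord_eq_starAt {X : Type*} (u : List X) (v : Stream' X) :
    dotWord u v = starAt u.length (u ++ₛ v) := by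
  funext i
  change (dotWord u v).get i = _
  simp only [dotWord, starAt]
  rcases lt_trichotomy i u.length with h | h | h
  · rw [Stream'.get_append_left _ _ _ (by simp; omega)]
    simp only [h, if_true]
    rw [List.getElem_append_left (by simpa using h)]
    have := Stream'.get_append_left i u v h
    simp only [Stream'.get] at this
    simp [this]
  · subst h
    rw [Stream'.get_append_left _ _ _ (by simp)]
    simp
  · obtain ⟨j, rfl⟩ : ∃ j, i = u.length + 1 + j := ⟨i - (u.length + 1), by omega⟩
    have h1 := Stream'.get_append_right j (u.map some ++ [none]) (v.map some)
    simp only [List.length_append, List.length_map, List.length_singleton] at h1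
    rw [h1]
    have h2 := Stream'.get_append_right j u v
    have h3 : u.length + 1 + j - 1 = u.length + j := by omega
    simp only [Stream'.get] at h2
    rw [if_neg (by omega), if_neg (by omega), h3, h2]
    rfl

theorem starAt_eq_dotWord {X : Type*} (m : ℕ) (x : Stream' X) :
    starAt m x = dotWord (x.take m) (x.drop m) := by
  rw [dotWord_eq_starAt, Stream'.append_take_drop, Stream'.length_take]

theorem starAt_eq_none_iff {X : Type*} {m i : ℕ} {x : Stream' X} :
    starAt m x i = none ↔ i = m := by
  simp only [starAt]
  split_ifs <;> simp <;> omega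

theorem starAt_inj {X : Type*} {m m' : ℕ} {x x' : Stream' X} (h : starAt m x = starAt m' x') :
    m = m' ∧ x = x' := by
  have hm : m = m' := starAt_eq_none_iff.1 (h ▸ starAt_eq_none_iff.2 rfl : starAt m' x' m = none)
  subst hm
  refine ⟨rfl, funext fun i => ?_⟩
  by_cases hi : i < m
  · simpa [starAt, hi] using congrFun h i
  · have := congrFun h (i + 1)
    simpa [starAt, show ¬ i + 1 < m by omega, show i + 1 ≠ m by omega] using this

theorem exists_eq_starAt {X : Type*} {m : ℕ} {w : Stream' (WithStar X)}
    (h : ∀ i, w i = none ↔ i = m) : ∃ x, w = starAt m x := by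
  have h1 : ∀ i, ∃ y, w (if i < m then i else i + 1) = some y := fun i =>
    Option.ne_none_iff_exists'.1 fun h2 => by
      have := (h _).1 h2
      split_ifs at this <;> omega
  choose x hx using h1
  refine ⟨x, funext fun i => ?_⟩
  simp only [starAt]
  split_ifs with h2 h3
  · simpa [h2] using hx i
  · exact (h i).2 h3
  · have := hx (i - 1)
    rwa [if_neg (by omega), show i - 1 + 1 = i by omega] at this

/-! ### Values of words -/

theorem natValue_add_fracValue {b : ℕ} (hb : 2 ≤ b) (u : List (Fin b)) (v : Stream' (Fin b)) :
    (natValue u : ℝ) + fracValue v = (b : ℝ) ^ u.length * fracValue (u ++ₛ v) := by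
  have hb0 : (b : ℝ) ≠ 0 := by positivity
  rw [fracValue_eq_ofDigits (u ++ₛ v), Real.ofDigits_eq_sum_add_ofDigits _ u.length, mul_add,
    mul_inv_cancel_left₀ (by positivity), fracValue_eq_ofDigits]
  congr 1
  · rw [natValue, Finset.mul_sum, Finset.sum_range]
    push_cast
    refine Finset.sum_congr rfl fun i _ => ?_
    have h1 := Stream'.get_append_left i u v i.isLt
    simp only [Real.ofDigitsTerm, h1, List.get_eq_getElem]
    have h2 : u.length = (u.length - 1 - i) + (i + 1) := by have := i.isLt; omega
    have h3 : (b : ℝ) ^ u.length = b ^ (u.length - 1 - i) * b ^ (i + 1 : ℕ) := by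
      rw [← pow_add, ← h2]
    rw [h3]
    field_simp
  · congr 1
    funext i
    rw [add_comm]
    exact (Stream'.get_append_right i u v).symm

theorem map_append_stream_comp {X Y : Type*} (f : X → Y) (x : Stream' X) (k : ℕ) :
    (x.take k).map f ++ₛ (x.drop k).map f = x.map f := by
  rw [← Stream'.map_append_stream, Stream'.append_take_drop]

theorem parEncodes_starAt {b d : ℕ} (hb : 2 ≤ b) (k : ℕ) (x : Stream' (Fin d → Fin b))
    (r : Fin d → ℝ) :
    ParEncodes (starAt k x) r ↔ ∀ f, r f = (b : ℝ) ^ k * fracValue (x.map fun a => a f) := by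
  have key : ∀ f, (natValue ((x.take k).map fun a => a f) : ℝ) +
      fracValue ((x.drop k).map fun a => a f) = (b : ℝ) ^ k * fracValue (x.map fun a => a f) := by
    intro f
    rw [natValue_add_fracValue hb, map_append_stream_comp]
    simp
  constructor
  · rintro ⟨u, v, h1, h2⟩ f
    rw [dotWord_eq_starAt] at h1
    obtain ⟨h3, h4⟩ := starAt_inj h1
    have hu : x.take k = u := by
      rw [h4, h3]
      simpa using (Stream'.take_append_of_le_length u.length u v (le_refl u.length))
    have hv : x.drop k = v := by rw [h4, h3, Stream'.drop_append_stream]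
    rw [h2, ← key f, hu, hv]
  · intro h
    exact ⟨x.take k, x.drop k, starAt_eq_dotWord k x, fun f => by rw [h f, key f]⟩

theorem dotWord_parList {b d : ℕ} (hd : 1 ≤ d) (u : List (Fin b)) (v : Stream' (Fin b))
    (hu : d ∣ u.length) :
    dotWord (parList d u) (parStream d v) = starAt (u.length / d) (parStream d (u ++ₛ v)) := by
  obtain ⟨k, hk⟩ := hu
  have hl : (parList d u).length = k := by simp [parList, hk, Nat.mul_div_cancel_left k hd]
  rw [dotWord_eq_starAt, hl, hk, Nat.mul_div_cancel_left k hd]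
  congr 1
  refine Stream'.ext fun i => ?_
  by_cases hi : i < k
  · rw [Stream'.get_append_left _ _ _ (by omega)]
    funext j
    have h1 : d * i + j < u.length := by
      have : d * (i + 1) ≤ d * k := Nat.mul_le_mul_left d hi
      have := j.isLt
      rw [hk]; nlinarith
    have := Stream'.get_append_left _ u v h1
    exact (congrFun (List.getElem_ofFn (lt_of_lt_of_eq hi hl.symm)) j).trans this.symm
  · obtain ⟨j, rfl⟩ : ∃ j, i = k + j := ⟨i - k, by omega⟩
    have h1 := Stream'.get_append_right j (parList d u) (parStream d v)
    rw [hl] at h1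
    rw [h1]
    funext f
    simp only [parStream, Stream'.get]
    have h2 := Stream'.get_append_right (d * j + f) u v
    simp only [Stream'.get] at h2
    rw [← h2, hk]
    congr 1
    ring

theorem parStream_surjective {b d : ℕ} (hd : 1 ≤ d) :
    Function.Surjective (parStream d : Stream' (Fin b) → _) := by
  intro y
  refine ⟨fun i => y (i / d) ⟨i % d, Nat.mod_lt _ hd⟩, ?_⟩
  funext i j
  have h1 : (d * i + j) / d = i := by
    rw [Nat.mul_add_div hd, Nat.div_eq_of_lt j.isLt, add_zero]
  have h2 : (d * i + j) % d = j := by rw [Nat.mul_add_mod, Nat.mod_eq_of_lt j.isLt]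
  simp only [parStream, Stream'.get, h1, h2]

theorem mem_parLanguage {b d : ℕ} (hd : 1 ≤ d) (L : Set (Stream' (WithStar (Fin b)))) (w) :
    w ∈ parLanguage d L ↔ ∃ k x, starAt (d * k) x ∈ L ∧ w = starAt k (parStream d x) := by
  constructor
  · rintro ⟨u, v, hu, hL, rfl⟩
    refine ⟨u.length / d, u ++ₛ v, ?_, dotWord_parList hd u v hu⟩
    rwa [Nat.mul_div_cancel' hu, ← dotWord_eq_starAt]
  · rintro ⟨k, x, hL, rfl⟩
    refine ⟨x.take (d * k), x.drop (d * k), by simp, by rwa [← starAt_eq_dotWord], ?_⟩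
    rw [dotWord_parList hd _ _ (by simp), Stream'.append_take_drop, Stream'.length_take,
      Nat.mul_div_cancel_left k hd]

/-- The digits of component `f` in a sequential encoding. -/
def component {b : ℕ} (d f : ℕ) (x : Stream' (Fin b)) : Stream' (Fin b) := fun i => x (d * i + f)

/-- For `d ≥ 1`, grouping digits is a bijection between the two kinds of digit streams and only
divides the separator position by `d`, so saturation can be studied on the sequential words
themselves. -/
theorem parSaturated_iff {b d : ℕ} (hb : 2 ≤ b) (hd : 1 ≤ d)
    (L : Set (Stream' (WithStar (Fin b)))) :
    ParSaturated (parLanguage d L) ↔ ∀ k k' x x', starAt (d * k) x ∈ L →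
      (∀ f < d, (b : ℝ) ^ k * fracValue (component d f x) =
        (b : ℝ) ^ k' * fracValue (component d f x')) → starAt (d * k') x' ∈ L := by
  constructor
  · intro h k k' x x' hx hv
    have h1 := h (fun f => (b : ℝ) ^ k * fracValue (component d f x))
      ⟨_, (mem_parLanguage hd _ _).2 ⟨k, x, hx, rfl⟩, (parEncodes_starAt hb _ _ _).2 fun f => rfl⟩
      (starAt k' (parStream d x')) ((parEncodes_starAt hb _ _ _).2 fun f => hv f f.isLt)
    obtain ⟨k₁, x₁, h2, h3⟩ := (mem_parLanguage hd _ _).1 h1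
    obtain ⟨rfl, h4⟩ := starAt_inj h3
    have : x' = x₁ := by
      funext i
      have h5 := congrFun (congrFun h4 (i / d)) ⟨i % d, Nat.mod_lt _ hd⟩
      simpa only [parStream, Stream'.get, Nat.div_add_mod] using h5
    rwa [this]
  · rintro h r ⟨w, hw, hr⟩ w' hw'
    obtain ⟨k, x, hx, rfl⟩ := (mem_parLanguage hd _ _).1 hw
    obtain ⟨u, v, hw1, hw2⟩ := hw'
    obtain ⟨x', hx'⟩ := parStream_surjective hd (u ++ₛ v)
    rw [dotWord_eq_starAt, ← hx'] at hw1
    have hw3 : ParEncodes w' r := ⟨u, v, by rw [dotWord_eq_starAt, ← hx', hw1], hw2⟩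
    rw [hw1, parEncodes_starAt hb] at hw3
    rw [parEncodes_starAt hb] at hr
    refine (mem_parLanguage hd _ _).2 ⟨_, x', h k _ x x' hx fun f hf => ?_, hw1⟩
    exact (hr ⟨f, hf⟩).symm.trans (hw3 ⟨f, hf⟩)

theorem isSeqLanguage_iff {b d : ℕ} (L : Set (Stream' (WithStar (Fin b)))) :
    IsSeqLanguage d L ↔ ∀ w ∈ L, ∃ m x, d ∣ m ∧ w = starAt m x := by
  refine forall₂_congr fun w _ => ⟨?_, ?_⟩
  · rintro ⟨u, v, h, rfl⟩
    exact ⟨_, _, h, dotWord_eq_starAt u v⟩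
  · rintro ⟨m, x, h, rfl⟩
    exact ⟨x.take m, x.drop m, by simpa using h, starAt_eq_dotWord m x⟩

end SeqRVA

namespace SeqRVA

/-! ### Saturation in terms of padding and of dual expansions of one component -/

theorem replicate_append_starAt {X : Type*} (j m : ℕ) (z : X) (x : Stream' X) :
    List.replicate j (some z) ++ₛ starAt m x = starAt (m + j) (List.replicate j z ++ₛ x) := by
  rw [starAt_eq_dotWord m x]
  have h : List.replicate j (some z) ++ₛ dotWord (x.take m) (x.drop m) =
      dotWord (List.replicate j z ++ x.take m) (x.drop m) := by
    simp [dotWord, Stream'.append_append_stream, List.append_assoc]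
  rw [h, dotWord_eq_starAt, Stream'.append_append_stream, Stream'.append_take_drop]
  simp [add_comm]

theorem fracValue_component_replicate {b d : ℕ} (hb : 2 ≤ b) (z : Fin b) (hz : (z : ℕ) = 0)
    (j f : ℕ) (hf : f < d) (x : Stream' (Fin b)) :
    (b : ℝ) ^ j * fracValue (component d f (List.replicate (d * j) z ++ₛ x)) =
      fracValue (component d f x) := by
  have hb0 : (b : ℝ) ≠ 0 := by positivity
  rw [fracValue_eq_ofDigits, fracValue_eq_ofDigits, Real.ofDigits_eq_sum_add_ofDigits _ j,
    mul_add, mul_inv_cancel_left₀ (by positivity), Finset.sum_eq_zero, mul_zero, zero_add]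
  · congr 1
    funext i
    have h := Stream'.get_append_right (d * i + f) (List.replicate (d * j) z) x
    rw [List.length_replicate] at h
    refine Eq.trans ?_ h
    simp only [component, Stream'.get]
    congr 1
    ring
  · intro i hi
    have hlt : d * i + f < (List.replicate (d * j) z).length := by
      have : d * (i + 1) ≤ d * j := Nat.mul_le_mul_left d (Finset.mem_range.1 hi)
      rw [List.length_replicate]; nlinarith
    have h := Stream'.get_append_left _ (List.replicate (d * j) z) x hlt
    rw [List.getElem_replicate] at h
    have h' : (component d f (List.replicate (d * j) z ++ₛ x)).get i = z := h
    simp [Real.ofDigitsTerm, h', hz]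

/-- The digit sequences `x` and `x'` are the same, except that the component to which position `t`
belongs is expanded in the two ways that start to differ at position `t`. -/
def FlatDual {b : ℕ} (d t : ℕ) (x x' : Stream' (Fin b)) : Prop :=
  (∀ i < t, x i = x' i) ∧ (x t : ℕ) = x' t + 1 ∧
    ∀ i > t, if d ∣ i - t then (x i : ℕ) = 0 ∧ (x' i : ℕ) + 1 = b else x i = x' i

/-- The positions congruent to `t` modulo `d` form the component `t % d`. This component sees a dual
pair that separates at its digit number `t / d`; the other components see no change. -/
theorem FlatDual.fracValue_eq {b d t : ℕ} (hb : 2 ≤ b) {x x' : Stream' (Fin b)}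
    (h : FlatDual d t x x') {f : ℕ} (hf : f < d) :
    fracValue (component d f x) = fracValue (component d f x') := by
  obtain ⟨h1, h2, h3⟩ := h
  rw [fracValue_eq_ofDigits, fracValue_eq_ofDigits]
  have hmod : ∀ i, d ∣ (d * i + f) - t → t ≤ d * i + f → f = t % d := by
    intro i hi hle
    have := (Nat.modEq_iff_dvd' hle).2 hi
    rw [Nat.ModEq, Nat.mul_add_mod, Nat.mod_eq_of_lt hf] at this
    exact this.symm
  by_cases hft : f = t % d
  · have ht : d * (t / d) + f = t := by rw [hft, Nat.div_add_mod]
    refine DualAt.ofDigits_eq (t := t / d) hb ⟨fun i hi => h1 _ ?_, ?_, fun i hi => ?_⟩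
    · have : d * (i + 1) ≤ d * (t / d) := Nat.mul_le_mul_left d hi
      nlinarith
    · simpa only [Stream'.get, component, ht] using h2
    · have h4 : d * (t / d) < d * i := Nat.mul_lt_mul_of_pos_left hi (by omega)
      have h5 := h3 (d * i + f) (by omega)
      have h6 : d * i + f - t = d * (i - t / d) := by rw [Nat.mul_sub]; omega
      rwa [if_pos (by rw [h6]; exact Nat.dvd_mul_right _ _)] at h5
  · congr 1
    funext i
    simp only [Stream'.get, component]
    rcases lt_trichotomy (d * i + f) t with hlt | heq | hgt
    · exact h1 _ hlt
    · exact absurd (hmod i (by simp [heq]) heq.ge) hft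
    · have h5 := h3 _ hgt
      rwa [if_neg fun hdvd => hft (hmod i hdvd hgt.le)] at h5

theorem flatDual_of_dualAt {b d f t : ℕ} (hf : f < d) {x x' : Stream' (Fin b)}
    (hne : ∀ i, i % d ≠ f → x i = x' i)
    (h : DualAt t (component d f x).get (component d f x').get) :
    FlatDual d (d * t + f) x x' := by
  obtain ⟨h1, h2, h3⟩ := h
  have hdec : ∀ i, i % d = f → d * (i / d) + f = i := fun i hi => by
    conv_rhs => rw [← Nat.div_add_mod i d, hi]
  refine ⟨fun i hi => ?_, h2, fun i hi => ?_⟩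
  · by_cases hm : i % d = f
    · have h4 := hdec i hm
      have h5 : i / d < t := by
        by_contra hcon
        have : d * t ≤ d * (i / d) := Nat.mul_le_mul_left d (by omega)
        omega
      have := h1 _ h5
      simpa only [Stream'.get, component, h4] using this
    · exact hne i hm
  · have hmod : d ∣ i - (d * t + f) ↔ i % d = f := by
      rw [← Nat.modEq_iff_dvd' (by omega), Nat.ModEq, Nat.mul_add_mod, Nat.mod_eq_of_lt hf, eq_comm]
    split_ifs with hm
    · rw [hmod] at hm
      have h4 := hdec i hm
      have h5 : t < i / d := by
        by_contra hcon
        have : d * (i / d) ≤ d * t := Nat.mul_le_mul_left d (by omega)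
        omega
      have := h3 _ h5
      simpa only [Stream'.get, component, h4] using this
    · rw [hmod] at hm
      exact hne i hm

/-- Both invariances are instances of saturation, as padding and dual switches preserve the vector.
Conversely they generate all passages between encodings of one vector: padding aligns the
separators, and then each component is either left alone or switched once. -/
theorem saturated_iff {b d : ℕ} (hb : 2 ≤ b) (hd : 1 ≤ d) (z : Fin b) (hz : (z : ℕ) = 0)
    (L : Set (Stream' (WithStar (Fin b)))) (hL : ∀ w ∈ L, ∃ m x, d ∣ m ∧ w = starAt m x) :
    ParSaturated (parLanguage d L) ↔
      (∀ w, w ∈ L ↔ List.replicate d (some z) ++ₛ w ∈ L) ∧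
      ∀ m t x x', d ∣ m → FlatDual d t x x' → (starAt m x ∈ L ↔ starAt m x' ∈ L) := by
  rw [parSaturated_iff hb hd]
  have hb0 : (b : ℝ) ≠ 0 := by positivity
  constructor
  · intro h
    refine ⟨fun w => ⟨fun hw => ?_, fun hw => ?_⟩, ?_⟩
    · obtain ⟨m, x, ⟨k, rfl⟩, rfl⟩ := hL w hw
      rw [replicate_append_starAt, ← Nat.mul_succ]
      refine h k (k + 1) _ _ hw fun f hf => ?_
      have := fracValue_component_replicate hb z hz 1 f hf x
      rw [mul_one, pow_one] at this
      rw [← this, pow_succ]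
      ring
    · obtain ⟨m, y, ⟨k, rfl⟩, hy⟩ := hL _ hw
      -- The padded word starts with a digit because `d ≥ 1`, so its separator is not at position 0
      -- and a whole zero vector can be removed in front of it.
      have hk : k ≠ 0 := by
        rintro rfl
        have h0 : (List.replicate d (some z) ++ₛ w).get 0 = starAt (d * 0) y 0 := congrFun hy 0
        rw [Stream'.get_append_left _ _ _ (by rw [List.length_replicate]; exact hd)] at h0
        simp [starAt] at h0
      obtain ⟨k, rfl⟩ := Nat.exists_eq_succ_of_ne_zero hk
      have hy1 : ∃ x, y = List.replicate d z ++ₛ x := by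
        refine ⟨y.drop d, ?_⟩
        conv_lhs => rw [← Stream'.append_take_drop d y]
        congr 1
        refine List.ext_getElem (by simp) fun i hi _ => ?_
        rw [Stream'.length_take] at hi
        have h1 : (List.replicate d (some z) ++ₛ w).get i = starAt (d * (k + 1)) y i := congrFun hy i
        rw [Stream'.get_append_left _ _ _ (by simpa using hi), List.getElem_replicate, starAt,
          if_pos (by nlinarith)] at h1
        simpa [Stream'.get] using (Option.some.inj h1).symm
      obtain ⟨x, rfl⟩ := hy1
      rw [Nat.succ_eq_add_one, Nat.mul_succ, ← replicate_append_starAt] at hy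
      have hw' := Stream'.append_right_injective _ _ _ hy
      rw [hy, replicate_append_starAt, ← Nat.mul_succ] at hw
      rw [hw']
      refine h (k + 1) k _ _ hw fun f hf => ?_
      have := fracValue_component_replicate hb z hz 1 f hf x
      rw [mul_one, pow_one] at this
      rw [← this, pow_succ]
      ring
    · rintro m t x x' ⟨k, rfl⟩ hx
      exact ⟨fun hw => h k k _ _ hw fun f hf => by rw [hx.fracValue_eq hb hf],
        fun hw => h k k _ _ hw fun f hf => by rw [hx.fracValue_eq hb hf]⟩
  · rintro ⟨hpad, hdual⟩ k k' x x' hx hv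
    have hpads : ∀ j m y, starAt m y ∈ L ↔ starAt (m + d * j) (List.replicate (d * j) z ++ₛ y) ∈ L := by
      intro j
      induction j with
      | zero => intro m y; simp
      | succ j ih =>
        intro m y
        rw [ih m y, hpad, replicate_append_starAt, ← Stream'.append_append_stream,
          List.replicate_append_replicate, Nat.mul_succ, add_assoc, add_comm d]
    have hsame : ∀ k (y y' : Stream' (Fin b)), (∀ f < d, fracValue (component d f y) =
        fracValue (component d f y')) → starAt (d * k) y ∈ L → starAt (d * k) y' ∈ L := by
      intro k y y' hy hmem
      classical
      -- A hybrid: the components in `s` are already taken from `y'`, the others still from `y`.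
      -- Adding one component to `s` keeps its value, hence changes nothing or is a dual switch.
      let Z : Finset ℕ → Stream' (Fin b) := fun s i => if i % d ∈ s then y' i else y i
      have hZ : ∀ s : Finset ℕ, (∀ f ∈ s, f < d) → starAt (d * k) (Z s) ∈ L := by
        intro s
        induction s using Finset.induction_on with
        | empty => intro _; simpa [Z] using hmem
        | insert f s hfs ih =>
          intro hs
          have ih := ih fun g hg => hs g (Finset.mem_insert_of_mem hg)
          have hf : f < d := hs f (Finset.mem_insert_self f s)
          have hmodf : ∀ i, (d * i + f) % d = f := fun i => by
            rw [Nat.mul_add_mod, Nat.mod_eq_of_lt hf]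
          have hc : component d f (Z s) = component d f y := by
            funext i
            simp [component, Z, hmodf, hfs]
          have hc' : component d f (Z (insert f s)) = component d f y' := by
            funext i
            simp [component, Z, hmodf]
          have hne : ∀ i, i % d ≠ f → Z s i = Z (insert f s) i := fun i hi => by
            simp [Z, hi]
          have he := hy f hf
          rw [← hc, ← hc', fracValue_eq_ofDigits, fracValue_eq_ofDigits] at he
          rcases eq_or_dualAt_of_ofDigits_eq hb he with h | ⟨t, h | h⟩
          · have : Z s = Z (insert f s) := by
              funext i
              by_cases hi : i % d = f
              · have h1 := congrFun h (i / d)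
                have h2 : d * (i / d) + f = i := by
                  conv_rhs => rw [← Nat.div_add_mod i d, hi]
                simpa only [component, Stream'.get, h2] using h1
              · exact hne i hi
            rwa [← this]
          · exact (hdual _ _ _ _ (Nat.dvd_mul_right d k) (flatDual_of_dualAt hf hne h)).1 ih
          · exact (hdual _ _ _ _ (Nat.dvd_mul_right d k)
              (flatDual_of_dualAt hf (fun i hi => (hne i hi).symm) h)).2 ih
      have h1 := hZ (Finset.range d) fun f hf => Finset.mem_range.1 hf
      have h2 : Z (Finset.range d) = y' := by
        funext i
        simp [Z, Nat.mod_lt i hd]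
      rwa [h2] at h1
    -- Each word is padded by as many zero vectors as the natural part of the other has letters, so
    -- both separators move to position `d * (k + k')`.
    rw [hpads k (d * k') x', add_comm, ← Nat.mul_add]
    rw [hpads k' (d * k) x, ← Nat.mul_add] at hx
    rw [Nat.add_comm] 
    rw [Nat.add_comm k' k]
    refine hsame _ _ _ (fun f hf => ?_) hx
    have h1 := fracValue_component_replicate hb z hz k' f hf x
    have h2 := fracValue_component_replicate hb z hz k f hf x'
    have h3 := hv f hf
    rw [← h1, ← h2, ← mul_assoc, ← mul_assoc, mul_comm ((b : ℝ) ^ k')] at h3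
    exact mul_left_cancel₀ (by positivity) h3

end SeqRVA

namespace SeqRVA

open Filter Relation

/-! ### Equivalence of states of weak automata -/

section Weak

variable {Q A : Type*}

/-- The run on `w` that starts in state `q`. -/
def runFrom (δ : Q → A → Q) (q : Q) (w : Stream' A) : ℕ → Q
  | 0 => q
  | i + 1 => δ (runFrom δ q w i) (w.get i)

/-- The word `w` is accepted from state `q`. -/
def Accepts (δ : Q → A → Q) (F : Set Q) (q : Q) (w : Stream' A) : Prop :=
  ∃ᶠ i in atTop, runFrom δ q w i ∈ F

/-- There is a transition from `x` to `y`. -/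
def Edge (δ : Q → A → Q) (x y : Q) : Prop := ∃ a, δ x a = y

/-- With finitely many states, infinitely many visits to the accepting set include infinitely many
visits to one of its elements. -/
theorem mem_language_iff [Finite Q] (M : BuchiAutomaton Q A) (w : Stream' A) :
    w ∈ M.language ↔ Accepts M.step M.accept M.start w := by
  have hrun : ∀ i, M.run w i = runFrom M.step M.start w i := by
    intro i
    induction i with
    | zero => rfl
    | succ i ih => simp [BuchiAutomaton.run, runFrom, ih]
  simp only [BuchiAutomaton.language, Set.mem_ofPred_eq, Accepts, hrun]
  constructor
  · rintro ⟨q, hq, h⟩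
    rw [← Nat.frequently_atTop_iff_infinite] at h
    exact h.mono fun i hi => hi ▸ hq
  · intro h
    rw [Nat.frequently_atTop_iff_infinite] at h
    have h2 : {i | runFrom M.step M.start w i ∈ M.accept} =
        ⋃ q ∈ M.accept, {i | runFrom M.step M.start w i = q} := by
      ext i; simp
    by_contra hcon
    push Not at hcon
    refine h ?_
    rw [h2]
    exact (Set.toFinite M.accept).biUnion hcon

theorem runFrom_append (δ : Q → A → Q) (q : Q) (u : List A) (w : Stream' A) (i : ℕ) :
    runFrom δ q (u ++ₛ w) (u.length + i) = runFrom δ (u.foldl δ q) w i := by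
  induction i with
  | zero =>
    induction u generalizing q with
    | nil => rfl
    | cons a u ih =>
      have hcons : ∀ j, runFrom δ q (List.cons a u ++ₛ w) (j + 1) = runFrom δ (δ q a) (u ++ₛ w) j := by
        intro j
        induction j with
        | zero => rfl
        | succ j ihj =>
          rw [runFrom, ihj]
          rfl
      have := ih (δ q a)
      simp only [add_zero, List.length_cons, List.foldl_cons] at this ⊢
      rw [hcons, this]
  | succ i ih =>
    rw [← add_assoc, runFrom, ih, runFrom, Stream'.get_append_right]

theorem accepts_append (δ : Q → A → Q) (F : Set Q) (q : Q) (u : List A) (w : Stream' A) :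
    Accepts δ F q (u ++ₛ w) ↔ Accepts δ F (u.foldl δ q) w := by
  simp only [Accepts, Nat.frequently_atTop_iff_infinite, ← runFrom_append]
  simp only [← Nat.frequently_atTop_iff_infinite]
  conv_lhs => rw [← map_add_atTop_eq_nat u.length]
  simp only [frequently_map, add_comm]

theorem runFrom_eq_foldl (δ : Q → A → Q) (q : Q) (w : Stream' A) (i : ℕ) :
    runFrom δ q w i = (w.take i).foldl δ q := by
  have := runFrom_append δ q (w.take i) (w.drop i) 0
  simpa [Stream'.append_take_drop, runFrom] using this

theorem accepts_drop (δ : Q → A → Q) (F : Set Q) (q : Q) (w : Stream' A) (i : ℕ) :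
    Accepts δ F q w ↔ Accepts δ F (runFrom δ q w i) (w.drop i) := by
  rw [runFrom_eq_foldl, ← accepts_append, Stream'.append_take_drop]

theorem reflTransGen_iff_foldl (δ : Q → A → Q) (x y : Q) :
    ReflTransGen (Edge δ) x y ↔ ∃ u : List A, u.foldl δ x = y := by
  constructor
  · intro h
    induction h with
    | refl => exact ⟨[], rfl⟩
    | tail _ h ih =>
      obtain ⟨u, rfl⟩ := ih
      obtain ⟨a, rfl⟩ := h
      exact ⟨u ++ [a], by simp⟩
  · rintro ⟨u, rfl⟩
    induction u generalizing x with
    | nil => exact .refl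
    | cons a u ih => exact .head ⟨a, rfl⟩ (ih _)

theorem transGen_iff_foldl (δ : Q → A → Q) (x y : Q) :
    TransGen (Edge δ) x y ↔ ∃ u : List A, u ≠ [] ∧ u.foldl δ x = y := by
  rw [TransGen.head'_iff]
  constructor
  · rintro ⟨z, ⟨a, rfl⟩, h⟩
    obtain ⟨u, rfl⟩ := (reflTransGen_iff_foldl δ _ _).1 h
    exact ⟨List.cons a u, by simp, rfl⟩
  · rintro ⟨u, hu, rfl⟩
    cases u with
    | nil => exact absurd rfl hu
    | cons a u => exact ⟨δ x a, ⟨a, rfl⟩, (reflTransGen_iff_foldl δ _ _).2 ⟨u, rfl⟩⟩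

theorem reflTransGen_runFrom (δ : Q → A → Q) (q : Q) (w : Stream' A) {i j : ℕ} (h : i ≤ j) :
    ReflTransGen (Edge δ) (runFrom δ q w i) (runFrom δ q w j) := by
  induction j, h using Nat.le_induction with
  | base => exact .refl
  | succ j _ ih => exact ih.tail ⟨_, rfl⟩

/-- Whether a state is accepting depends only on its strongly connected component. -/
def WeakSet (δ : Q → A → Q) (F : Set Q) : Prop :=
  ∀ x y, ReflTransGen (Edge δ) x y → ReflTransGen (Edge δ) y x → x ∈ F → y ∈ F

theorem WeakSet.mem_iff {δ : Q → A → Q} {F : Set Q} (hw : WeakSet δ F) {x y : Q}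
    (h1 : ReflTransGen (Edge δ) x y) (h2 : ReflTransGen (Edge δ) y x) : x ∈ F ↔ y ∈ F :=
  ⟨hw x y h1 h2, hw y x h2 h1⟩

theorem weakSet_of_isWeak {M : BuchiAutomaton Q A} (h : M.IsWeak) : WeakSet M.step M.accept := by
  obtain ⟨S, hS⟩ := h
  intro x y hxy hyx hx
  rw [reflTransGen_iff_foldl] at hxy hyx
  rw [hS] at hx ⊢
  simp only [Set.mem_iUnion, exists_prop] at hx ⊢
  obtain ⟨q, hq, ⟨u, hu⟩, v, hv⟩ := hx
  obtain ⟨u', hu'⟩ := hxy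
  obtain ⟨v', hv'⟩ := hyx
  exact ⟨q, hq, ⟨u ++ u', by rw [List.foldl_append, hu, hu']⟩,
    ⟨v' ++ v, by rw [List.foldl_append, hv', hv]⟩⟩

/-- The states from some point on are in the strongly connected component of one recurrent
state. -/
theorem exists_eventually_mutual [Finite Q] (δ : Q → A → Q) (q : Q) (w : Stream' A) :
    ∃ r, TransGen (Edge δ) r r ∧ ∀ᶠ i in atTop, ReflTransGen (Edge δ) r (runFrom δ q w i) ∧
      ReflTransGen (Edge δ) (runFrom δ q w i) r := by
  obtain ⟨r, hr⟩ := Finite.exists_infinite_fiber (runFrom δ q w)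
  have hr' := Nat.frequently_atTop_iff_infinite.2 (Set.infinite_coe_iff.1 hr)
  rw [frequently_atTop] at hr'
  obtain ⟨i, -, hi⟩ := hr' 0
  obtain ⟨j, hj, hij⟩ := hr' (i + 1)
  change runFrom δ q w i = r at hi
  change runFrom δ q w j = r at hij
  refine ⟨r, ?_, eventually_atTop.2 ⟨i, fun k hk => ⟨?_, ?_⟩⟩⟩
  · refine TransGen.head' (b := runFrom δ q w (i + 1)) ⟨w.get i, ?_⟩ ?_
    · rw [runFrom, hi]
    · rw [← hij]
      exact reflTransGen_runFrom δ q w hj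
  · rw [← hi]
    exact reflTransGen_runFrom δ q w hk
  · obtain ⟨l, hl, hkl⟩ := hr' k
    change runFrom δ q w l = r at hkl
    rw [← hkl]
    exact reflTransGen_runFrom δ q w hl

/-- A numbering of the states by the number of alternations between accepting and rejecting
cycles that are possible from them. -/
structure IsColoring (δ : Q → A → Q) (F : Set Q) (col : Q → ℕ) : Prop where
  mono : ∀ x a, col (δ x a) ≤ col x
  parity : ∀ x, TransGen (Edge δ) x x → (col x % 2 = 1 ↔ x ∈ F)
  min : ∀ x, col x ≠ 0 → ∃ y, ReflTransGen (Edge δ) x y ∧ TransGen (Edge δ) y y ∧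
    col y = col x ∧ (col x = 1 ∨ ∃ z, ReflTransGen (Edge δ) y z ∧ col z + 1 = col x)

theorem IsColoring.mono' {δ : Q → A → Q} {F : Set Q} {col : Q → ℕ} (h : IsColoring δ F col)
    {x y : Q} (hxy : ReflTransGen (Edge δ) x y) : col y ≤ col x := by
  induction hxy with
  | refl => exact le_rfl
  | tail _ h1 ih =>
    obtain ⟨a, rfl⟩ := h1
    exact (h.mono _ a).trans ih

theorem IsColoring.accepts_iff [Finite Q] {δ : Q → A → Q} {F : Set Q} {col : Q → ℕ}
    (h : IsColoring δ F col) (q : Q) (w : Stream' A) :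
    Accepts δ F q w ↔ ∃ᶠ i in atTop, col (runFrom δ q w i) % 2 = 1 := by
  obtain ⟨r, hr, hev⟩ := exists_eventually_mutual δ q w
  refine frequently_congr (hev.mono fun i hi => ?_)
  exact (h.parity _ ((hr.trans_right hi.2).trans_left hi.1)).symm

/-- The whole run lies on a closed path through `q`, so by weakness its states are all accepting or
all rejecting. -/
theorem accepts_cycle {δ : Q → A → Q} {F : Set Q} (hF : WeakSet δ F) {q : Q} {y : List A}
    (hy : y ≠ []) (hq : y.foldl δ q = q) : Accepts δ F q (Stream'.cycle y hy) ↔ q ∈ F := by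
  have hk : ∀ k, runFrom δ q (Stream'.cycle y hy) (y.length * k) = q := by
    intro k
    induction k with
    | zero => rfl
    | succ k ih =>
      rw [Stream'.cycle_eq, Nat.mul_succ, add_comm, runFrom_append, hq, ih]
  have hpos : 0 < y.length := List.length_pos_of_ne_nil hy
  have hmem : ∀ i, runFrom δ q (Stream'.cycle y hy) i ∈ F ↔ q ∈ F := by
    intro i
    refine hF.mem_iff ?_ (reflTransGen_runFrom δ q _ (Nat.zero_le i))
    have := reflTransGen_runFrom δ q (Stream'.cycle y hy)
      (show i ≤ y.length * i from Nat.le_mul_of_pos_left i hpos)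
    rwa [hk] at this
  simp only [Accepts, hmem, frequently_const]

theorem exists_foldl_pow [Finite Q] (δ : Q → A → Q) (q : Q) (x : List A) :
    ∃ i m : ℕ, 0 < m ∧ ((fun s => x.foldl δ s)^[m]) (((fun s => x.foldl δ s)^[i]) q) =
      ((fun s => x.foldl δ s)^[i]) q := by
  obtain ⟨i, j, hij, h⟩ := Finite.exists_ne_map_eq_of_infinite
    (fun i : ℕ => ((fun s => x.foldl δ s)^[i]) q)
  wlog hlt : i < j generalizing i j
  · exact this j i hij.symm h.symm (by omega)
  refine ⟨i, j - i, by omega, ?_⟩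
  rw [← Function.iterate_add_apply, Nat.sub_add_cancel hlt.le]
  exact h.symm

theorem foldl_flatten_replicate (δ : Q → A → Q) (q : Q) (x : List A) (m : ℕ) :
    (List.replicate m x).flatten.foldl δ q = ((fun s => x.foldl δ s)^[m]) q := by
  induction m generalizing q with
  | zero => rfl
  | succ m ih => rw [List.replicate_succ, List.flatten_cons, List.foldl_append, ih]; rfl

/-- Induction on the color. A state of color `c + 1` reaches a cycle of the same color; the word
read around that cycle eventually loops from the equivalent state as well. The induction hypothesis
below the cycle shows that this second loop has color at least `c`, and acceptance of the periodic
word shows that it has the parity of `c + 1`. -/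
theorem IsColoring.le_of_accepts [Finite Q] {δ : Q → A → Q} {F : Set Q} (hF : WeakSet δ F)
    {col : Q → ℕ} (h : IsColoring δ F col) (c : ℕ) :
    ∀ p q, col p = c → (∀ w, Accepts δ F p w ↔ Accepts δ F q w) → c ≤ col q := by
  induction c with
  | zero => intros; omega
  | succ c ih =>
    intro p q hp hpq
    have hstep : ∀ {p q}, (∀ w, Accepts δ F p w ↔ Accepts δ F q w) → ∀ u : List A, ∀ w,
        (Accepts δ F (u.foldl δ p) w ↔ Accepts δ F (u.foldl δ q) w) := by
      intro p q hpq u w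
      rw [← accepts_append, ← accepts_append, hpq]
    obtain ⟨p', hpp', hrec, hcol, hlow⟩ := h.min p (by omega)
    obtain ⟨u, rfl⟩ := (reflTransGen_iff_foldl δ _ _).1 hpp'
    obtain ⟨x, hx, hx'⟩ := (transGen_iff_foldl δ _ _).1 hrec
    have h1 := hstep hpq u
    set p' := u.foldl δ p
    -- Repeating `x` from the companion state becomes periodic after `i` rounds, with period `m`.
    -- Meanwhile `p'` stays where it is, so it is equivalent to the state `q''` reached after these
    -- `i` rounds.
    obtain ⟨i, m, hm, him⟩ := exists_foldl_pow δ (u.foldl δ q) x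
    have hloop : ∀ j, (List.replicate j x).flatten.foldl δ p' = p' := by
      intro j
      rw [foldl_flatten_replicate]
      exact Function.iterate_fixed hx' j
    have h2 := hstep h1 (List.replicate i x).flatten
    rw [hloop] at h2
    have hq'' : ReflTransGen (Edge δ) q ((List.replicate i x).flatten.foldl δ (u.foldl δ q)) :=
      (reflTransGen_iff_foldl δ _ _).2 ⟨u ++ (List.replicate i x).flatten, by rw [List.foldl_append]⟩
    rw [foldl_flatten_replicate] at h2 hq''
    set q'' := ((fun s => x.foldl δ s)^[i]) (u.foldl δ q)
    have hy : (List.replicate m x).flatten ≠ [] := by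
      cases m with
      | zero => omega
      | succ m => simp [List.replicate_succ, hx]
    have hqy : (List.replicate m x).flatten.foldl δ q'' = q'' := by
      rw [foldl_flatten_replicate, him]
    have h3 := h2 (Stream'.cycle _ hy)
    rw [accepts_cycle hF hy (hloop m), accepts_cycle hF hy hqy] at h3
    have hrec'' : TransGen (Edge δ) q'' q'' := (transGen_iff_foldl δ _ _).2 ⟨_, hy, hqy⟩
    rw [← h.parity _ hrec, ← h.parity _ hrec'', hcol, hp] at h3
    have h4 : c ≤ col q'' := by
      rcases hlow with h5 | ⟨z, hz, hz'⟩
      · omega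
      · obtain ⟨v, rfl⟩ := (reflTransGen_iff_foldl δ _ _).1 hz
        have h6 := ih _ (v.foldl δ q'') (by omega) (hstep h2 v)
        exact h6.trans (h.mono' ((reflTransGen_iff_foldl δ _ _).2 ⟨v, rfl⟩))
    have h7 := h.mono' hq''
    omega

/-- Two states accept the same words iff all finite words lead to states with colors of the same
parity. -/
theorem IsColoring.forall_accepts_iff [Finite Q] {δ : Q → A → Q} {F : Set Q} (hF : WeakSet δ F)
    {col : Q → ℕ} (h : IsColoring δ F col) (p q : Q) :
    (∀ w, Accepts δ F p w ↔ Accepts δ F q w) ↔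
      ∀ u : List A, col (u.foldl δ p) % 2 = col (u.foldl δ q) % 2 := by
  constructor
  · intro hpq u
    have hu : ∀ w, Accepts δ F (u.foldl δ p) w ↔ Accepts δ F (u.foldl δ q) w := fun w => by
      rw [← accepts_append, ← accepts_append, hpq]
    have h1 := h.le_of_accepts hF _ _ _ rfl hu
    have h2 := h.le_of_accepts hF _ _ _ rfl fun w => (hu w).symm
    rw [le_antisymm h1 h2]
  · intro hu w
    rw [h.accepts_iff, h.accepts_iff]
    simp only [runFrom_eq_foldl, hu]

end Weak

end SeqRVA

namespace SeqRVA

/-! ### Counting digits in words -/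

section Count

variable {b : ℕ}

/-- The number of digits among the first `i` letters. -/
def digitCount (w : Stream' (WithStar (Fin b))) : ℕ → ℕ
  | 0 => 0
  | i + 1 => digitCount w i + if w i = none then 0 else 1

/-- Replace by `z` each `d`-th digit, starting with digit number `d - 1`. -/
def fixDigits (d : ℕ) (z : Fin b) (w : Stream' (WithStar (Fin b))) : Stream' (WithStar (Fin b)) :=
  fun i => if w i = none then none else if d ∣ digitCount w i + 1 then some z else w i

/-- The number of digits before position `i` if the separator is at position `m`. -/
def digitIndex (m i : ℕ) : ℕ := if i ≤ m then i else i - 1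

/-- The position of digit number `i` if the separator is at position `m`. -/
def digitPos (m i : ℕ) : ℕ := if i < m then i else i + 1

theorem fixDigits_eq_none {d : ℕ} {z : Fin b} {w : Stream' (WithStar (Fin b))} {i : ℕ} :
    fixDigits d z w i = none ↔ w i = none := by
  simp only [fixDigits]
  split_ifs <;> simp_all

theorem digitCount_congr {w w' : Stream' (WithStar (Fin b))} (h : ∀ i, w i = none ↔ w' i = none)
    (i : ℕ) : digitCount w i = digitCount w' i := by
  induction i with
  | zero => rfl
  | succ i ih => simp only [digitCount, ih, h]

theorem starAt_of_ne {m i : ℕ} (x : Stream' (Fin b)) (h : i ≠ m) :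
    starAt m x i = some (x (digitIndex m i)) := by
  simp only [starAt, digitIndex]
  split_ifs <;> first | rfl | omega

theorem starAt_digitPos (m i : ℕ) (x : Stream' (Fin b)) :
    starAt m x (digitPos m i) = some (x i) := by
  simp only [starAt, digitPos]
  split_ifs <;> first | rfl | omega

theorem digitCount_drop_starAt (m a : ℕ) (x : Stream' (Fin b)) (i : ℕ) :
    digitCount ((starAt m x).drop a) i + digitIndex m a = digitIndex m (a + i) := by
  induction i with
  | zero => simp [digitCount]
  | succ i ih =>
    have h : (starAt m x).drop a i = none ↔ a + i = m := by
      rw [add_comm]; exact starAt_eq_none_iff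
    simp only [digitCount, h]
    simp only [digitIndex] at ih ⊢
    split_ifs at ih ⊢ <;> omega

/-- A dual switch is rewritten as something an automaton can guess and follow: a prefix, one altered
digit, and a tail `w` of which each `d`-th digit is overwritten. Separators are skipped in the
counting, so it does not matter on which side of the separator the switch starts. The tail `w` may
be arbitrary because words of the wrong shape are outside `L`. -/
theorem flatDual_iff {L : Set (Stream' (WithStar (Fin b)))} {d : ℕ} (z l : Fin b)
    (hz : (z : ℕ) = 0) (hl : (l : ℕ) + 1 = b) (hL : ∀ w ∈ L, ∃ m x, d ∣ m ∧ w = starAt m x) :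
    (∀ m t x x', d ∣ m → FlatDual d t x x' → (starAt m x ∈ L ↔ starAt m x' ∈ L)) ↔
      ∀ (p : List (WithStar (Fin b))) (j i : Fin b) (w : Stream' (WithStar (Fin b))),
        (j : ℕ) = i + 1 → (p ++ₛ (Stream'.cons (some j) (fixDigits d z w)) ∈ L ↔
          p ++ₛ (Stream'.cons (some i) (fixDigits d l w)) ∈ L) := by
  constructor
  · intro h p j i w hji
    set y := p ++ₛ (Stream'.cons (some j) (fixDigits d z w)) with hy
    set y' := p ++ₛ (Stream'.cons (some i) (fixDigits d l w)) with hy'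
    have hy1 : ∀ k < p.length, y k = y' k := fun k hk =>
      (Stream'.get_append_left k p _ hk).trans (Stream'.get_append_left k p _ hk).symm
    have hy2 : y p.length = some j := Stream'.get_append_right 0 p _
    have hy2' : y' p.length = some i := Stream'.get_append_right 0 p _
    have hy3 : ∀ k, y (p.length + 1 + k) = fixDigits d z w k := fun k => by
      rw [add_assoc, add_comm 1]; exact Stream'.get_append_right (k + 1) p _
    have hy3' : ∀ k, y' (p.length + 1 + k) = fixDigits d l w k := fun k => by
      rw [add_assoc, add_comm 1]; exact Stream'.get_append_right (k + 1) p _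
    -- Overwriting digits does not move separators. So if one of the two words is in `L`, both have
    -- exactly one separator, at the same position.
    have hnone : ∀ k, y k = none ↔ y' k = none := by
      intro k
      rcases lt_trichotomy k p.length with hk | rfl | hk
      · rw [hy1 k hk]
      · simp [hy2, hy2']
      · obtain ⟨k, rfl⟩ : ∃ j, k = p.length + 1 + j := ⟨k - (p.length + 1), by omega⟩
        rw [hy3, hy3', fixDigits_eq_none, fixDigits_eq_none]
    have key : ∀ m x x', y = starAt m x → y' = starAt m x' →
        FlatDual d (digitIndex m p.length) x x' := by
      intro m x x' hx hx'
      have hpm : p.length ≠ m := by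
        intro hpm
        have := (starAt_eq_none_iff (x := x)).2 hpm
        rw [← hx, hy2] at this
        exact absurd this (by simp)
      have hxk : ∀ k, y (digitPos m k) = some (x k) := fun k => by rw [hx, starAt_digitPos]
      have hxk' : ∀ k, y' (digitPos m k) = some (x' k) := fun k => by rw [hx', starAt_digitPos]
      have hpos : digitPos m (digitIndex m p.length) = p.length := by
        simp only [digitPos, digitIndex]; split_ifs <;> omega
      refine ⟨fun k hk => ?_, ?_, fun k hk => ?_⟩
      · have hlt : digitPos m k < p.length := by
          simp only [digitPos, digitIndex] at hk ⊢; split_ifs at hk ⊢ <;> omega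
        have := hy1 _ hlt
        rw [hxk, hxk'] at this
        exact Option.some.inj this
      · have h1 := hxk (digitIndex m p.length)
        have h2 := hxk' (digitIndex m p.length)
        rw [hpos, hy2] at h1
        rw [hpos, hy2'] at h2
        rw [← Option.some.inj h1, ← Option.some.inj h2, hji]
      · obtain ⟨e, he⟩ : ∃ e, digitPos m k = p.length + 1 + e := by
          refine ⟨digitPos m k - (p.length + 1), ?_⟩
          simp only [digitPos, digitIndex] at hk ⊢; split_ifs at hk ⊢ <;> omega
        have h1 := hxk k
        have h2 := hxk' k
        rw [he, hy3] at h1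
        rw [he, hy3'] at h2
        have hdrop : (starAt m x).drop (p.length + 1) = fixDigits d z w := by
          funext e
          rw [← hx, ← hy3]; exact Stream'.get_drop e (p.length + 1) y
        have hcnt := digitCount_drop_starAt m (p.length + 1) x e
        rw [hdrop, digitCount_congr (w' := w) (fun _ => fixDigits_eq_none), ← he] at hcnt
        have hc : digitCount w e + 1 = k - digitIndex m p.length := by
          simp only [digitPos, digitIndex] at hcnt hk ⊢
          split_ifs at hcnt hk ⊢ <;> omega
        simp only [fixDigits, hc] at h1 h2
        split_ifs at h1 h2 ⊢
        · rw [← Option.some.inj h1, ← Option.some.inj h2]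
          exact ⟨hz, hl⟩
        · exact Option.some.inj (h1.symm.trans h2)
    constructor
    · intro hmem
      obtain ⟨m, x, hm, hx⟩ := hL _ hmem
      obtain ⟨x', hx'⟩ := exists_eq_starAt (w := y') (m := m) fun k => by
        rw [← hnone, hx, starAt_eq_none_iff]
      rw [hx']
      rw [hx] at hmem
      exact (h m _ x x' hm (key m x x' hx hx')).1 hmem
    · intro hmem
      obtain ⟨m, x', hm, hx'⟩ := hL _ hmem
      obtain ⟨x, hx⟩ := exists_eq_starAt (w := y) (m := m) fun k => by
        rw [hnone, hx', starAt_eq_none_iff]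
      rw [hx]
      rw [hx'] at hmem
      exact (h m _ x x' hm (key m x x' hx hx')).2 hmem
  · rintro h m t x x' hm ⟨h1, h2, h3⟩
    set P := digitPos m t with hP
    have hPm : P ≠ m := by
      simp only [hP, digitPos]; split_ifs <;> omega
    have hind : digitIndex m (P + 1) = t + 1 := by
      simp only [hP, digitPos, digitIndex]; split_ifs <;> omega
    have hw := h ((starAt m x).take P) (x t) (x' t) ((starAt m x).drop (P + 1)) h2
    have hi : ∀ e, P + 1 + e ≠ m → digitIndex m (P + 1 + e) > t := fun e he => by
      simp only [hP, digitPos, digitIndex] at he ⊢; split_ifs at he ⊢ <;> omega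
    have hcnt := digitCount_drop_starAt m (P + 1) x
    rw [hind] at hcnt
    have hdrop : ∀ (x : Stream' (Fin b)) e, (starAt m x).drop (P + 1) e = starAt m x (P + 1 + e) :=
      fun x e => Stream'.get_drop e (P + 1) (starAt m x)
    have e1 : fixDigits d z ((starAt m x).drop (P + 1)) = (starAt m x).drop (P + 1) := by
      funext e
      simp only [fixDigits, hdrop]
      split_ifs with h4 h5
      · exact h4.symm
      · rw [starAt_eq_none_iff] at h4
        have h6 := h3 _ (hi e h4)
        rw [if_pos (by rwa [← hcnt, show ∀ c, c + (t + 1) - t = c + 1 by intro c; omega])] at h6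
        rw [starAt_of_ne x h4]
        congr 1
        ext
        rw [h6.1, hz]
      · rfl
    have e2 : fixDigits d l ((starAt m x).drop (P + 1)) = (starAt m x').drop (P + 1) := by
      funext e
      simp only [fixDigits, hdrop]
      split_ifs with h4 h5
      · rw [starAt_eq_none_iff] at h4
        exact (starAt_eq_none_iff.2 h4).symm
      · rw [starAt_eq_none_iff] at h4
        have h6 := h3 _ (hi e h4)
        rw [if_pos (by rwa [← hcnt, show ∀ c, c + (t + 1) - t = c + 1 by intro c; omega])] at h6
        rw [starAt_of_ne x' h4]
        congr 1
        ext
        omega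
      · rw [starAt_eq_none_iff] at h4
        have h6 := h3 _ (hi e h4)
        rw [if_neg (by rwa [← hcnt, show ∀ c, c + (t + 1) - t = c + 1 by intro c; omega])] at h6
        rw [starAt_of_ne x h4, starAt_of_ne x' h4, h6]
    have hsplit : ∀ x : Stream' (Fin b), (starAt m x).take P ++ₛ
        Stream'.cons (some (x t)) ((starAt m x).drop (P + 1)) = starAt m x := by
      intro x
      conv_rhs => rw [← Stream'.append_take_drop P (starAt m x)]
      congr 1
      rw [← Stream'.eta ((starAt m x).drop P), Stream'.tail_drop', Stream'.head_drop]
      congr 1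
      exact (starAt_digitPos m t x).symm
    have htake : (starAt m x).take P = (starAt m x').take P := by
      refine List.ext_getElem (by simp) fun i hi _ => ?_
      rw [Stream'.length_take] at hi
      simp only [Stream'.take_get, Stream'.get]
      by_cases him : i = m
      · rw [starAt_eq_none_iff.2 him, starAt_eq_none_iff.2 him]
      · rw [starAt_of_ne x him, starAt_of_ne x' him, h1]
        simp only [hP, digitPos, digitIndex] at hi ⊢; split_ifs at hi ⊢ <;> omega
    rwa [e1, e2, hsplit x, htake, hsplit x'] at hw

end Count

end SeqRVA

namespace SeqRVA

open Filter Relation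

/-! ### Reduction to the equivalence of two states of one automaton

The states are triples of a kind, a state of the given automaton and a number less than `d`. The
kinds, which never decrease along transitions, are: the two start states to be compared (`0`, `1`),
two simulations of the automaton (`2`, `3`) that may branch off by a letter `b + j` to compare two
expansions of a component (`6`, `7`), the search for accepted words that are not encodings (before
the separator: `4`, after it: `5`), the automaton itself (`8`), and the empty language (`9`). -/

/-- The kind of the successor. -/
def bigKind (b k g a : ℕ) : ℕ :=
  if k = 0 then (if a = 0 then 2 else if a = 1 then 8 else 4)
  else if k = 1 then (if a = 0 then 3 else if a = 1 then 8 else 9)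
  else if k = 2 then (if b < a then 6 else 2)
  else if k = 3 then (if b < a then 7 else 3)
  else if k = 4 then (if a < b then 4 else if g = 0 then 5 else 8)
  else if k = 5 then (if a < b then 5 else 8)
  else k

/-- The letter that the underlying automaton reads. -/
def bigLetter (b k g a : ℕ) : ℕ :=
  if k = 2 then (if b < a then a - b else a)
  else if k = 3 then (if b < a then a - b - 1 else a)
  else if k = 6 then (if a < b then (if g = 0 then 0 else a) else b)
  else if k = 7 then (if a < b then (if g = 0 then b - 1 else a) else b)
  else if a < b then a else b

/-- The number of digits that precede the next digit of the distinguished component. -/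
def bigPhase (b d k g a : ℕ) : ℕ :=
  if k < 2 then 0
  else if k < 4 then (if b < a then d - 1 else g)
  else if a < b then (if g = 0 then d - 1 else g - 1)
  else g

theorem bigKind_lt {b k g a : ℕ} (hk : k < 10) : bigKind b k g a < 10 := by
  simp only [bigKind]; split_ifs <;> omega

theorem bigPhase_lt {b d k g a : ℕ} (hg : g < d) : bigPhase b d k g a < d := by
  simp only [bigPhase]; split_ifs <;> omega

section Big

variable {b d n : ℕ}

/-- The transitions; `qz` is the state reached by a zero vector. -/
def bigStep (M : BuchiAutomaton (Fin n) (WithStar (Fin b))) (qz : Fin n)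
    (x : Fin 10 × Fin n × Fin d) (a : Fin (2 * b)) : Fin 10 × Fin n × Fin d :=
  (⟨bigKind b x.1 x.2.2 a, bigKind_lt x.1.isLt⟩,
    if (x.1 : ℕ) < 2 then (if (x.1 : ℕ) = 1 ∧ (a : ℕ) = 1 then qz else M.start)
    else M.step x.2.1 (Ram.letterOfNat b (bigLetter b x.1 x.2.2 a)),
    ⟨bigPhase b d x.1 x.2.2 a, bigPhase_lt x.2.2.isLt⟩)

/-- The accepting states. -/
def bigAccept (d : ℕ) (M : BuchiAutomaton (Fin n) (WithStar (Fin b))) :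
    Set (Fin 10 × Fin n × Fin d) :=
  {x | ((x.1 : ℕ) = 4 ∨ 6 ≤ (x.1 : ℕ) ∧ (x.1 : ℕ) ≤ 8) ∧ x.2.1 ∈ M.accept}

variable (M : BuchiAutomaton (Fin n) (WithStar (Fin b))) (qz : Fin n)

theorem mem_bigAccept {x : Fin 10 × Fin n × Fin d} : x ∈ bigAccept d M ↔
    ((x.1 : ℕ) = 4 ∨ 6 ≤ (x.1 : ℕ) ∧ (x.1 : ℕ) ≤ 8) ∧ x.2.1 ∈ M.accept := Iff.rfl

theorem bigStep_reach {x y : Fin 10 × Fin n × Fin d}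
    (h : ReflTransGen (Edge (bigStep M qz)) x y) : (x.1 : ℕ) ≤ y.1 ∧
      (2 ≤ (x.1 : ℕ) → ReflTransGen (Edge M.step) x.2.1 y.2.1) := by
  induction h with
  | refl => exact ⟨le_rfl, fun _ => .refl⟩
  | @tail y z _ h ih =>
    obtain ⟨a, rfl⟩ := h
    have h1 : (y.1 : ℕ) ≤ bigKind b y.1 y.2.2 a := by
      simp only [bigKind]; split_ifs <;> omega
    refine ⟨ih.1.trans h1, fun h2 => (ih.2 h2).tail
      ⟨Ram.letterOfNat b (bigLetter b y.1 y.2.2 a), ?_⟩⟩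
    simp [bigStep, show ¬ (y.1 : ℕ) < 2 by omega]

/-- Since kinds never decrease, states that reach each other have the same kind. Accepting kinds are
at least 4, where every transition follows one of `M`, so the underlying states also reach each
other. -/
theorem weakSet_bigAccept (h : WeakSet M.step M.accept) :
    WeakSet (bigStep M qz) (bigAccept d M) := by
  rintro x y hxy hyx ⟨h1, h2⟩
  have h3 := bigStep_reach M qz hxy
  have h4 := bigStep_reach M qz hyx
  exact ⟨by omega, h _ _ (h3.2 (by omega)) (h4.2 (by omega)) h2⟩

/-- The word over the original alphabet. -/
def proj (w : Stream' (Fin (2 * b))) : Stream' (WithStar (Fin b)) :=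
  w.map fun a : Fin (2 * b) => Ram.letterOfNat b a

/-- The number of a letter. -/
def code (y : WithStar (Fin b)) (hb : 2 ≤ b) : Fin (2 * b) :=
  match y with
  | none => ⟨b, by omega⟩
  | some i => ⟨i, by have := i.isLt; omega⟩

theorem letterOfNat_code (hb : 2 ≤ b) (y : WithStar (Fin b)) :
    Ram.letterOfNat b (code y hb) = y := by
  cases y <;> simp [code, Ram.letterOfNat]

theorem code_le (hb : 2 ≤ b) (y : WithStar (Fin b)) : (code y hb : ℕ) ≤ b := by
  cases y with
  | none => simp [code]
  | some i => exact i.isLt.le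

theorem letterOfNat_eq_none {i : ℕ} : Ram.letterOfNat b i = none ↔ b ≤ i := by
  simp only [Ram.letterOfNat]
  split_ifs <;> simp <;> omega

theorem letterOfNat_min {i : ℕ} :
    Ram.letterOfNat b (if i < b then i else b) = Ram.letterOfNat b i := by
  simp only [Ram.letterOfNat]
  split_ifs <;> first | rfl | omega

theorem proj_eq_none {w : Stream' (Fin (2 * b))} {i : ℕ} : proj w i = none ↔ b ≤ (w i : ℕ) :=
  letterOfNat_eq_none

theorem exists_proj_eq (hb : 2 ≤ b) (w : Stream' (WithStar (Fin b))) : ∃ W, proj W = w := by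
  refine ⟨w.map fun y => code y hb, ?_⟩
  funext i
  exact letterOfNat_code hb (w i)

/-! #### The kinds of states -/

theorem runFrom_plain {x : Fin 10 × Fin n × Fin d} (hx : (x.1 : ℕ) = 8)
    (W : Stream' (Fin (2 * b))) (i : ℕ) :
    ((runFrom (bigStep M qz) x W i).1 : ℕ) = 8 ∧
      (runFrom (bigStep M qz) x W i).2.1 = runFrom M.step x.2.1 (proj W) i := by
  induction i with
  | zero => exact ⟨hx, rfl⟩
  | succ i ih =>
    simp only [runFrom, bigStep, ih.1, ih.2]
    refine ⟨by simp [bigKind], ?_⟩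
    simp [bigLetter, letterOfNat_min]
    rfl

theorem accepts_plain {x : Fin 10 × Fin n × Fin d} (hx : (x.1 : ℕ) = 8)
    (W : Stream' (Fin (2 * b))) : Accepts (bigStep M qz) (bigAccept d M) x W ↔
      Accepts M.step M.accept x.2.1 (proj W) := by
  refine frequently_congr (Eventually.of_forall fun i => ?_)
  obtain ⟨h1, h2⟩ := runFrom_plain M qz hx W i
  simp [mem_bigAccept, h1, h2]

theorem not_accepts_dead {x : Fin 10 × Fin n × Fin d} (hx : (x.1 : ℕ) = 9)
    (W : Stream' (Fin (2 * b))) : ¬ Accepts (bigStep M qz) (bigAccept d M) x W := by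
  have h : ∀ i, ((runFrom (bigStep M qz) x W i).1 : ℕ) = 9 := by
    intro i
    induction i with
    | zero => exact hx
    | succ i ih => simp [runFrom, bigStep, ih, bigKind]
  simp [Accepts, mem_bigAccept, h]

theorem dvd_phase_step {g c : ℕ} (hg : g < d) (h : d ∣ g + c) :
    d ∣ (if g = 0 then d - 1 else g - 1) + (c + 1) := by
  split_ifs with h0
  · rw [show d - 1 + (c + 1) = d + (g + c) by omega]
    exact (Nat.dvd_add_right (dvd_refl d)).2 h
  · rwa [show g - 1 + (c + 1) = g + c by omega]

theorem phase_eq_zero_iff {g c : ℕ} (hg : g < d) (h : d ∣ g + c) : g = 0 ↔ d ∣ c := by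
  constructor
  · rintro rfl; simpa using h
  · intro hc
    exact Nat.eq_zero_of_dvd_of_lt ((Nat.dvd_add_left hc).1 h) hg

/-- The phase counts down modulo `d` at each digit and pauses at separators. Starting from `d - 1`,
it is 0 exactly at the digits whose distance, counted in digits, from the branching digit is a
multiple of `d`; those are replaced by `z`. -/
theorem accepts_dual {x : Fin 10 × Fin n × Fin d} {z : Fin b}
    (hx : (x.1 : ℕ) = 6 ∧ (z : ℕ) = 0 ∨ (x.1 : ℕ) = 7 ∧ (z : ℕ) = b - 1)
    (hg : (x.2.2 : ℕ) = d - 1) (W : Stream' (Fin (2 * b))) :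
    Accepts (bigStep M qz) (bigAccept d M) x W ↔
      Accepts M.step M.accept x.2.1 (fixDigits d z (proj W)) := by
  have key : ∀ i, (runFrom (bigStep M qz) x W i).1 = x.1 ∧
      (runFrom (bigStep M qz) x W i).2.1 = runFrom M.step x.2.1 (fixDigits d z (proj W)) i ∧
      d ∣ ((runFrom (bigStep M qz) x W i).2.2 : ℕ) + (digitCount (proj W) i + 1) := by
    intro i
    induction i with
    | zero =>
      refine ⟨rfl, rfl, ?_⟩
      have := x.2.2.isLt
      simp only [runFrom, hg, digitCount]
      rw [show d - 1 + (0 + 1) = d by omega]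
    | succ i ih =>
      obtain ⟨h1, h2, h3⟩ := ih
      have hk : (x.1 : ℕ) = 6 ∨ (x.1 : ℕ) = 7 := by omega
      have hlt := (runFrom (bigStep M qz) x W i).2.2.isLt
      have h0 := phase_eq_zero_iff hlt h3
      have hval := (W i).isLt
      refine ⟨?_, ?_, ?_⟩
      · ext
        simp only [runFrom, bigStep, h1]
        rcases hk with hk | hk <;> simp [bigKind, hk]
      · simp only [runFrom, bigStep, h1, h2]
        rw [if_neg (by omega)]
        congr 1
        change _ = fixDigits d z (proj W) i
        simp only [fixDigits, proj_eq_none, ← h0]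
        have hl : bigLetter b x.1 (runFrom (bigStep M qz) x W i).2.2 (W.get i) =
            if (W.get i : ℕ) < b then (if ((runFrom (bigStep M qz) x W i).2.2 : ℕ) = 0 then (z : ℕ)
              else W.get i) else b := by
          rcases hx with ⟨hx, hz⟩ | ⟨hx, hz⟩ <;> simp [bigLetter, hx, hz]
        rw [hl]
        change Ram.letterOfNat b (if (W i : ℕ) < b then
          (if ((runFrom (bigStep M qz) x W i).2.2 : ℕ) = 0 then (z : ℕ) else W i) else b) = _
        by_cases ha : (W i : ℕ) < b
        · rw [if_pos ha, if_neg (show ¬ b ≤ (W i : ℕ) by omega)]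
          split_ifs
          · simp [Ram.letterOfNat]
          · rfl
        · rw [if_neg ha, if_pos (show b ≤ (W i : ℕ) by omega), letterOfNat_eq_none]
      · simp only [runFrom, bigStep, h1, digitCount, proj_eq_none, bigPhase]
        rw [if_neg (by omega), if_neg (by omega)]
        by_cases ha : (W i : ℕ) < b
        · rw [if_pos (show ((W.get i : Fin (2 * b)) : ℕ) < b from ha),
            if_neg (show ¬ b ≤ (W i : ℕ) by omega)]
          exact dvd_phase_step hlt h3
        · rw [if_neg (show ¬ ((W.get i : Fin (2 * b)) : ℕ) < b from ha),
            if_pos (show b ≤ (W i : ℕ) by omega)]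
          exact h3
  refine frequently_congr (Eventually.of_forall fun i => ?_)
  obtain ⟨h1, h2, -⟩ := key i
  rw [mem_bigAccept, h1, h2]
  exact and_iff_right (by omega)

theorem runFrom_after {x : Fin 10 × Fin n × Fin d} (hx : (x.1 : ℕ) = 5)
    (W : Stream' (Fin (2 * b))) (i : ℕ) (h : ∀ j < i, proj W j ≠ none) :
    ((runFrom (bigStep M qz) x W i).1 : ℕ) = 5 ∧
      (runFrom (bigStep M qz) x W i).2.1 = runFrom M.step x.2.1 (proj W) i := by
  induction i with
  | zero => exact ⟨hx, rfl⟩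
  | succ i ih =>
    obtain ⟨h1, h2⟩ := ih fun j hj => h j (by omega)
    have h3 := h i (by omega)
    rw [Ne, proj_eq_none, not_le] at h3
    simp only [runFrom, bigStep, h1, h2]
    refine ⟨by simp [bigKind, Stream'.get, h3], ?_⟩
    simp [bigLetter, letterOfNat_min]
    rfl

theorem runFrom_before {x : Fin 10 × Fin n × Fin d} (hx : (x.1 : ℕ) = 4) (hg : (x.2.2 : ℕ) = 0)
    (W : Stream' (Fin (2 * b))) (i : ℕ) (h : ∀ j < i, proj W j ≠ none) :
    ((runFrom (bigStep M qz) x W i).1 : ℕ) = 4 ∧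
      (runFrom (bigStep M qz) x W i).2.1 = runFrom M.step x.2.1 (proj W) i ∧
      d ∣ ((runFrom (bigStep M qz) x W i).2.2 : ℕ) + i := by
  induction i with
  | zero => exact ⟨hx, rfl, by simp [runFrom, hg]⟩
  | succ i ih =>
    obtain ⟨h1, h2, h3⟩ := ih fun j hj => h j (by omega)
    have h4 := h i (by omega)
    rw [Ne, proj_eq_none, not_le] at h4
    have hlt := (runFrom (bigStep M qz) x W i).2.2.isLt
    have := dvd_phase_step hlt h3
    simp only [runFrom, bigStep, h1, h2]
    refine ⟨by simp [bigKind, Stream'.get, h4], ?_, ?_⟩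
    · simp [bigLetter, letterOfNat_min]
      rfl
    · simpa [bigPhase, Stream'.get, h4] using this

theorem proj_drop (W : Stream' (Fin (2 * b))) (i : ℕ) : proj (W.drop i) = (proj W).drop i := rfl

theorem accepts_after {x : Fin 10 × Fin n × Fin d} (hx : (x.1 : ℕ) = 5)
    (W : Stream' (Fin (2 * b))) : Accepts (bigStep M qz) (bigAccept d M) x W ↔
      (∃ i, proj W i = none) ∧ Accepts M.step M.accept x.2.1 (proj W) := by
  classical
  by_cases h : ∃ i, proj W i = none
  · obtain ⟨h1, h2⟩ := runFrom_after M qz hx W (Nat.find h) fun j hj => Nat.find_min h hj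
    have h3 := Nat.find_spec h
    set P := Nat.find h
    have h3' := proj_eq_none.1 h3
    rw [accepts_drop (bigStep M qz) _ x W (P + 1), accepts_plain]
    · simp only [h, true_and]
      rw [accepts_drop M.step _ x.2.1 (proj W) (P + 1), proj_drop]
      simp only [runFrom, bigStep, h1, h2]
      simp [bigLetter, letterOfNat_min]
      rfl
    · simp [runFrom, bigStep, h1, bigKind, Stream'.get, h3'.not_gt]
  · simp only [h, false_and, iff_false]
    push Not at h
    simp [Accepts, mem_bigAccept, runFrom_after M qz hx W _ fun j _ => h j]

/-- Only kind 5 suspends acceptance: it is entered by a first separator after a multiple of `d`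
digits and left only by a second separator. A missing, misplaced or repeated separator leaves the
run finally in kind 4 or 8, where acceptance is that of `M`. -/
theorem accepts_before {x : Fin 10 × Fin n × Fin d} (hx : (x.1 : ℕ) = 4) (hg : (x.2.2 : ℕ) = 0)
    (W : Stream' (Fin (2 * b))) : Accepts (bigStep M qz) (bigAccept d M) x W ↔
      (¬ ∃ m y, d ∣ m ∧ proj W = starAt m y) ∧ Accepts M.step M.accept x.2.1 (proj W) := by
  classical
  by_cases h : ∃ i, proj W i = none
  · obtain ⟨h1, h2, h4⟩ := runFrom_before M qz hx hg W (Nat.find h) fun j hj => Nat.find_min h hj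
    have h3 := Nat.find_spec h
    have hmin : ∀ j < Nat.find h, proj W j ≠ none := fun j hj => Nat.find_min h hj
    set P := Nat.find h
    have h3' := proj_eq_none.1 h3
    have hphase := phase_eq_zero_iff (runFrom (bigStep M qz) x W P).2.2.isLt h4
    have hM : runFrom M.step x.2.1 (proj W) (P + 1) =
        (runFrom (bigStep M qz) x W (P + 1)).2.1 := by
      simp only [runFrom, bigStep, h1, h2]
      simp [bigLetter, letterOfNat_min]
      rfl
    have hkind : ((runFrom (bigStep M qz) x W (P + 1)).1 : ℕ) = if d ∣ P then 5 else 8 := by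
      simp [runFrom, bigStep, h1, bigKind, Stream'.get, h3'.not_gt, hphase]
    rw [accepts_drop (bigStep M qz) _ x W (P + 1), accepts_drop M.step _ x.2.1 (proj W) (P + 1), hM]
    by_cases hdP : d ∣ P
    · rw [if_pos hdP] at hkind
      rw [accepts_after M qz hkind, proj_drop]
      refine and_congr_left fun _ => ?_
      constructor
      · rintro ⟨i, hi⟩ ⟨m, y, hm, hy⟩
        have e1 := starAt_eq_none_iff.1 (hy ▸ h3)
        have e2 := starAt_eq_none_iff.1 (hy ▸ ((Stream'.get_drop i (P + 1) (proj W)).symm.trans hi))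
        omega
      · intro hn
        by_contra hcon
        push Not at hcon
        have hP : ∀ i, proj W i = none ↔ i = P := by
          refine fun i => ⟨fun hi => ?_, fun hi => hi ▸ h3⟩
          rcases lt_trichotomy i P with hlt | heq | hgt
          · exact absurd hi (hmin i hlt)
          · exact heq
          · obtain ⟨e, rfl⟩ : ∃ e, i = P + 1 + e := ⟨i - (P + 1), by omega⟩
            exact absurd ((Stream'.get_drop e (P + 1) (proj W)).trans hi) (hcon e)
        obtain ⟨y, hy⟩ := exists_eq_starAt hP
        exact hn ⟨P, y, hdP, hy⟩
    · rw [if_neg hdP] at hkind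
      rw [accepts_plain M qz hkind, proj_drop]
      refine (and_iff_right ?_).symm
      rintro ⟨m, y, hm, hy⟩
      have e1 := starAt_eq_none_iff.1 (hy ▸ h3)
      exact hdP (e1 ▸ hm)
  · have hno : ¬ ∃ m y, d ∣ m ∧ proj W = starAt m y := by
      rintro ⟨m, y, -, hy⟩
      exact h ⟨m, by rw [hy, starAt_eq_none_iff]⟩
    simp only [hno, not_false_eq_true, true_and]
    push Not at h
    refine frequently_congr (Eventually.of_forall fun i => ?_)
    obtain ⟨h1, h2, -⟩ := runFrom_before M qz hx hg W i fun j _ => h j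
    simp [mem_bigAccept, h1, h2]

theorem foldl_simulate {x : Fin 10 × Fin n × Fin d} (hx : (x.1 : ℕ) = 2 ∨ (x.1 : ℕ) = 3)
    (u : List (Fin (2 * b))) (hu : ∀ a ∈ u, (a : ℕ) ≤ b) :
    (u.foldl (bigStep M qz) x).1 = x.1 ∧ (u.foldl (bigStep M qz) x).2.1 =
      (u.map fun a : Fin (2 * b) => Ram.letterOfNat b a).foldl M.step x.2.1 := by
  induction u generalizing x with
  | nil => exact ⟨rfl, rfl⟩
  | cons a u ih =>
    have ha : ¬ b < (a : ℕ) := by simpa using hu a (by simp)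
    have h1 : (bigStep M qz x a).1 = x.1 := by
      ext
      rcases hx with hx | hx <;> simp [bigStep, bigKind, hx, ha]
    have h2 : (bigStep M qz x a).2.1 = M.step x.2.1 (Ram.letterOfNat b a) := by
      rcases hx with hx | hx <;> simp [bigStep, bigLetter, hx, ha]
    obtain ⟨h3, h4⟩ := ih (x := bigStep M qz x a) (by rwa [h1]) fun a' ha' => hu a' (by simp [ha'])
    simp only [List.foldl_cons, List.map_cons]
    exact ⟨h3.trans h1, by rw [h4, h2]⟩

theorem not_accepts_simulate {x : Fin 10 × Fin n × Fin d} (hx : (x.1 : ℕ) = 2 ∨ (x.1 : ℕ) = 3)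
    (W : Stream' (Fin (2 * b))) (hW : ∀ i, (W i : ℕ) ≤ b) :
    ¬ Accepts (bigStep M qz) (bigAccept d M) x W := by
  have h : ∀ i, (runFrom (bigStep M qz) x W i).1 = x.1 := by
    intro i
    rw [runFrom_eq_foldl]
    refine (foldl_simulate M qz hx _ fun a ha => ?_).1
    obtain ⟨j, hj, rfl⟩ := List.getElem_of_mem ha
    rw [Stream'.take_get]
    exact hW j
  have h2 : ¬ ((x.1 : ℕ) = 4 ∨ 6 ≤ (x.1 : ℕ) ∧ (x.1 : ℕ) ≤ 8) := by omega
  simp [Accepts, mem_bigAccept, h, h2]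

/-- The letter `b + j` compares the two expansions that start with `j` and `j - 1`. -/
theorem accepts_simulate {x : Fin 10 × Fin n × Fin d} (hx : (x.1 : ℕ) = 2 ∨ (x.1 : ℕ) = 3)
    (u : List (Fin (2 * b))) (hu : ∀ a ∈ u, (a : ℕ) ≤ b) (a : Fin (2 * b)) (ha : b < (a : ℕ))
    (j z : Fin b) (hj : (x.1 : ℕ) = 2 ∧ (j : ℕ) = a - b ∧ (z : ℕ) = 0 ∨
      (x.1 : ℕ) = 3 ∧ (j : ℕ) = a - b - 1 ∧ (z : ℕ) = b - 1) (W : Stream' (Fin (2 * b))) :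
    Accepts (bigStep M qz) (bigAccept d M) x (u ++ₛ Stream'.cons a W) ↔
      Accepts M.step M.accept x.2.1 ((u.map fun a : Fin (2 * b) => Ram.letterOfNat b a) ++ₛ
        Stream'.cons (some j) (fixDigits d z (proj W))) := by
  obtain ⟨h1, h2⟩ := foldl_simulate M qz hx u hu
  have hcons : ∀ {X : Type} (y : X) (s : Stream' X), Stream'.cons y s = [y] ++ₛ s := fun _ _ => rfl
  rw [accepts_append, accepts_append, hcons, hcons, accepts_append, accepts_append]
  simp only [List.foldl_cons, List.foldl_nil]
  set y := u.foldl (bigStep M qz) x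
  have hk : ((bigStep M qz y a).1 : ℕ) = 6 ∧ (z : ℕ) = 0 ∨
      ((bigStep M qz y a).1 : ℕ) = 7 ∧ (z : ℕ) = b - 1 := by
    rcases hj with ⟨hj, -, hz⟩ | ⟨hj, -, hz⟩
    · left; simp [bigStep, bigKind, h1, hj, ha, hz]
    · right; simp [bigStep, bigKind, h1, hj, ha, hz]
  have hg : ((bigStep M qz y a).2.2 : ℕ) = d - 1 := by
    rcases hj with ⟨hj, -, hz⟩ | ⟨hj, -, hz⟩ <;> simp [bigStep, bigPhase, h1, hj, ha]
  rw [accepts_dual M qz hk hg]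
  have hq : (bigStep M qz y a).2.1 =
      M.step ((u.map fun a : Fin (2 * b) => Ram.letterOfNat b a).foldl M.step x.2.1) (some j) := by
    have hl : ∀ i, (j : ℕ) = i → Ram.letterOfNat b i = some j := by
      rintro _ rfl
      simp [Ram.letterOfNat]
    rw [← h2]
    rcases hj with ⟨hj, hj', -⟩ | ⟨hj, hj', -⟩ <;>
      simp [bigStep, bigLetter, h1, hj, ha, hl _ hj', y]
  rw [hq]

/-- The first letter above `b` fixes the point of divergence and the digits there. Without such a
letter both runs stay in the rejecting kinds 2 and 3, so these words do not distinguish the states.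
-/
theorem accepts_simulate_iff (hb : 2 ≤ b) {x y : Fin 10 × Fin n × Fin d} (hx : (x.1 : ℕ) = 2)
    (hy : (y.1 : ℕ) = 3) (hxy : x.2.1 = y.2.1) (z l : Fin b) (hz : (z : ℕ) = 0)
    (hl : (l : ℕ) + 1 = b) :
    (∀ W, Accepts (bigStep M qz) (bigAccept d M) x W ↔
      Accepts (bigStep M qz) (bigAccept d M) y W) ↔
    ∀ (p : List (WithStar (Fin b))) (j i : Fin b) (w : Stream' (WithStar (Fin b))),
      (j : ℕ) = i + 1 → (Accepts M.step M.accept x.2.1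
          (p ++ₛ (Stream'.cons (some j) (fixDigits d z w))) ↔
        Accepts M.step M.accept x.2.1 (p ++ₛ (Stream'.cons (some i) (fixDigits d l w)))) := by
  constructor
  · intro h p j i w hji
    obtain ⟨W, rfl⟩ := exists_proj_eq hb w
    have hj := j.isLt
    have hu : ∀ a ∈ p.map fun y => code y hb, (a : ℕ) ≤ b := by
      simp only [List.mem_map]
      rintro _ ⟨y, -, rfl⟩
      exact code_le hb y
    have hp : (p.map fun y => code y hb).map (fun a : Fin (2 * b) => Ram.letterOfNat b a) = p := by
      simp [Function.comp_def, letterOfNat_code]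
    have h1 := h ((p.map fun y => code y hb) ++ₛ Stream'.cons ⟨b + j, by omega⟩ W)
    rw [accepts_simulate M qz (.inl hx) _ hu _ (by simp; omega) j z (.inl ⟨hx, by simp, hz⟩),
      accepts_simulate M qz (.inr hy) _ hu _ (by simp; omega) i l
        (.inr ⟨hy, by simp; omega, by omega⟩), hp, ← hxy] at h1
    exact h1
  · intro h W
    by_cases hW : ∃ i, b < (W i : ℕ)
    · classical
      have h3 := Nat.find_spec hW
      have hmin : ∀ j < Nat.find hW, (W j : ℕ) ≤ b := fun j hj => not_lt.1 (Nat.find_min hW hj)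
      set P := Nat.find hW
      have hlt := (W P).isLt
      have hu : ∀ a ∈ W.take P, (a : ℕ) ≤ b := by
        intro a ha
        obtain ⟨j, hj, rfl⟩ := List.getElem_of_mem ha
        rw [Stream'.take_get]
        exact hmin j (by simpa using hj)
      have hsplit : W = W.take P ++ₛ Stream'.cons (W P) (W.drop (P + 1)) := by
        conv_lhs => rw [← Stream'.append_take_drop P W]
        congr 1
        rw [← Stream'.eta (W.drop P), Stream'.tail_drop', Stream'.head_drop]
        rfl
      rw [hsplit, accepts_simulate M qz (.inl hx) _ hu _ h3 ⟨W P - b, by omega⟩ z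
          (.inl ⟨hx, rfl, hz⟩), accepts_simulate M qz (.inr hy) _ hu _ h3 ⟨W P - b - 1, by omega⟩ l
        (.inr ⟨hy, rfl, by omega⟩), ← hxy]
      exact h _ _ _ _ (by simp; omega)
    · push Not at hW
      exact iff_of_false (not_accepts_simulate M qz (.inl hx) W hW)
        (not_accepts_simulate M qz (.inr hy) W hW)

/-- The first letter selects a test: 0 for dual switches, 1 for padding, any other for the shape of
accepted words. Together these are the conditions of `saturated_iff` and `flatDual_iff` and of being
`d`-sequential. -/
theorem forall_accepts_iff_isSeqRVA (hb : 2 ≤ b) (hd : 1 ≤ d) (z : Fin b) (hz : (z : ℕ) = 0)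
    (hqz : qz = (List.replicate d (some z)).foldl M.step M.start)
    {x y : Fin 10 × Fin n × Fin d} (hx : (x.1 : ℕ) = 0) (hy : (y.1 : ℕ) = 1) :
    (∀ W, Accepts (bigStep M qz) (bigAccept d M) x W ↔
      Accepts (bigStep M qz) (bigAccept d M) y W) ↔ IsSeqRVA d M := by
  have hcons : ∀ (a : Fin (2 * b)) s x, Accepts (bigStep M qz) (bigAccept d M) x (Stream'.cons a s) ↔
      Accepts (bigStep M qz) (bigAccept d M) (bigStep M qz x a) s :=
    fun a s x => accepts_append _ _ _ [a] s
  have hsplit : (∀ W, Accepts (bigStep M qz) (bigAccept d M) x W ↔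
      Accepts (bigStep M qz) (bigAccept d M) y W) ↔
      ∀ a W, Accepts (bigStep M qz) (bigAccept d M) (bigStep M qz x a) W ↔
        Accepts (bigStep M qz) (bigAccept d M) (bigStep M qz y a) W := by
    constructor
    · intro h a W
      rw [← hcons, ← hcons, h]
    · intro h W
      rw [← Stream'.eta W]
      exact (hcons _ _ _).trans ((h _ _).trans (hcons _ _ _).symm)
  -- From the start kinds all letters from 2 on behave alike, so letter 2 stands for them; it exists
  -- because `2 * b ≥ 4`.
  have hfin : (∀ a W, Accepts (bigStep M qz) (bigAccept d M) (bigStep M qz x a) W ↔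
        Accepts (bigStep M qz) (bigAccept d M) (bigStep M qz y a) W) ↔
      (∀ W, Accepts (bigStep M qz) (bigAccept d M) (bigStep M qz x ⟨0, by omega⟩) W ↔
        Accepts (bigStep M qz) (bigAccept d M) (bigStep M qz y ⟨0, by omega⟩) W) ∧
      (∀ W, Accepts (bigStep M qz) (bigAccept d M) (bigStep M qz x ⟨1, by omega⟩) W ↔
        Accepts (bigStep M qz) (bigAccept d M) (bigStep M qz y ⟨1, by omega⟩) W) ∧
      (∀ W, Accepts (bigStep M qz) (bigAccept d M) (bigStep M qz x ⟨2, by omega⟩) W ↔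
        Accepts (bigStep M qz) (bigAccept d M) (bigStep M qz y ⟨2, by omega⟩) W) := by
    refine ⟨fun h => ⟨h _, h _, h _⟩, fun h a => ?_⟩
    by_cases h0 : (a : ℕ) = 0
    · have e : a = ⟨0, by omega⟩ := Fin.ext h0
      rw [e]
      exact h.1
    by_cases h1 : (a : ℕ) = 1
    · have e : a = ⟨1, by omega⟩ := Fin.ext h1
      rw [e]
      exact h.2.1
    · have e1 : bigStep M qz x a = bigStep M qz x ⟨2, by omega⟩ := by
        simp [bigStep, bigKind, bigPhase, hx, h0, h1]
      have e2 : bigStep M qz y a = bigStep M qz y ⟨2, by omega⟩ := by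
        simp [bigStep, bigKind, bigPhase, hy, h0, h1]
      rw [e1, e2]
      exact h.2.2
  rw [hsplit, hfin, accepts_simulate_iff M qz hb (x := bigStep M qz x _) (y := bigStep M qz y _)
    (by simp [bigStep, bigKind, hx]) (by simp [bigStep, bigKind, hy]) (by simp [bigStep, hx, hy])
    z ⟨b - 1, by omega⟩ hz (by simp; omega)]
  have hB : (∀ W, Accepts (bigStep M qz) (bigAccept d M) (bigStep M qz x ⟨1, by omega⟩) W ↔
      Accepts (bigStep M qz) (bigAccept d M) (bigStep M qz y ⟨1, by omega⟩) W) ↔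
      ∀ w, w ∈ M.language ↔ List.replicate d (some z) ++ₛ w ∈ M.language := by
    have e : ∀ W, (Accepts (bigStep M qz) (bigAccept d M) (bigStep M qz x ⟨1, by omega⟩) W ↔
      Accepts (bigStep M qz) (bigAccept d M) (bigStep M qz y ⟨1, by omega⟩) W) ↔
      (proj W ∈ M.language ↔ List.replicate d (some z) ++ₛ proj W ∈ M.language) := by
      intro W
      rw [accepts_plain M qz (by simp [bigStep, bigKind, hx]),
        accepts_plain M qz (by simp [bigStep, bigKind, hy]), mem_language_iff, mem_language_iff,
        accepts_append, ← hqz]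
      simp [bigStep, hx, hy]
    refine (forall_congr' e).trans ⟨fun h w => ?_, fun h W => h _⟩
    obtain ⟨W, rfl⟩ := exists_proj_eq hb w
    exact h W
  have hA : (∀ W, Accepts (bigStep M qz) (bigAccept d M) (bigStep M qz x ⟨2, by omega⟩) W ↔
      Accepts (bigStep M qz) (bigAccept d M) (bigStep M qz y ⟨2, by omega⟩) W) ↔
      IsSeqLanguage d M.language := by
    have e : ∀ W, (Accepts (bigStep M qz) (bigAccept d M) (bigStep M qz x ⟨2, by omega⟩) W ↔
      Accepts (bigStep M qz) (bigAccept d M) (bigStep M qz y ⟨2, by omega⟩) W) ↔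
      (proj W ∈ M.language → ∃ m x, d ∣ m ∧ proj W = starAt m x) := by
      intro W
      rw [iff_false_right (not_accepts_dead M qz (by simp [bigStep, bigKind, hy]) W),
        accepts_before M qz (by simp [bigStep, bigKind, hx]) (by simp [bigStep, bigPhase, hx]),
        mem_language_iff]
      simp only [bigStep, hx]
      simp only [Nat.ofNat_pos, if_true, zero_ne_one, false_and, if_false]
      exact ⟨fun h hA => by_contra fun hE => h ⟨hE, hA⟩, fun h hE => hE.1 (h hE.2)⟩
    rw [isSeqLanguage_iff]
    refine (forall_congr' e).trans ⟨fun h w => ?_, fun h W => h _⟩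
    obtain ⟨W, rfl⟩ := exists_proj_eq hb w
    exact h W
  rw [hA, hB, IsSeqRVA, ← and_assoc, and_comm]
  -- The characterization of saturation presupposes a sequential language, so it may be applied only
  -- under the first conjunct.
  refine and_congr_right fun hL => ?_
  have hL' := (isSeqLanguage_iff _).1 hL
  rw [saturated_iff hb hd z hz _ hL', flatDual_iff z ⟨b - 1, by omega⟩ hz (by simp; omega) hL',
    and_comm]
  refine and_congr_right fun _ => ?_
  simp only [mem_language_iff]
  simp [bigStep, hx]

end Big

end SeqRVA

namespace Ram

/-! ### Reasoning about programs -/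

instance : Add Term := ⟨.bin .add⟩
instance : Sub Term := ⟨.bin .sub⟩
instance : Mul Term := ⟨.bin .mul⟩

namespace Term

/-- The test `e₁ < e₂`. -/
def lt (e₁ e₂ : Term) : Term := .bin .lt e₁ e₂

/-- The test `e₁ = e₂`. -/
def eq (e₁ e₂ : Term) : Term := .bin .eq e₁ e₂

/-- The value of `e₁` if the test `c` succeeds, and of `e₂` otherwise. -/
def cond (c e₁ e₂ : Term) : Term := c * e₁ + (.lit 1 - c) * e₂

variable (σ : Store) (e₁ e₂ c : Term)

@[simp] theorem eval_add : (e₁ + e₂).eval σ = e₁.eval σ + e₂.eval σ := rfl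
@[simp] theorem eval_sub : (e₁ - e₂).eval σ = e₁.eval σ - e₂.eval σ := rfl
@[simp] theorem eval_mul : (e₁ * e₂).eval σ = e₁.eval σ * e₂.eval σ := rfl
@[simp] theorem eval_lt : (lt e₁ e₂).eval σ = if e₁.eval σ < e₂.eval σ then 1 else 0 := rfl
@[simp] theorem eval_eq : (eq e₁ e₂).eval σ = if e₁.eval σ = e₂.eval σ then 1 else 0 := rfl
@[simp] theorem eval_lit (k : ℕ) : (lit k).eval σ = k := rfl
@[simp] theorem eval_var (x : ℕ) : (var x).eval σ = σ.var x := rfl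
@[simp] theorem eval_read (a : ℕ) : (read a e₁).eval σ = σ.arr a (e₁.eval σ) := rfl

theorem eval_cond {p : Prop} [Decidable p] (h : c.eval σ = if p then 1 else 0) :
    (cond c e₁ e₂).eval σ = if p then e₁.eval σ else e₂.eval σ := by
  simp only [cond, eval_add, eval_mul, eval_sub, h]
  split_ifs <;> simp

@[simp] theorem eval_cond_lt (f₁ f₂ : Term) : (cond (lt f₁ f₂) e₁ e₂).eval σ =
    if f₁.eval σ < f₂.eval σ then e₁.eval σ else e₂.eval σ := eval_cond _ _ _ _ (eval_lt σ f₁ f₂)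

@[simp] theorem eval_cond_eq (f₁ f₂ : Term) : (cond (eq f₁ f₂) e₁ e₂).eval σ =
    if f₁.eval σ = f₂.eval σ then e₁.eval σ else e₂.eval σ := eval_cond _ _ _ _ (eval_eq σ f₁ f₂)

@[simp] theorem time_add : (e₁ + e₂).time = e₁.time + e₂.time + 1 := rfl
@[simp] theorem time_sub : (e₁ - e₂).time = e₁.time + e₂.time + 1 := rfl
@[simp] theorem time_mul : (e₁ * e₂).time = e₁.time + e₂.time + 1 := rfl
@[simp] theorem time_lt : (lt e₁ e₂).time = e₁.time + e₂.time + 1 := rfl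
@[simp] theorem time_eq : (eq e₁ e₂).time = e₁.time + e₂.time + 1 := rfl
@[simp] theorem time_lit (k : ℕ) : (lit k).time = 1 := rfl
@[simp] theorem time_var (x : ℕ) : (var x).time = 1 := rfl
@[simp] theorem time_read (a : ℕ) : (read a e₁).time = e₁.time + 1 := rfl
@[simp] theorem time_cond :
    (cond c e₁ e₂).time = c.time + e₁.time + 1 + (1 + c.time + 1 + e₂.time + 1) + 1 := rfl

@[simp] theorem space_add : (e₁ + e₂).space σ = max (e₁.space σ) (e₂.space σ) := rfl
@[simp] theorem space_sub : (e₁ - e₂).space σ = max (e₁.space σ) (e₂.space σ) := rfl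
@[simp] theorem space_mul : (e₁ * e₂).space σ = max (e₁.space σ) (e₂.space σ) := rfl
@[simp] theorem space_lt : (lt e₁ e₂).space σ = max (e₁.space σ) (e₂.space σ) := rfl
@[simp] theorem space_eq : (eq e₁ e₂).space σ = max (e₁.space σ) (e₂.space σ) := rfl
@[simp] theorem space_lit (k : ℕ) : (lit k).space σ = 0 := rfl
@[simp] theorem space_var (x : ℕ) : (var x).space σ = 0 := rfl
@[simp] theorem space_read (a : ℕ) :
    (read a e₁).space σ = max (e₁.space σ) (e₁.eval σ + 1) := rfl
@[simp] theorem space_cond : (cond c e₁ e₂).space σ =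
    max (max (c.space σ) (e₁.space σ)) (max (max 0 (c.space σ)) (e₂.space σ)) := rfl

end Term

@[simp] theorem Store.setVar_var (σ : Store) (x k y : ℕ) :
    (σ.setVar x k).var y = if y = x then k else σ.var y := by
  simp [Store.setVar, Function.update_apply]

@[simp] theorem Store.setVar_arr (σ : Store) (x k : ℕ) : (σ.setVar x k).arr = σ.arr := rfl

@[simp] theorem Store.setArr_var (σ : Store) (a i k : ℕ) : (σ.setArr a i k).var = σ.var := rfl

@[simp] theorem Store.setArr_arr (σ : Store) (a i k c : ℕ) : (σ.setArr a i k).arr c =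
    if c = a then Function.update (σ.arr a) i k else σ.arr c := by
  simp [Store.setArr, Function.update_apply]

/-- Started with memory `σ`, the program `p` halts, it uses only addresses below `s`, and `Q` holds
of the final memory and of the running time. -/
def Run (s : ℕ) (p : Program) (σ : Store) (Q : Store → ℕ → Prop) : Prop :=
  ∃ τ t s', Exec p σ τ t s' ∧ s' ≤ s ∧ Q τ t

theorem Run.imp {s : ℕ} {p : Program} {σ : Store} {Q Q' : Store → ℕ → Prop} (h : Run s p σ Q)
    (hQ : ∀ τ t, Q τ t → Q' τ t) : Run s p σ Q' := by
  obtain ⟨τ, t, s', h1, h2, h3⟩ := h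
  exact ⟨τ, t, s', h1, h2, hQ _ _ h3⟩

section

variable {s : ℕ} {σ : Store} {Q : Store → ℕ → Prop}

/-- This and the following equivalences let `simp` execute loop-free programs symbolically, leaving
claims about addresses, final memory and time. Determinism is not needed: exhibiting one execution
suffices. -/
theorem run_skip : Run s .skip σ Q ↔ Q σ 1 := by
  constructor
  · rintro ⟨_, _, _, ⟨⟩, -, h⟩
    exact h
  · exact fun h => ⟨_, _, _, .skip σ, Nat.zero_le _, h⟩

theorem run_assign {x : ℕ} {e : Term} : Run s (.assign x e) σ Q ↔
    e.space σ ≤ s ∧ Q (σ.setVar x (e.eval σ)) (e.time + 1) := by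
  constructor
  · rintro ⟨_, _, _, ⟨⟩, h, h'⟩
    exact ⟨h, h'⟩
  · exact fun ⟨h, h'⟩ => ⟨_, _, _, .assign σ x e, h, h'⟩

theorem run_write {a : ℕ} {e₁ e₂ : Term} : Run s (.write a e₁ e₂) σ Q ↔
    (e₁.space σ ≤ s ∧ e₂.space σ ≤ s ∧ e₁.eval σ < s) ∧
      Q (σ.setArr a (e₁.eval σ) (e₂.eval σ)) (e₁.time + e₂.time + 1) := by
  constructor
  · rintro ⟨_, _, _, ⟨⟩, h, h'⟩
    exact ⟨by omega, h'⟩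
  · exact fun ⟨h, h'⟩ => ⟨_, _, _, .write σ a e₁ e₂, by omega, h'⟩

theorem run_seq {p q : Program} : Run s (.seq p q) σ Q ↔
    Run s p σ fun τ t => Run s q τ fun τ' t' => Q τ' (t + t') := by
  constructor
  · rintro ⟨_, _, _, h, hs, hQ⟩
    cases h with
    | seq h1 h2 => exact ⟨_, _, _, h1, by omega, _, _, _, h2, by omega, hQ⟩
  · rintro ⟨_, _, _, h1, hs1, _, _, _, h2, hs2, hQ⟩
    exact ⟨_, _, _, .seq h1 h2, by omega, hQ⟩

theorem run_ite {e : Term} {p q : Program} : Run s (.ite e p q) σ Q ↔ e.space σ ≤ s ∧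
    (e.eval σ ≠ 0 → Run s p σ fun τ t => Q τ (e.time + 1 + t)) ∧
    (e.eval σ = 0 → Run s q σ fun τ t => Q τ (e.time + 1 + t)) := by
  constructor
  · rintro ⟨_, _, _, h, hs, hQ⟩
    cases h with
    | iteTrue h1 h2 =>
      exact ⟨by omega, fun _ => ⟨_, _, _, h2, by omega, hQ⟩, fun h => absurd h h1⟩
    | iteFalse h1 h2 =>
      exact ⟨by omega, fun h => absurd h1 h, fun _ => ⟨_, _, _, h2, by omega, hQ⟩⟩
  · rintro ⟨hs, h1, h2⟩
    by_cases h : e.eval σ = 0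
    · obtain ⟨_, _, _, h3, h4, h5⟩ := h2 h
      exact ⟨_, _, _, .iteFalse h h3, by omega, h5⟩
    · obtain ⟨_, _, _, h3, h4, h5⟩ := h1 h
      exact ⟨_, _, _, .iteTrue h h3, by omega, h5⟩

end

/-- The loop rule: `Inv σ φ` says that the invariant holds and that time `φ` is left. -/
theorem run_loop {s : ℕ} {e : Term} {p : Program} (Inv : Store → ℕ → Prop)
    (hs : ∀ σ φ, Inv σ φ → e.space σ ≤ s)
    (hp : ∀ σ φ, Inv σ φ → e.eval σ ≠ 0 →
      Run s p σ fun τ t => ∃ ψ, Inv τ ψ ∧ e.time + 1 + t + ψ ≤ φ) {σ : Store} {φ : ℕ}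
    (h : Inv σ φ) : Run s (.loop e p) σ fun τ t =>
      e.eval τ = 0 ∧ ∃ ψ, Inv τ ψ ∧ t + ψ ≤ φ + (e.time + 1) := by
  induction φ using Nat.strong_induction_on generalizing σ with
  | _ φ ih =>
    by_cases h0 : e.eval σ = 0
    · exact ⟨_, _, _, .loopDone h0, hs σ φ h, h0, φ, h, by omega⟩
    · obtain ⟨τ, t, s', h1, h2, ψ, h3, h4⟩ := hp σ φ h h0
      obtain ⟨τ', t', s'', h5, h6, h7, ψ', h8, h9⟩ := ih ψ (by omega) h3
      have := hs σ φ h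
      exact ⟨_, _, _, .loopStep h0 h1 h5, by omega, h7, ψ', h8, by omega⟩

/-- Execute programs one after the other. -/
def block : List Program → Program
  | [] => .skip
  | p :: ps => .seq p (block ps)

theorem run_block_nil {s : ℕ} {σ : Store} {Q : Store → ℕ → Prop} :
    Run s (block []) σ Q ↔ Q σ 1 := run_skip

theorem run_block_cons {s : ℕ} {σ : Store} {Q : Store → ℕ → Prop} {p : Program}
    {ps : List Program} : Run s (block (p :: ps)) σ Q ↔
      Run s p σ fun τ t => Run s (block ps) τ fun τ' t' => Q τ' (t + t') := run_seq

/-- Whether the program assigns to variable `x`. -/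
def Program.assigns : Program → ℕ → Bool
  | .skip, _ => false
  | .assign y _, x => x == y
  | .write _ _ _, _ => false
  | .seq p q, x => p.assigns x || q.assigns x
  | .ite _ p q, x => p.assigns x || q.assigns x
  | .loop _ p, x => p.assigns x

/-- Whether the program writes to array `a`. -/
def Program.writes : Program → ℕ → Bool
  | .skip, _ => false
  | .assign _ _, _ => false
  | .write c _ _, a => a == c
  | .seq p q, a => p.writes a || q.writes a
  | .ite _ p q, a => p.writes a || q.writes a
  | .loop _ p, a => p.writes a

theorem Exec.var_eq {p : Program} {σ τ : Store} {t s x : ℕ} (h : Exec p σ τ t s)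
    (hx : p.assigns x = false) : τ.var x = σ.var x := by
  induction h with
  | skip => rfl
  | assign σ y e =>
    simp only [Program.assigns, beq_eq_false_iff_ne] at hx
    simp [hx]
  | write => rfl
  | seq _ _ ih1 ih2 =>
    simp only [Program.assigns, Bool.or_eq_false_iff] at hx
    rw [ih2 hx.2, ih1 hx.1]
  | iteTrue _ _ ih =>
    simp only [Program.assigns, Bool.or_eq_false_iff] at hx
    exact ih hx.1
  | iteFalse _ _ ih =>
    simp only [Program.assigns, Bool.or_eq_false_iff] at hx
    exact ih hx.2
  | loopDone => rfl
  | loopStep _ _ _ ih1 ih2 => rw [ih2 hx, ih1 hx]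

theorem Exec.arr_eq {p : Program} {σ τ : Store} {t s a : ℕ} (h : Exec p σ τ t s)
    (ha : p.writes a = false) : τ.arr a = σ.arr a := by
  induction h with
  | skip => rfl
  | assign => rfl
  | write σ c e₁ e₂ =>
    simp only [Program.writes, beq_eq_false_iff_ne] at ha
    simp [ha]
  | seq _ _ ih1 ih2 =>
    simp only [Program.writes, Bool.or_eq_false_iff] at ha
    rw [ih2 ha.2, ih1 ha.1]
  | iteTrue _ _ ih =>
    simp only [Program.writes, Bool.or_eq_false_iff] at ha
    exact ih ha.1
  | iteFalse _ _ ih =>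
    simp only [Program.writes, Bool.or_eq_false_iff] at ha
    exact ih ha.2
  | loopDone => rfl
  | loopStep _ _ _ ih1 ih2 => rw [ih2 ha, ih1 ha]

/-- The text of a program shows what it can modify. Specifications thus need not mention untouched
memory: for a concrete program, the hypothesis on a concrete variable or array holds by `rfl`. -/
theorem Run.frame {s : ℕ} {p : Program} {σ : Store} {Q : Store → ℕ → Prop} (h : Run s p σ Q) :
    Run s p σ fun τ t => Q τ t ∧ (∀ x, p.assigns x = false → τ.var x = σ.var x) ∧
      ∀ a, p.writes a = false → τ.arr a = σ.arr a := by
  obtain ⟨τ, t, s', h1, h2, h3⟩ := h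
  exact ⟨τ, t, s', h1, h2, h3, fun _ => h1.var_eq, fun _ => h1.arr_eq⟩

end Ram

namespace SeqRVA

open Ram

/-! ### The table of the big automaton -/

/-- The number of a state of the big automaton. -/
def stateCode {n d : ℕ} (x : Fin 10 × Fin n × Fin d) : ℕ := ((x.1 : ℕ) * n + x.2.1) * d + x.2.2

theorem mul_add_inj {K p p' a a' : ℕ} (ha : a < K) (ha' : a' < K) :
    p * K + a = p' * K + a' ↔ p = p' ∧ a = a' := by
  constructor
  · intro h
    have hK : 0 < K := by omega
    have h1 : (p * K + a) / K = (p' * K + a') / K := by rw [h]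
    rw [mul_comm, Nat.mul_add_div hK, Nat.div_eq_of_lt ha, mul_comm, Nat.mul_add_div hK,
      Nat.div_eq_of_lt ha'] at h1
    have h2 : p = p' := by simpa using h1
    subst h2
    exact ⟨rfl, by omega⟩
  · rintro ⟨rfl, rfl⟩; rfl

theorem mul_add_lt {K N p a : ℕ} (hp : p < N) (ha : a < K) : p * K + a < N * K := by
  have : (p + 1) * K ≤ N * K := Nat.mul_le_mul_right K hp
  rw [Nat.add_mul, one_mul] at this
  omega

theorem stateCode_inj {n d : ℕ} : Function.Injective (stateCode (n := n) (d := d)) := by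
  rintro ⟨k, q, g⟩ ⟨k', q', g'⟩ h
  obtain ⟨h1, h2⟩ := (mul_add_inj g.isLt g'.isLt).1 h
  obtain ⟨h3, h4⟩ := (mul_add_inj q.isLt q'.isLt).1 h1
  simp only [Prod.mk.injEq]
  exact ⟨Fin.ext h3, Fin.ext h4, Fin.ext h2⟩

theorem stateCode_lt {n d : ℕ} (x : Fin 10 × Fin n × Fin d) : stateCode x < 10 * n * d :=
  mul_add_lt (mul_add_lt x.1.isLt x.2.1.isLt) x.2.2.isLt

theorem exists_stateCode {n d p : ℕ} (h : p < 10 * n * d) :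
    ∃ x : Fin 10 × Fin n × Fin d, stateCode x = p := by
  have hd : 0 < d := Nat.pos_of_ne_zero (by rintro rfl; simp at h)
  have hn : 0 < n := Nat.pos_of_ne_zero (by rintro rfl; simp at h)
  have h1 : p / d < 10 * n := Nat.div_lt_of_lt_mul (by rwa [mul_comm])
  have h2 : p / d / n < 10 := Nat.div_lt_of_lt_mul (by rwa [mul_comm])
  refine ⟨(⟨_, h2⟩, ⟨_, Nat.mod_lt (p / d) hn⟩, ⟨_, Nat.mod_lt p hd⟩), ?_⟩
  simp only [stateCode]
  rw [Nat.div_add_mod', Nat.div_add_mod']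

/-- Follow `d` zeros. -/
def zeroProgram : Program :=
  .loop (.lt (.var 7) (.var 1)) (block [
    .assign 6 (.read 0 (.var 6 * (.var 0 + .lit 1))),
    .assign 7 (.var 7 + .lit 1)])

/-- Set the variables `4`, `5` and `6` to the number of states and the number of letters of the big
automaton and to the state reached by a zero vector. -/
def initProgram : Program := block [
  .assign 4 (.lit 10 * .var 2 * .var 1),
  .assign 5 (.lit 2 * .var 0),
  .assign 6 (.var 3),
  zeroProgram,
  .assign 7 (.lit 0)]

/-- Kind (`11`), state (`10`) and phase (`9`) determine, with the letter (`8`), the kind of the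
successor. -/
def kindTerm : Term :=
  .cond (.eq (.var 11) (.lit 0))
    (.cond (.eq (.var 8) (.lit 0)) (.lit 2) (.cond (.eq (.var 8) (.lit 1)) (.lit 8) (.lit 4)))
  (.cond (.eq (.var 11) (.lit 1))
    (.cond (.eq (.var 8) (.lit 0)) (.lit 3) (.cond (.eq (.var 8) (.lit 1)) (.lit 8) (.lit 9)))
  (.cond (.eq (.var 11) (.lit 2)) (.cond (.lt (.var 0) (.var 8)) (.lit 6) (.lit 2))
  (.cond (.eq (.var 11) (.lit 3)) (.cond (.lt (.var 0) (.var 8)) (.lit 7) (.lit 3))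
  (.cond (.eq (.var 11) (.lit 4)) (.cond (.lt (.var 8) (.var 0)) (.lit 4)
    (.cond (.eq (.var 9) (.lit 0)) (.lit 5) (.lit 8)))
  (.cond (.eq (.var 11) (.lit 5)) (.cond (.lt (.var 8) (.var 0)) (.lit 5) (.lit 8))
    (.var 11))))))

/-- The letter that the underlying automaton reads. -/
def letterTerm : Term :=
  .cond (.eq (.var 11) (.lit 2))
    (.cond (.lt (.var 0) (.var 8)) (.var 8 - .var 0) (.var 8))
  (.cond (.eq (.var 11) (.lit 3))
    (.cond (.lt (.var 0) (.var 8)) (.var 8 - .var 0 - .lit 1) (.var 8))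
  (.cond (.eq (.var 11) (.lit 6)) (.cond (.lt (.var 8) (.var 0))
    (.cond (.eq (.var 9) (.lit 0)) (.lit 0) (.var 8)) (.var 0))
  (.cond (.eq (.var 11) (.lit 7)) (.cond (.lt (.var 8) (.var 0))
    (.cond (.eq (.var 9) (.lit 0)) (.var 0 - .lit 1) (.var 8)) (.var 0))
    (.cond (.lt (.var 8) (.var 0)) (.var 8) (.var 0)))))

/-- The phase of the successor. -/
def phaseTerm : Term :=
  .cond (.lt (.var 11) (.lit 2)) (.lit 0)
  (.cond (.lt (.var 11) (.lit 4)) (.cond (.lt (.var 0) (.var 8)) (.var 1 - .lit 1) (.var 9))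
  (.cond (.lt (.var 8) (.var 0)) (.cond (.eq (.var 9) (.lit 0)) (.var 1 - .lit 1) (.var 9 - .lit 1))
    (.var 9)))

/-- The state of the underlying automaton in the successor, if variable `12` is the letter. -/
def targetTerm : Term :=
  .cond (.lt (.var 11) (.lit 2))
    (.cond (.eq (.var 11) (.lit 1)) (.cond (.eq (.var 8) (.lit 1)) (.var 6) (.var 3)) (.var 3))
    (.read 0 (.var 10 * (.var 0 + .lit 1) + .var 12))

/-- Whether the state is accepting. -/
def acceptTerm : Term :=
  .cond (.eq (.var 11) (.lit 4)) (.read 1 (.var 10))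
    (.cond (.lt (.var 11) (.lit 6)) (.lit 0)
      (.cond (.lt (.var 11) (.lit 9)) (.read 1 (.var 10)) (.lit 0)))

/-- The computation of one table entry. -/
def entryProgram : Program := block [
  .assign 12 letterTerm,
  .assign 13 kindTerm,
  .assign 14 phaseTerm,
  .assign 15 targetTerm,
  .write 2 (.var 7) ((.var 13 * .var 2 + .var 15) * .var 1 + .var 14),
  .write 3 (.var 16) acceptTerm]

/-- The step to the next table entry. -/
def nextProgram : Program := block [
  .assign 7 (.var 7 + .lit 1),
  .assign 8 (.var 8 + .lit 1),
  .ite (.eq (.var 8) (.var 5)) (block [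
    .assign 8 (.lit 0),
    .assign 16 (.var 16 + .lit 1),
    .assign 9 (.var 9 + .lit 1),
    .ite (.eq (.var 9) (.var 1)) (block [
      .assign 9 (.lit 0),
      .assign 10 (.var 10 + .lit 1),
      .ite (.eq (.var 10) (.var 2)) (block [
        .assign 10 (.lit 0),
        .assign 11 (.var 11 + .lit 1)]) .skip]) .skip]) .skip]

/-- The computation of the table (array `2`) and of the accepting states (array `3`). -/
def tableProgram : Program :=
  .loop (.lt (.var 7) (.var 4 * .var 5)) (block [entryProgram, nextProgram])

section

variable {b d n : ℕ} (M : BuchiAutomaton (Fin n) (WithStar (Fin b)))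

/-- The memory contains the input and the values computed by the initialization. -/
structure Env (qz : Fin n) (d : ℕ) (σ : Store) : Prop where
  base : σ.var 0 = b
  dim : σ.var 1 = d
  states : σ.var 2 = n
  start : σ.var 3 = M.start
  size : σ.var 4 = 10 * n * d
  letters : σ.var 5 = 2 * b
  zero : σ.var 6 = qz
  step : ∀ (q : Fin n) a, a ≤ b →
    σ.arr 0 (q * (b + 1) + a) = M.step q (letterOfNat b a)
  accept : ∀ q : Fin n, (σ.arr 1 q ≠ 0 ↔ q ∈ M.accept)

theorem input_arr_zero (q : Fin n) {a : ℕ} (ha : a ≤ b) :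
    (input b d n M).arr 0 (q * (b + 1) + a) = M.step q (letterOfNat b a) := by
  have h1 : ((q : ℕ) * (b + 1) + a) / (b + 1) = q := by
    rw [mul_comm, Nat.mul_add_div (by omega), Nat.div_eq_of_lt (by omega), add_zero]
  have h2 : ((q : ℕ) * (b + 1) + a) % (b + 1) = a := by
    rw [mul_comm, Nat.mul_add_mod, Nat.mod_eq_of_lt (by omega)]
  simp only [input, h1, h2]
  simp

theorem cell_lt (q : Fin n) {a : ℕ} (ha : a ≤ b) (hb : 2 ≤ b) (hd : 1 ≤ d) :
    (q : ℕ) * (b + 1) + a < 10 * n * d * (2 * b) := by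
  have h1 := mul_add_lt q.isLt (show a < b + 1 by omega)
  have h2 : n * (b + 1) ≤ n * d * (2 * b) := by
    rw [mul_assoc]
    refine Nat.mul_le_mul_left n ?_
    nlinarith
  nlinarith

/-- The parameter of `Env` for the contents of variable 6 serves as loop invariant: it starts as the
initial state and advances by one zero per iteration. -/
theorem zero_run (hb : 2 ≤ b) (hd : 1 ≤ d) (z : Fin b) (hz : (z : ℕ) = 0) (S : ℕ)
    (hS : 10 * n * d * (2 * b) ≤ S) (σ : Store) (h : Env M M.start d σ)
    (hv : ∀ x, 7 ≤ x → σ.var x = 0) (ha : ∀ a, 2 ≤ a → σ.arr a = fun _ => 0) :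
    Run S zeroProgram σ fun τ t =>
      Env M ((List.replicate d (some z)).foldl M.step M.start) d τ ∧ τ.var 7 = d ∧
      (∀ x, 8 ≤ x → τ.var x = 0) ∧ (∀ a, 2 ≤ a → τ.arr a = fun _ => 0) ∧ t ≤ 16 * d + 4 := by
  refine (run_loop (fun σ φ => ∃ i ≤ d, Env M ((List.replicate i (some z)).foldl M.step M.start) d σ
    ∧ σ.var 7 = i ∧ (∀ x, 8 ≤ x → σ.var x = 0) ∧ (∀ a, 2 ≤ a → σ.arr a = fun _ => 0) ∧
    φ = 16 * (d - i)) ?_ ?_ (φ := 16 * d) ?_).imp ?_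
  · intros; simp
  · rintro σ φ ⟨i, hi, h, h7, hv, ha, rfl⟩ h0
    simp only [Term.eval_lt, Term.eval_var, h7, h.dim, ne_eq, ite_eq_right_iff, one_ne_zero,
      imp_false, not_not] at h0
    have hl : letterOfNat b 0 = some z := by
      have : 0 < b := by omega
      simp only [letterOfNat, this, dif_pos]
      congr 1
      ext
      simp [hz]
    have hstep := h.step ((List.replicate i (some z)).foldl M.step M.start) 0 (by omega)
    have hcell := cell_lt ((List.replicate i (some z)).foldl M.step M.start) (Nat.zero_le b) hb hd
    simp only [add_zero] at hstep hcell
    simp only [run_block_cons, run_block_nil, run_assign]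
    refine ⟨by simp [h.zero, h.base]; omega, by simp, 16 * (d - (i + 1)), ⟨i + 1, h0, ⟨?_, ?_, ?_, ?_,
      ?_, ?_, ?_, ?_, ?_⟩, ?_, ?_, ?_, rfl⟩, ?_⟩
    · simp [h.base]
    · simp [h.dim]
    · simp [h.states]
    · simp [h.start]
    · simp [h.size]
    · simp [h.letters]
    · simp [h.base, h.zero, hstep, hl, List.replicate_succ']
    · simpa using h.step
    · simpa using h.accept
    · simp [h7]
    · intro x hx
      simp [show x ≠ 6 by omega, show x ≠ 7 by omega, hv x hx]
    · simpa using ha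
    · simp; omega
  · exact ⟨0, Nat.zero_le d, h, hv 7 le_rfl, fun x hx => hv x (by omega), ha, by simp⟩
  · rintro τ t ⟨h0, ψ, ⟨i, hi, h, h7, hv, ha, rfl⟩, ht⟩
    simp only [Term.eval_lt, Term.eval_var, h7, h.dim, ite_eq_right_iff, one_ne_zero,
      imp_false] at h0
    obtain rfl : i = d := by omega
    refine ⟨h, h7, hv, ha, ?_⟩
    simp at ht
    omega

theorem init_run (hb : 2 ≤ b) (hd : 1 ≤ d) (z : Fin b) (hz : (z : ℕ) = 0) (S : ℕ)
    (hS : 10 * n * d * (2 * b) ≤ S) :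
    Run S initProgram (input b d n M) fun τ t =>
      Env M ((List.replicate d (some z)).foldl M.step M.start) d τ ∧
      (∀ x, 7 ≤ x → τ.var x = 0) ∧ (∀ a, 2 ≤ a → τ.arr a = fun _ => 0) ∧ t ≤ 16 * d + 30 := by
  rw [initProgram]
  simp only [run_block_cons, run_assign]
  refine ⟨by simp, by simp, by simp, ?_⟩
  refine (zero_run M hb hd z hz S hS _ ⟨?_, ?_, ?_, ?_, ?_, ?_, ?_, ?_, ?_⟩ ?_ ?_).imp ?_
  · simp [input]
  · simp [input]
  · simp [input]
  · simp [input]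
  · simp [input]
  · simp [input]
  · simp [input]
  · simpa using fun q a => input_arr_zero M q
  · simp [input]
  · intro x hx
    simp only [Store.setVar_var, show x ≠ 6 by omega, show x ≠ 5 by omega, show x ≠ 4 by omega,
      if_false]
    simp only [input]
    split <;> omega
  · intro a ha
    simp only [Store.setVar_arr]
    funext i
    simp only [input]
    split <;> omega
  · rintro τ t ⟨h, h7, hv, ha, ht⟩
    simp only [run_block_nil]
    refine ⟨by simp, ⟨?_, ?_, ?_, ?_, ?_, ?_, ?_, ?_, ?_⟩, ?_, ?_, ?_⟩
    · simp [h.base]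
    · simp [h.dim]
    · simp [h.states]
    · simp [h.start]
    · simp [h.size]
    · simp [h.letters]
    · simp [h.zero]
    · simpa using h.step
    · simpa using h.accept
    · intro x hx
      by_cases h8 : x = 7
      · simp [h8]
      · simp [h8, hv x (by omega)]
    · simpa using ha
    · simp; omega

/-- The table entries before number `idx` are correct. -/
def TableCorrect (qz : Fin n) (d idx : ℕ) (σ : Store) : Prop :=
  ∀ (x : Fin 10 × Fin n × Fin d),
    (∀ a : Fin (2 * b), stateCode x * (2 * b) + a < idx →
      σ.arr 2 (stateCode x * (2 * b) + a) = stateCode (bigStep M qz x a)) ∧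
    (stateCode x * (2 * b) < idx → (σ.arr 3 (stateCode x) ≠ 0 ↔ x ∈ bigAccept d M))

/-- The counters give the position `idx` in the table. -/
structure TablePos (b d n idx : ℕ) (σ : Store) : Prop where
  pos : σ.var 7 = idx
  state : σ.var 16 = (σ.var 11 * n + σ.var 10) * d + σ.var 9
  eq : idx = σ.var 16 * (2 * b) + σ.var 8
  letter : σ.var 8 < 2 * b
  phase : σ.var 9 < d
  target : σ.var 10 < n

/-- Division is not an instruction, so a table index cannot be decoded directly. Letter, phase,
state and kind are advanced instead as the digits of an odometer, along with the index. -/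
theorem next_run (S : ℕ) (qz : Fin n) (hb : 2 ≤ b) (idx : ℕ) (σ : Store)
    (h : Env M qz d σ) (hp : TablePos b d n idx σ) (hc : TableCorrect M qz d (idx + 1) σ) :
    Run S nextProgram σ fun τ t => Env M qz d τ ∧ TablePos b d n (idx + 1) τ ∧
      TableCorrect M qz d (idx + 1) τ ∧ t ≤ 100 := by
  have hpost : ∀ τ : Store, (∀ x, x < 7 → τ.var x = σ.var x) → τ.arr = σ.arr →
      Env M qz d τ ∧ TableCorrect M qz d (idx + 1) τ := by
    intro τ hτ ha
    refine ⟨⟨?_, ?_, ?_, ?_, ?_, ?_, ?_, ?_, ?_⟩, ?_⟩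
    · rw [hτ _ (by omega), h.base]
    · rw [hτ _ (by omega), h.dim]
    · rw [hτ _ (by omega), h.states]
    · rw [hτ _ (by omega), h.start]
    · rw [hτ _ (by omega), h.size]
    · rw [hτ _ (by omega), h.letters]
    · rw [hτ _ (by omega), h.zero]
    · simpa only [ha] using h.step
    · simpa only [ha] using h.accept
    · simpa only [TableCorrect, ha] using hc
  have leaf : ∀ (τ : Store) (t : ℕ), (∀ x, x < 7 → τ.var x = σ.var x) → τ.arr = σ.arr →
      TablePos b d n (idx + 1) τ → t ≤ 100 → Env M qz d τ ∧ TablePos b d n (idx + 1) τ ∧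
      TableCorrect M qz d (idx + 1) τ ∧ t ≤ 100 :=
    fun τ t h1 h2 h3 h4 => ⟨(hpost τ h1 h2).1, h3, (hpost τ h1 h2).2, h4⟩
  clear hpost
  obtain ⟨h7, h16, he, h8, h9, h10⟩ := hp
  simp only [nextProgram, run_block_cons, run_block_nil, run_assign, run_ite, run_skip]
  refine ⟨by simp, by simp, by simp, fun hK => ?_, fun hK => ?_⟩
  · simp [h.letters] at hK
    refine ⟨by simp, by simp, by simp, by simp, fun hD => ?_, fun hD => ?_⟩
    · simp [h.dim] at hD
      refine ⟨by simp, by simp, by simp, fun hN => ?_, fun hN => ?_⟩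
      · simp [h.states] at hN
        refine ⟨by simp, by simp, leaf _ _ ?_ (by simp) ⟨?_, ?_, ?_, ?_, ?_, ?_⟩ (by simp)⟩
        · intro x hx; simp; split_ifs <;> first | rfl | omega
        · simp [h7]
        · simp [h16, ← hN, ← hD]; ring
        · simp [he, ← hK]; ring
        · simp; omega
        · simp; omega
        · simp; omega
      · simp [h.states] at hN
        refine leaf _ _ ?_ (by simp) ⟨?_, ?_, ?_, ?_, ?_, ?_⟩ (by simp)
        · intro x hx; simp; split_ifs <;> first | rfl | omega
        · simp [h7]
        · simp [h16, ← hD]; ring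
        · simp [he, ← hK]; ring
        · simp; omega
        · simp; omega
        · simp; omega
    · simp [h.dim] at hD
      refine leaf _ _ ?_ (by simp) ⟨?_, ?_, ?_, ?_, ?_, ?_⟩ (by simp)
      · intro x hx; simp; split_ifs <;> first | rfl | omega
      · simp [h7]
      · simp [h16]; ring
      · simp [he, ← hK]; ring
      · simp; omega
      · simp; omega
      · simp; omega
  · simp [h.letters] at hK
    refine leaf _ _ ?_ (by simp) ⟨?_, ?_, ?_, ?_, ?_, ?_⟩ (by simp)
    · intro x hx; simp; split_ifs <;> first | rfl | omega
    · simp [h7]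
    · simp [h16]
    · simp [he]; ring
    · simp; omega
    · simp; omega
    · simp; omega

theorem entry_run (S : ℕ) (hS : 10 * n * d * (2 * b) ≤ S) (qz : Fin n) (hb : 2 ≤ b) (hd : 1 ≤ d)
    (idx : ℕ) (σ : Store) (h : Env M qz d σ) (hp : TablePos b d n idx σ)
    (hidx : idx < 10 * n * d * (2 * b)) (hc : TableCorrect M qz d idx σ) :
    Run S entryProgram σ fun τ t => Env M qz d τ ∧ TablePos b d n idx τ ∧
      TableCorrect M qz d (idx + 1) τ ∧ t ≤ 1000 := by
  obtain ⟨h7, h16, he, h8, h9, h10⟩ := hp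
  -- `TablePos` does not bound the kind, which becomes 10 after the last entry. Inside the table the
  -- bound follows from the index.
  have hk : σ.var 11 < 10 := by
    by_contra hcon
    have h1 : 10 * n * d ≤ σ.var 16 := by
      rw [h16]
      refine le_trans ?_ (Nat.le_add_right _ _)
      refine Nat.mul_le_mul_right d ?_
      refine le_trans ?_ (Nat.le_add_right _ _)
      exact Nat.mul_le_mul_right n (by omega)
    have := Nat.mul_le_mul_right (2 * b) h1
    omega
  have hp16 : σ.var 16 < 10 * n * d := by rw [h16]; exact mul_add_lt (mul_add_lt hk h10) h9
  let x : Fin 10 × Fin n × Fin d := (⟨σ.var 11, hk⟩, ⟨σ.var 10, h10⟩, ⟨σ.var 9, h9⟩)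
  let a : Fin (2 * b) := ⟨σ.var 8, h8⟩
  have hx : σ.var 16 = stateCode x := h16
  have hl : letterTerm.eval σ = bigLetter b x.1 x.2.2 a := by
    simp [letterTerm, bigLetter, h.base, x, a]
    rfl
  have hlb : bigLetter b x.1 x.2.2 a ≤ b := by
    have := a.isLt
    simp only [bigLetter]
    split_ifs <;> omega
  have hkt : ∀ k, kindTerm.eval (σ.setVar 12 k) = bigKind b x.1 x.2.2 a := by
    intro k
    simp [kindTerm, bigKind, h.base, x, a]
  have hpt : ∀ k k', phaseTerm.eval ((σ.setVar 12 k).setVar 13 k') = bigPhase b d x.1 x.2.2 a := by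
    intro k k'
    simp [phaseTerm, bigPhase, h.base, h.dim, x, a]
  have htt : ∀ k k', targetTerm.eval (((σ.setVar 12 (bigLetter b x.1 x.2.2 a)).setVar 13 k).setVar 14 k')
      = ((bigStep M qz x a).2.1 : ℕ) := by
    intro k k'
    have := h.step ⟨σ.var 10, h10⟩ _ hlb
    simp only at this
    simp [targetTerm, h.base, h.zero, h.start, bigStep, this, apply_ite Fin.val, x, a, ite_and]
  -- A conditional term evaluates both branches, so the read from the input table must stay in range
  -- even for the start kinds, whose target does not depend on it.
  have hts : ∀ k k', targetTerm.space
      (((σ.setVar 12 (bigLetter b x.1 x.2.2 a)).setVar 13 k).setVar 14 k') ≤ S := by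
    intro k k'
    have := cell_lt ⟨σ.var 10, h10⟩ hlb hb hd
    simp only at this
    simp [targetTerm, h.base]
    omega
  have hn : n ≤ S := by nlinarith [Nat.mul_le_mul (Nat.mul_le_mul_left (10 * n) hd) hb]
  have hN : 10 * n * d ≤ S := by nlinarith
  set τ₀ := (((σ.setVar 12 (bigLetter b x.1 x.2.2 a)).setVar 13 (bigKind b x.1 x.2.2 a)).setVar 14
    (bigPhase b d x.1 x.2.2 a)).setVar 15 (bigStep M qz x a).2.1 with hτ₀
  set τ₁ := τ₀.setArr 2 idx (stateCode (bigStep M qz x a)) with hτ₁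
  have hval : ((Term.var 13 * .var 2 + .var 15) * .var 1 + .var 14).eval τ₀ =
      stateCode (bigStep M qz x a) := by
    simp [hτ₀, h.states, h.dim, stateCode, bigStep]
  have hacc : acceptTerm.eval τ₁ ≠ 0 ↔ x ∈ bigAccept d M := by
    have := h.accept ⟨σ.var 10, h10⟩
    simp only at this
    simp [hτ₁, hτ₀, acceptTerm, mem_bigAccept, x, ← this]
    split_ifs <;> simp <;> omega
  have hspace : acceptTerm.space τ₁ ≤ S := by
    simp [hτ₁, hτ₀, acceptTerm]
    omega
  simp only [entryProgram, run_block_cons, run_block_nil, run_assign, run_write, hl, hkt, hpt, htt]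
  rw [← hτ₀, hval, show Term.eval τ₀ (.var 7) = idx by simp [hτ₀, h7], ← hτ₁,
    show Term.eval τ₁ (.var 16) = σ.var 16 by simp [hτ₁, hτ₀]]
  refine ⟨by simp [letterTerm], by simp [kindTerm], by simp [phaseTerm], hts _ _,
    ⟨by simp, by simp, by omega⟩, ⟨by simp, hspace, by omega⟩,
    ⟨?_, ?_, ?_, ?_, ?_, ?_, ?_, ?_, ?_⟩, ⟨?_, ?_, ?_, ?_, ?_, ?_⟩, ?_, ?_⟩
  · simp [hτ₁, hτ₀, h.base]
  · simp [hτ₁, hτ₀, h.dim]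
  · simp [hτ₁, hτ₀, h.states]
  · simp [hτ₁, hτ₀, h.start]
  · simp [hτ₁, hτ₀, h.size]
  · simp [hτ₁, hτ₀, h.letters]
  · simp [hτ₁, hτ₀, h.zero]
  · simpa [hτ₁, hτ₀] using h.step
  · simpa [hτ₁, hτ₀] using h.accept
  · simpa [hτ₁, hτ₀] using h7
  · simpa [hτ₁, hτ₀] using h16
  · simpa [hτ₁, hτ₀] using he
  · simpa [hτ₁, hτ₀] using h8
  · simpa [hτ₁, hτ₀] using h9
  · simpa [hτ₁, hτ₀] using h10
  · intro y
    obtain ⟨hc2, hc3⟩ := hc y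
    have hidx : idx = stateCode x * (2 * b) + a := by rw [he, hx]
    constructor
    · intro c hlt
      simp only [hτ₁, hτ₀, Store.setArr_arr, Store.setVar_arr]
      by_cases heq : stateCode y * (2 * b) + c = idx
      · rw [hidx, mul_add_inj c.isLt a.isLt] at heq
        obtain rfl := stateCode_inj heq.1
        obtain rfl : c = a := Fin.ext heq.2
        simp [hidx]
      · have := hc2 c (by omega)
        simp [heq, this]
    -- The acceptance entry of a state is rewritten for each of its letters. It is therefore correct
    -- from its first letter on, and the entries of other states are not touched.
    · intro hlt
      simp only [Store.setArr_arr, if_true]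
      rw [hx]
      by_cases hxy : y = x
      · subst hxy
        rw [Function.update_self]
        exact hacc
      · rw [Function.update_of_ne fun he => hxy (stateCode_inj he)]
        have hne : stateCode y * (2 * b) ≠ idx := by
          intro heq
          rw [hidx, ← Nat.add_zero (stateCode y * (2 * b)), mul_add_inj (by omega) a.isLt] at heq
          exact hxy (stateCode_inj heq.1)
        simpa [hτ₁, hτ₀] using hc3 (by omega)
  · simp [letterTerm, kindTerm, phaseTerm, targetTerm, acceptTerm]

theorem table_run (S : ℕ) (hS : 10 * n * d * (2 * b) ≤ S) (qz : Fin n) (hb : 2 ≤ b) (hd : 1 ≤ d)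
    (σ : Store) (h : Env M qz d σ) (hv : ∀ x, 7 ≤ x → σ.var x = 0) :
    Run S tableProgram σ fun τ t => Env M qz d τ ∧
      TableCorrect M qz d (10 * n * d * (2 * b)) τ ∧ t ≤ 1200 * (10 * n * d * (2 * b)) + 10 := by
  refine (run_loop (fun σ φ => ∃ idx ≤ 10 * n * d * (2 * b), Env M qz d σ ∧ TablePos b d n idx σ ∧
    TableCorrect M qz d idx σ ∧ φ = 1200 * (10 * n * d * (2 * b) - idx)) ?_ ?_
    (φ := 1200 * (10 * n * d * (2 * b))) ?_).imp ?_
  · intros; simp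
  · rintro σ φ ⟨idx, hle, h, hp, hc, rfl⟩ h0
    simp only [Term.eval_lt, Term.eval_mul, Term.eval_var, hp.pos, h.size, h.letters, ne_eq,
      ite_eq_right_iff, one_ne_zero, imp_false, not_not] at h0
    simp only [run_block_cons, run_block_nil]
    refine (entry_run M S hS qz hb hd idx σ h hp h0 hc).imp ?_
    rintro σ₁ t₁ ⟨h1, hp1, hc1, ht1⟩
    refine (next_run M S qz hb idx σ₁ h1 hp1 hc1).imp ?_
    rintro σ₂ t₂ ⟨h2, hp2, hc2, ht2⟩
    refine ⟨_, ⟨idx + 1, h0, h2, hp2, hc2, rfl⟩, ?_⟩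
    simp
    omega
  · refine ⟨0, Nat.zero_le _, h, ⟨hv _ (by omega), ?_, ?_, ?_, ?_, ?_⟩, ?_, rfl⟩
    · simp [hv 16 (by omega), hv 11 (by omega), hv 10 (by omega), hv 9 (by omega)]
    · simp [hv 16 (by omega), hv 8 (by omega)]
    · rw [hv 8 (by omega)]; omega
    · rw [hv 9 (by omega)]; omega
    · rw [hv 10 (by omega)]; exact qz.pos
    · intro x
      exact ⟨fun a ha => absurd ha (Nat.not_lt_zero _), fun ha => absurd ha (Nat.not_lt_zero _)⟩
  · rintro τ t ⟨h0, ψ, ⟨idx, hle, h, hp, hc, rfl⟩, ht⟩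
    simp only [Term.eval_lt, Term.eval_mul, Term.eval_var, hp.pos, h.size, h.letters,
      ite_eq_right_iff, one_ne_zero, imp_false] at h0
    obtain rfl : idx = 10 * n * d * (2 * b) := by omega
    refine ⟨h, hc, ?_⟩
    simp at ht
    omega

end

end SeqRVA

namespace SeqRVA

open Ram

/-! ### Union-find -/

/-- The arrays `par` (`0` for a root, otherwise the parent plus one) and `sz` (the size of the
tree minus one) represent the partition of `{0, …, N - 1}` into the fibers of `rt`. -/
structure UnionFind (N : ℕ) (par sz rt : ℕ → ℕ) : Prop where
  rt_lt : ∀ x < N, rt x < N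
  root : ∀ x < N, par (rt x) = 0
  fix : ∀ x < N, par x = 0 → rt x = x
  step : ∀ x < N, par x ≠ 0 →
    par x - 1 < N ∧ rt (par x - 1) = rt x ∧ 2 * (sz x + 1) ≤ sz (par x - 1) + 1
  size : ∀ x < N, sz x + 1 ≤ N
  sum : ∑ x ∈ Finset.range N, (if par x = 0 then sz x + 1 else 0) = N

theorem UnionFind.init (N : ℕ) (hN : 0 < N) : UnionFind N (fun _ => 0) (fun _ => 0) id where
  rt_lt _ h := h
  root _ _ := rfl
  fix _ _ _ := rfl
  step _ _ h := absurd rfl h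
  size _ _ := by omega
  sum := by simp

/-- The smaller tree is hung below the larger one, so the size at least doubles along the new link.
Since the sizes at the roots add up to `N`, the new size does not exceed `N`. -/
theorem UnionFind.union {N : ℕ} {par sz rt : ℕ → ℕ} (h : UnionFind N par sz rt) {r r' : ℕ}
    (hr : r < N) (hr' : r' < N) (hne : r ≠ r') (h0 : par r = 0) (h0' : par r' = 0)
    (hle : sz r ≤ sz r') :
    UnionFind N (Function.update par r (r' + 1)) (Function.update sz r' (sz r' + sz r + 1))
      (fun x => if rt x = r then r' else rt x) := by
  have hfr := h.fix r hr h0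
  have hfr' := h.fix r' hr' h0'
  have hsum : ∀ f : ℕ → ℕ, ∑ x ∈ Finset.range N, f x =
      f r + (f r' + ∑ x ∈ ((Finset.range N).erase r).erase r', f x) := by
    intro f
    rw [Finset.add_sum_erase _ f (by simp [hr', hne.symm]),
      Finset.add_sum_erase _ f (by simpa using hr)]
  have hs := h.sum
  rw [hsum, if_pos h0, if_pos h0'] at hs
  refine ⟨?_, ?_, ?_, ?_, ?_, ?_⟩
  · intro x hx
    split_ifs
    · exact hr'
    · exact h.rt_lt x hx
  · intro x hx
    split_ifs with hxr
    · rw [Function.update_of_ne hne.symm, h0']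
    · rw [Function.update_of_ne hxr, h.root x hx]
  · intro x hx hp
    have hxr : x ≠ r := by
      rintro rfl
      simp at hp
    rw [Function.update_of_ne hxr] at hp
    rw [h.fix x hx hp, if_neg hxr]
  · intro x hx hp
    by_cases hxr : x = r
    · subst hxr
      simp only [Function.update_self, Nat.add_sub_cancel, hfr, hfr', if_true, hne.symm, if_false]
      rw [Function.update_of_ne hne]
      refine ⟨hr', trivial, by omega⟩
    · rw [Function.update_of_ne hxr] at hp ⊢
      have hxr' : x ≠ r' := by rintro rfl; exact hp h0'
      obtain ⟨h1, h2, h3⟩ := h.step x hx hp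
      rw [h2, Function.update_of_ne hxr']
      refine ⟨h1, rfl, h3.trans ?_⟩
      by_cases hpr : par x - 1 = r'
      · rw [hpr, Function.update_self]; omega
      · rw [Function.update_of_ne hpr]
  · intro x hx
    by_cases hxr : x = r'
    · rw [hxr, Function.update_self]
      omega
    · rw [Function.update_of_ne hxr]
      exact h.size x hx
  · rw [hsum, if_neg (by simp), if_pos (by rw [Function.update_of_ne hne.symm, h0']),
      Function.update_self]
    rw [Finset.sum_congr rfl (g := fun x => if par x = 0 then sz x + 1 else 0)]
    · omega
    · intro x hx
      simp only [Finset.mem_erase] at hx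
      rw [Function.update_of_ne hx.1, Function.update_of_ne hx.2.1]

/-- Replace the node in variable `r` by its root. -/
def findProgram (r : ℕ) : Program :=
  .loop (.read 12 (.var r)) (.assign r (.read 12 (.var r) - .lit 1))

theorem setVar_setVar (σ : Store) (x k l : ℕ) : (σ.setVar x k).setVar x l = σ.setVar x l := by
  simp [Store.setVar]

theorem setVar_self (σ : Store) (x : ℕ) : σ.setVar x (σ.var x) = σ := by
  simp [Store.setVar]

/-- Each step to a parent at least doubles the size stored in array 13, which never exceeds `N`.
Union by size alone thus gives logarithmic paths, without path compression. One step costs 8 units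
and the final test 3. -/
theorem find_run {N : ℕ} {rt : ℕ → ℕ} (S r : ℕ) (hS : N ≤ S) (σ : Store)
    (h : UnionFind N (σ.arr 12) (σ.arr 13) rt) (hr : σ.var r < N) :
    Run S (findProgram r) σ fun τ t => τ = σ.setVar r (rt (σ.var r)) ∧ t ≤ 8 * Nat.log 2 N + 3 := by
  refine (run_loop (fun τ φ => ∃ x < N, τ = σ.setVar r x ∧ rt x = rt (σ.var r) ∧
    φ = 8 * (Nat.log 2 N - Nat.log 2 (σ.arr 13 x + 1))) ?_ ?_
    (φ := 8 * (Nat.log 2 N - Nat.log 2 (σ.arr 13 (σ.var r) + 1))) ?_).imp ?_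
  · rintro _ _ ⟨x, hx, rfl, -, -⟩
    simp
    omega
  · rintro _ _ ⟨x, hx, rfl, hrt, rfl⟩ h0
    simp only [Term.eval_read, Store.setVar_arr, Term.eval_var, Store.setVar_var, if_true] at h0
    obtain ⟨h1, h2, h3⟩ := h.step x hx h0
    simp only [run_assign]
    refine ⟨by simp; omega, _, ⟨σ.arr 12 x - 1, h1, by simp [setVar_setVar], h2.trans hrt, rfl⟩, ?_⟩
    have h4 : Nat.log 2 (σ.arr 13 x + 1) + 1 ≤ Nat.log 2 (σ.arr 13 (σ.arr 12 x - 1) + 1) := by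
      rw [← Nat.log_mul_base (by omega) (by omega), mul_comm]
      exact Nat.log_mono_right h3
    have h5 : Nat.log 2 (σ.arr 13 (σ.arr 12 x - 1) + 1) ≤ Nat.log 2 N :=
      Nat.log_mono_right (h.size _ h1)
    simp
    omega
  · exact ⟨_, hr, (setVar_self σ r).symm, rfl, rfl⟩
  · rintro τ t ⟨h0, ψ, ⟨x, hx, rfl, hrt, -⟩, ht⟩
    simp only [Term.eval_read, Store.setVar_arr, Term.eval_var, Store.setVar_var, if_true] at h0
    refine ⟨by rw [← hrt, h.fix x hx h0], ?_⟩
    simp at ht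
    have := Nat.sub_le (Nat.log 2 N) (Nat.log 2 (σ.arr 13 (σ.var r) + 1))
    omega

/-! ### Comparing two states of an automaton -/

/-- The state of the merging process: the queue `(A i, B i)`, `i < t`, generates the partition. -/
structure Merge (N : ℕ) (bit : ℕ → ℕ) (V : ℕ → ℕ → Prop) (par sz A B : ℕ → ℕ) (t flag : ℕ)
    (rt : ℕ → ℕ) : Prop where
  uf : UnionFind N par sz rt
  card : t + ((Finset.range N).filter fun x => par x = 0).card = N
  mem : ∀ i < t, A i < N ∧ B i < N ∧ rt (A i) = rt (B i) ∧ V (A i) (B i)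
  gen : ∀ E : ℕ → ℕ → Prop, Equivalence E → (∀ i < t, E (A i) (B i)) →
    ∀ x < N, ∀ y < N, rt x = rt y → E x y
  flag_one : flag ≠ 0 → flag = 1 ∧ ∀ i < t, bit (A i) = bit (B i)
  flag_zero : flag = 0 → ∃ i < t, bit (A i) ≠ bit (B i)

theorem Merge.init (N : ℕ) (hN : 0 < N) (bit : ℕ → ℕ) (V : ℕ → ℕ → Prop) (A B : ℕ → ℕ) :
    Merge N bit V (fun _ => 0) (fun _ => 0) A B 0 1 id where
  uf := .init N hN
  card := by simp
  mem i hi := absurd hi (Nat.not_lt_zero i)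
  gen E hE _ x _ y _ h := (show x = y from h) ▸ hE.refl x
  flag_one _ := ⟨rfl, fun i hi => absurd hi (Nat.not_lt_zero i)⟩
  flag_zero h := absurd h one_ne_zero

/-- Each queued pair has cost one root and a root always remains, so fewer than `N` pairs are ever
queued. -/
theorem Merge.lt {N : ℕ} {bit : ℕ → ℕ} {V : ℕ → ℕ → Prop} {par sz A B rt : ℕ → ℕ} {t flag : ℕ}
    (h : Merge N bit V par sz A B t flag rt) (hN : 0 < N) : t < N := by
  have h1 : 0 < ((Finset.range N).filter fun x => par x = 0).card :=
    Finset.card_pos.2 ⟨rt 0, by simp [h.uf.rt_lt 0 hN, h.uf.root 0 hN]⟩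
  have := h.card
  omega

/-- The union links roots, but the queue records the original pair `(p, q)`: this pair is reached by
a common word and, with the earlier pairs, generates the new partition. Both orientations in `hrr`
occur, as the sizes decide which root is hung. -/
theorem Merge.push {N : ℕ} {bit : ℕ → ℕ} {V : ℕ → ℕ → Prop} {par sz A B rt : ℕ → ℕ} {t flag : ℕ}
    (h : Merge N bit V par sz A B t flag rt) {p q r r' : ℕ} (hp : p < N) (hq : q < N)
    (hV : V p q) (hrr : r = rt p ∧ r' = rt q ∨ r = rt q ∧ r' = rt p) (hne : r ≠ r')
    (hle : sz r ≤ sz r') :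
    Merge N bit V (Function.update par r (r' + 1)) (Function.update sz r' (sz r' + sz r + 1))
      (Function.update A t p) (Function.update B t q) (t + 1) (if bit p = bit q then flag else 0)
      (fun x => if rt x = r then r' else rt x) := by
  have hrN : r < N := by rcases hrr with ⟨rfl, -⟩ | ⟨rfl, -⟩ <;> exact h.uf.rt_lt _ ‹_›
  have hrN' : r' < N := by rcases hrr with ⟨-, rfl⟩ | ⟨-, rfl⟩ <;> exact h.uf.rt_lt _ ‹_›
  have h0 : par r = 0 := by rcases hrr with ⟨rfl, -⟩ | ⟨rfl, -⟩ <;> exact h.uf.root _ ‹_›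
  have h0' : par r' = 0 := by rcases hrr with ⟨-, rfl⟩ | ⟨-, rfl⟩ <;> exact h.uf.root _ ‹_›
  have hA : ∀ i < t, Function.update A t p i = A i := fun i hi =>
    Function.update_of_ne (by omega) _ _
  have hB : ∀ i < t, Function.update B t q i = B i := fun i hi =>
    Function.update_of_ne (by omega) _ _
  refine ⟨h.uf.union hrN hrN' hne h0 h0' hle, ?_, ?_, ?_, ?_, ?_⟩
  · have h1 : (Finset.range N).filter (fun x => Function.update par r (r' + 1) x = 0) =
        ((Finset.range N).filter fun x => par x = 0).erase r := by
      ext x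
      simp only [Finset.mem_filter, Finset.mem_erase, Finset.mem_range]
      by_cases hx : x = r
      · simp [hx]
      · simp [hx]
    have hmem : r ∈ (Finset.range N).filter fun x => par x = 0 := by simp [hrN, h0]
    have h2 := Finset.card_erase_add_one hmem
    have := h.card
    rw [h1]
    omega
  · intro i hi
    rcases Nat.lt_succ_iff_lt_or_eq.1 hi with hi | rfl
    · rw [hA i hi, hB i hi]
      obtain ⟨h1, h2, h3, h4⟩ := h.mem i hi
      exact ⟨h1, h2, by rw [h3], h4⟩
    · simp only [Function.update_self]
      refine ⟨hp, hq, ?_, hV⟩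
      rcases hrr with ⟨h1, h2⟩ | ⟨h1, h2⟩
      · rw [if_pos h1.symm, if_neg fun h3 => hne (h3.symm.trans h2.symm), h2]
      · rw [if_pos h1.symm, if_neg fun h3 => hne (h3.symm.trans h2.symm), h2]
  · intro E hE hgen x hx y hy hxy
    have hpq : E p q := by simpa using hgen t (by omega)
    have hold := h.gen E hE fun i hi => by
      have := hgen i (by omega)
      rwa [hA i hi, hB i hi] at this
    have hcross : ∀ x < N, ∀ y < N, rt x = r → rt y = r' → E x y := by
      intro x hx y hy h1 h2
      rcases hrr with ⟨h3, h4⟩ | ⟨h3, h4⟩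
      · exact hE.trans (hold x hx p hp (h1.trans h3))
          (hE.trans hpq (hold q hq y hy (h4.symm.trans h2.symm)))
      · exact hE.trans (hold x hx q hq (h1.trans h3))
          (hE.trans (hE.symm hpq) (hold p hp y hy (h4.symm.trans h2.symm)))
    split_ifs at hxy with h1 h2 h2
    · exact hold x hx y hy (h1.trans h2.symm)
    · exact hcross x hx y hy h1 hxy.symm
    · exact hE.symm (hcross y hy x hx h2 hxy)
    · exact hold x hx y hy hxy
  · intro hf
    split_ifs at hf ⊢ with hbit
    · obtain ⟨h1, h2⟩ := h.flag_one hf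
      refine ⟨h1, fun i hi => ?_⟩
      rcases Nat.lt_succ_iff_lt_or_eq.1 hi with hi | rfl
      · rw [hA i hi, hB i hi, h2 i hi]
      · simpa using hbit
    · exact absurd rfl hf
  · intro hf
    split_ifs at hf with hbit
    · obtain ⟨i, hi, h1⟩ := h.flag_zero hf
      exact ⟨i, by omega, by rwa [hA i hi, hB i hi]⟩
    · exact ⟨t, by omega, by simpa using hbit⟩

/-- Merge the classes of the states in the variables `30` and `31`. -/
def relateProgram : Program := block [
  .assign 32 (.var 30),
  findProgram 32,
  .assign 33 (.var 31),
  findProgram 33,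
  .ite (.eq (.var 32) (.var 33)) .skip (block [
    .assign 29 (.cond (.eq (.read 11 (.var 30)) (.read 11 (.var 31))) (.var 29) (.lit 0)),
    .write 14 (.var 28) (.var 30),
    .write 15 (.var 28) (.var 31),
    .assign 28 (.var 28 + .lit 1),
    .ite (.lt (.read 13 (.var 33)) (.read 13 (.var 32)))
      (block [
        .write 13 (.var 32) (.read 13 (.var 32) + .read 13 (.var 33) + .lit 1),
        .write 12 (.var 33) (.var 32 + .lit 1)])
      (block [
        .write 13 (.var 33) (.read 13 (.var 33) + .read 13 (.var 32) + .lit 1),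
        .write 12 (.var 32) (.var 33 + .lit 1)])])]

/-- The merging process as a property of the memory. -/
def MergeState (N : ℕ) (bit : ℕ → ℕ) (V : ℕ → ℕ → Prop) (rt : ℕ → ℕ) (σ : Store) : Prop :=
  σ.arr 11 = bit ∧ Merge N bit V (σ.arr 12) (σ.arr 13) (σ.arr 14) (σ.arr 15) (σ.var 28) (σ.var 29) rt

theorem relate_run {N : ℕ} {bit rt : ℕ → ℕ} {V : ℕ → ℕ → Prop} (S : ℕ) (hS : N ≤ S) (σ : Store)
    (h : MergeState N bit V rt σ) (hp : σ.var 30 < N) (hq : σ.var 31 < N)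
    (hV : V (σ.var 30) (σ.var 31)) :
    Run S relateProgram σ fun τ t => t ≤ 16 * Nat.log 2 N + 100 ∧ ∃ rt', MergeState N bit V rt' τ ∧
      rt' (σ.var 30) = rt' (σ.var 31) ∧ (∀ x y, rt x = rt y → rt' x = rt' y) ∧
      σ.var 28 ≤ τ.var 28 ∧
      ∀ i < σ.var 28, τ.arr 14 i = σ.arr 14 i ∧ τ.arr 15 i = σ.arr 15 i := by
  obtain ⟨hbit, hm⟩ := h
  simp only [relateProgram, run_block_cons, run_assign]
  refine ⟨by simp, (find_run S 32 hS _ (rt := rt) (by simpa using hm.uf) (by simpa using hp)).imp ?_⟩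
  rintro _ t₁ ⟨rfl, ht₁⟩
  refine ⟨by simp, (find_run S 33 hS _ (rt := rt) (by simpa using hm.uf) (by simpa using hq)).imp ?_⟩
  rintro _ t₂ ⟨rfl, ht₂⟩
  simp only [Term.eval_var, setVar_setVar, Store.setVar_var, if_true, run_block_nil]
  simp only [run_ite, run_block_cons, run_block_nil, run_assign, run_write, run_skip]
  have hrp := hm.uf.rt_lt _ hp
  have hrq := hm.uf.rt_lt _ hq
  have ht := hm.lt (by omega)
  refine ⟨by simp, fun heq => ?_, fun hne => ?_⟩
  · simp at heq
    refine ⟨by simp; omega, rt, ⟨by simpa using hbit, by simpa using hm⟩, heq, fun _ _ => id, ?_, ?_⟩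
    · simp
    · simp
  · simp at hne
    refine ⟨by simp; omega, by simp; omega, by simp; omega, by simp, by simp; omega, fun hlt => ?_,
      fun hge => ?_⟩
    · simp at hlt
      refine ⟨by simp; omega, by simp; omega, by simp; omega,
        fun x => if rt x = rt (σ.var 31) then rt (σ.var 30) else rt x, ⟨by simpa using hbit, ?_⟩, ?_⟩
      · have := hm.push (r := rt (σ.var 31)) (r' := rt (σ.var 30)) hp hq hV (.inr ⟨rfl, rfl⟩)
          (Ne.symm hne) hlt.le
        simpa [hbit] using this
      · refine ⟨by simp [hne], fun x y hxy => by simp only [hxy], by simp, fun i hi => ?_⟩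
        simp [hi.ne]
    · simp at hge
      refine ⟨by simp; omega, by simp; omega, by simp; omega,
        fun x => if rt x = rt (σ.var 30) then rt (σ.var 31) else rt x, ⟨by simpa using hbit, ?_⟩, ?_⟩
      · have := hm.push (r := rt (σ.var 30)) (r' := rt (σ.var 31)) hp hq hV (.inl ⟨rfl, rfl⟩)
          hne hge
        simpa [hbit] using this
      · refine ⟨by simp [Ne.symm hne], fun x y hxy => by simp only [hxy], by simp, fun i hi => ?_⟩
        simp [hi.ne]

end SeqRVA

/-! ### The union-find equivalence test. -/

namespace SeqRVA

open Ram

/-- Follow the table `T` of an automaton with `K` letters. -/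
def tableStep (T : ℕ → ℕ) (K p a : ℕ) : ℕ := T (p * K + a)

/-- Some word leads from `s₁` to `x` and from `s₂` to `y`. -/
def PairReach (T : ℕ → ℕ) (K s₁ s₂ x y : ℕ) : Prop :=
  ∃ u : List ℕ, (∀ a ∈ u, a < K) ∧ u.foldl (tableStep T K) s₁ = x ∧ u.foldl (tableStep T K) s₂ = y

/-- Process letter number `34` for the pair number `27`. -/
def letterProgram : Program := block [
  .assign 30 (.read 2 (.read 14 (.var 27) * .var 5 + .var 34)),
  .assign 31 (.read 2 (.read 15 (.var 27) * .var 5 + .var 34)),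
  relateProgram,
  .assign 34 (.var 34 + .lit 1)]

/-- Process the pair number `27`. -/
def rowProgram : Program := block [
  .assign 34 (.lit 0),
  .loop (.lt (.var 34) (.var 5)) letterProgram,
  .assign 27 (.var 27 + .lit 1)]

/-- Compare the states in the variables `30` and `31`. -/
def compareProgram : Program := block [
  .assign 27 (.lit 0),
  .assign 28 (.lit 0),
  .assign 29 (.lit 1),
  relateProgram,
  .loop (.lt (.var 27) (.var 28)) rowProgram]

/-- The first `h` pairs and the first `a` letters of the next pair are processed. -/
structure CompareInv (N K : ℕ) (T bit : ℕ → ℕ) (s₁ s₂ h a : ℕ) (rt : ℕ → ℕ) (σ : Store) :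
    Prop where
  letters : σ.var 5 = K
  table : σ.arr 2 = T
  merge : MergeState N bit (PairReach T K s₁ s₂) rt σ
  head : σ.var 27 = h
  start : rt s₁ = rt s₂
  rows : ∀ i < h, ∀ c < K, rt (T (σ.arr 14 i * K + c)) = rt (T (σ.arr 15 i * K + c))
  row : ∀ c < a, rt (T (σ.arr 14 h * K + c)) = rt (T (σ.arr 15 h * K + c))
  le : h ≤ σ.var 28

section

variable {N K : ℕ} {T bit : ℕ → ℕ} {s₁ s₂ : ℕ}

/-- The word that reaches the current pair, extended by the letter, reaches the pair of successors.
Merging only coarsens the partition and keeps older queue entries, so what was processed before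
stays valid. -/
theorem letter_run (hT : ∀ p < N, ∀ a < K, T (p * K + a) < N) (S : ℕ) (hN : N ≤ S)
    (hNK : N * K ≤ S) {h a : ℕ} {rt : ℕ → ℕ} {σ : Store}
    (hi : CompareInv N K T bit s₁ s₂ h a rt σ) (h34 : σ.var 34 = a) (ha : a < K)
    (hlt : h < σ.var 28) :
    Run S letterProgram σ fun τ t => t ≤ 16 * Nat.log 2 N + 140 ∧
      ∃ rt', CompareInv N K T bit s₁ s₂ h (a + 1) rt' τ ∧ τ.var 34 = a + 1 ∧ h < τ.var 28 := by
  obtain ⟨h5, hT2, ⟨hbit, hm⟩, h27, hstart, hrows, hrow, hle⟩ := hi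
  obtain ⟨hA, hB, hAB, u, hu, hu1, hu2⟩ := hm.mem h hlt
  have hv1 := mul_add_lt hA ha
  have hv2 := mul_add_lt hB ha
  have htN := hm.lt (by omega)
  simp only [letterProgram, run_block_cons, run_block_nil, run_assign]
  refine ⟨by simp [h27, h5, h34]; omega, by simp [h27, h5, h34]; omega, ?_⟩
  have hrel := relate_run (N := N) (bit := bit) (rt := rt) (V := PairReach T K s₁ s₂) S hN
    ((σ.setVar 30 (T (σ.arr 14 h * K + a))).setVar 31 (T (σ.arr 15 h * K + a)))
    ⟨by simpa using hbit, by simpa using hm⟩ (by simpa using hT _ hA a ha)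
    (by simpa using hT _ hB a ha)
    ⟨u ++ [a], by simpa [or_imp, forall_and] using ⟨hu, ha⟩,
      by simp [hu1, tableStep], by simp [hu2, tableStep]⟩
  have hσ : ((σ.setVar 30 ((Term.read 2 (.read 14 (.var 27) * .var 5 + .var 34)).eval σ)).setVar 31
      ((Term.read 2 (.read 15 (.var 27) * .var 5 + .var 34)).eval (σ.setVar 30
        ((Term.read 2 (.read 14 (.var 27) * .var 5 + .var 34)).eval σ)))) =
      ((σ.setVar 30 (T (σ.arr 14 h * K + a))).setVar 31 (T (σ.arr 15 h * K + a))) := by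
    simp [h27, h5, h34, hT2]
  rw [hσ]
  refine hrel.frame.imp ?_
  rintro τ t ⟨⟨ht, rt', ⟨hbit', hm'⟩, hnew, hmono, h28, hq⟩, hvar, harr⟩
  simp only [Store.setVar_var, Store.setVar_arr] at hnew h28 hq
  simp at hnew h28 hq
  have g5 := hvar 5 rfl
  have g27 := hvar 27 rfl
  have g34 := hvar 34 rfl
  have g2 := harr 2 rfl
  simp only [Store.setVar_var, Store.setVar_arr] at g5 g27 g34 g2
  simp at g5 g27 g34
  refine ⟨by simp, by simp; omega, rt', ⟨by simp [g5, h5], by simp [g2, hT2],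
    ⟨by simpa using hbit', by simpa using hm'⟩, by simp [g27, h27], hmono _ _ hstart, ?_, ?_, ?_⟩,
    by simp [g34, h34], by simp; omega⟩
  · intro i hih c hc
    simp only [Store.setVar_arr]
    obtain ⟨e1, e2⟩ := hq i (by omega)
    rw [e1, e2]
    exact hmono _ _ (hrows i hih c hc)
  · intro c hc
    simp only [Store.setVar_arr]
    obtain ⟨e1, e2⟩ := hq h hlt
    rw [e1, e2]
    rcases Nat.lt_succ_iff_lt_or_eq.1 hc with hc | rfl
    · exact hmono _ _ (hrow c hc)
    · exact hnew
  · simp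
    omega

theorem row_run (hT : ∀ p < N, ∀ a < K, T (p * K + a) < N) (S : ℕ) (hN : N ≤ S)
    (hNK : N * K ≤ S) {h : ℕ} {rt : ℕ → ℕ} {σ : Store}
    (hi : CompareInv N K T bit s₁ s₂ h 0 rt σ) (hlt : h < σ.var 28) :
    Run S rowProgram σ fun τ t => t ≤ K * (16 * Nat.log 2 N + 150) + 20 ∧
      ∃ rt', CompareInv N K T bit s₁ s₂ (h + 1) 0 rt' τ := by
  simp only [rowProgram, run_block_cons, run_block_nil, run_assign]
  refine ⟨by simp, ?_⟩
  refine (run_loop (fun σ φ => ∃ a rt, a ≤ K ∧ CompareInv N K T bit s₁ s₂ h a rt σ ∧ σ.var 34 = a ∧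
    h < σ.var 28 ∧ φ = (K - a) * (16 * Nat.log 2 N + 150)) ?_ ?_
    (φ := K * (16 * Nat.log 2 N + 150)) ?_).imp ?_
  · intros; simp
  · rintro σ φ ⟨a, rt, haK, hi, h34, hlt, rfl⟩ h0
    simp only [Term.eval_lt, Term.eval_var, h34, hi.letters, ne_eq, ite_eq_right_iff, one_ne_zero,
      imp_false, not_not] at h0
    refine (letter_run hT S hN hNK hi h34 h0 hlt).imp ?_
    rintro τ t ⟨ht, rt', hi', h34', hlt'⟩
    refine ⟨_, ⟨a + 1, rt', h0, hi', h34', hlt', rfl⟩, ?_⟩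
    obtain ⟨e, rfl⟩ : ∃ e, K = a + 1 + e := ⟨K - (a + 1), by omega⟩
    rw [show a + 1 + e - a = e + 1 by omega, show a + 1 + e - (a + 1) = e by omega, Nat.add_mul,
      one_mul]
    simp
    omega
  · obtain ⟨h5, hT2, ⟨hbit, hm⟩, h27, hstart, hrows, hrow, hle⟩ := hi
    exact ⟨0, rt, Nat.zero_le _, ⟨by simpa using h5, by simpa using hT2,
      ⟨by simpa using hbit, by simpa using hm⟩, by simpa using h27, hstart, by simpa using hrows,
      by simp, by simpa using hle⟩, by simp, by simpa using hlt, by simp⟩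
  · rintro τ t ⟨h0, ψ, ⟨a, rt', haK, hi, h34, hlt, -⟩, ht⟩
    simp only [Term.eval_lt, Term.eval_var, h34, hi.letters, ite_eq_right_iff, one_ne_zero,
      imp_false] at h0
    obtain rfl : a = K := by omega
    obtain ⟨h5, hT2, ⟨hbit, hm⟩, h27, hstart, hrows, hrow, hle⟩ := hi
    refine ⟨by simp, ?_, rt', ⟨by simpa using h5, by simpa using hT2,
      ⟨by simpa using hbit, by simpa using hm⟩, by simp [h27], hstart, ?_, by simp,
      by simp; omega⟩⟩
    · simp at ht ⊢
      omega
    · intro i hi c hc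
      simp only [Store.setVar_arr]
      rcases Nat.lt_succ_iff_lt_or_eq.1 hi with hi | rfl
      · exact hrows i hi c hc
      · exact hrow c hc

theorem foldl_lt (hT : ∀ p < N, ∀ a < K, T (p * K + a) < N) {s : ℕ} (hs : s < N) (u : List ℕ)
    (hu : ∀ a ∈ u, a < K) : u.foldl (tableStep T K) s < N := by
  induction u generalizing s with
  | nil => exact hs
  | cons a u ih =>
    exact ih (hT s hs a (hu a (by simp))) fun c hc => hu c (by simp [hc])

/-- Flag 0 means that some queued pair has different bits; its common access word is a
counterexample. Otherwise `Merge.gen` extends two properties from the queue to all pairs in the same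
class: merged successors and equal bits. By induction on the word, the two runs then stay in common
classes. -/
theorem CompareInv.result (hT : ∀ p < N, ∀ a < K, T (p * K + a) < N) (h1 : s₁ < N) (h2 : s₂ < N)
    {rt : ℕ → ℕ} {σ : Store} (hi : CompareInv N K T bit s₁ s₂ (σ.var 28) 0 rt σ) :
    (σ.var 29 = 1 ∧ ∀ u : List ℕ, (∀ a ∈ u, a < K) →
      bit (u.foldl (tableStep T K) s₁) = bit (u.foldl (tableStep T K) s₂)) ∨
    (σ.var 29 = 0 ∧ ∃ u : List ℕ, (∀ a ∈ u, a < K) ∧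
      bit (u.foldl (tableStep T K) s₁) ≠ bit (u.foldl (tableStep T K) s₂)) := by
  obtain ⟨-, -, ⟨-, hm⟩, -, hstart, hrows, -, -⟩ := hi
  by_cases h0 : σ.var 29 = 0
  · obtain ⟨i, hi, hne⟩ := hm.flag_zero h0
    obtain ⟨-, -, -, u, hu, hu1, hu2⟩ := hm.mem i hi
    exact .inr ⟨h0, u, hu, by rwa [hu1, hu2]⟩
  · obtain ⟨hf, hbits⟩ := hm.flag_one h0
    refine .inl ⟨hf, fun u hu => ?_⟩
    have hcong := hm.gen (fun x y => ∀ c < K, rt (T (x * K + c)) = rt (T (y * K + c)))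
      ⟨fun _ _ _ => rfl, fun h c hc => (h c hc).symm, fun h h' c hc => (h c hc).trans (h' c hc)⟩
      hrows
    have hbit := hm.gen (fun x y => bit x = bit y)
      ⟨fun _ => rfl, fun h => h.symm, fun h h' => h.trans h'⟩ hbits
    have key : ∀ u : List ℕ, (∀ a ∈ u, a < K) → ∀ x < N, ∀ y < N, rt x = rt y →
        rt (u.foldl (tableStep T K) x) = rt (u.foldl (tableStep T K) y) := by
      intro u
      induction u with
      | nil => exact fun _ _ _ _ _ h => h
      | cons a u ih =>
        intro hu x hx y hy hxy
        have ha := hu a (by simp)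
        exact ih (fun c hc => hu c (by simp [hc])) _ (hT x hx a ha) _ (hT y hy a ha)
          (hcong x hx y hy hxy a ha)
    exact hbit _ (foldl_lt hT h1 u hu) _ (foldl_lt hT h2 u hu) (key u hu _ h1 _ h2 hstart)

theorem compare_run (hT : ∀ p < N, ∀ a < K, T (p * K + a) < N) (S : ℕ) (hN : N ≤ S)
    (hNK : N * K ≤ S) {σ : Store} (h5 : σ.var 5 = K) (hT2 : σ.arr 2 = T) (hbit : σ.arr 11 = bit)
    (h12 : σ.arr 12 = fun _ => 0) (h13 : σ.arr 13 = fun _ => 0) (h30 : σ.var 30 = s₁)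
    (h31 : σ.var 31 = s₂) (h1 : s₁ < N) (h2 : s₂ < N) :
    Run S compareProgram σ fun τ t =>
      t ≤ N * (K * (16 * Nat.log 2 N + 150) + 30) + 16 * Nat.log 2 N + 200 ∧
      ((τ.var 29 = 1 ∧ ∀ u : List ℕ, (∀ a ∈ u, a < K) →
        bit (u.foldl (tableStep T K) s₁) = bit (u.foldl (tableStep T K) s₂)) ∨
      (τ.var 29 = 0 ∧ ∃ u : List ℕ, (∀ a ∈ u, a < K) ∧
        bit (u.foldl (tableStep T K) s₁) ≠ bit (u.foldl (tableStep T K) s₂))) := by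
  simp only [compareProgram, run_block_cons, run_block_nil, run_assign]
  refine ⟨by simp, by simp, by simp, ?_⟩
  have hinit := Merge.init N (by omega) bit (PairReach T K s₁ s₂) (σ.arr 14) (σ.arr 15)
  have hrel := relate_run (N := N) (bit := bit) (rt := id) (V := PairReach T K s₁ s₂) S hN
    (((σ.setVar 27 0).setVar 28 0).setVar 29 1)
    ⟨by simpa using hbit, by simpa [h12, h13] using hinit⟩ (by simpa [h30] using h1)
    (by simpa [h31] using h2)
    ⟨[], by simp, by simp [h30], by simp [h31]⟩
  refine hrel.frame.imp ?_
  rintro τ t ⟨⟨ht, rt, hm, hnew, -, -, -⟩, hvar, harr⟩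
  have g5 := hvar 5 rfl
  have g27 := hvar 27 rfl
  have g2 := harr 2 rfl
  simp [h30, h31] at hnew g5 g27 g2
  refine (run_loop (fun σ φ => ∃ h rt, CompareInv N K T bit s₁ s₂ h 0 rt σ ∧
    φ = (N - h) * (K * (16 * Nat.log 2 N + 150) + 30)) ?_ ?_
    (φ := N * (K * (16 * Nat.log 2 N + 150) + 30)) ?_).imp ?_
  · intros; simp
  · rintro σ φ ⟨h, rt, hi, rfl⟩ h0
    simp only [Term.eval_lt, Term.eval_var, hi.head, ne_eq, ite_eq_right_iff, one_ne_zero,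
      imp_false, not_not] at h0
    have hlt := hi.merge.2.lt (by omega)
    refine (row_run hT S hN hNK hi h0).imp ?_
    rintro τ t ⟨ht, rt', hi'⟩
    refine ⟨_, ⟨h + 1, rt', hi', rfl⟩, ?_⟩
    obtain ⟨e, rfl⟩ : ∃ e, N = h + 1 + e := ⟨N - (h + 1), by omega⟩
    rw [show h + 1 + e - h = e + 1 by omega, show h + 1 + e - (h + 1) = e by omega, Nat.add_mul,
      one_mul]
    simp
    omega
  · exact ⟨0, rt, ⟨by rw [g5, h5], by rw [g2, hT2], hm, g27, hnew, by simp, by simp, by simp⟩,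
      by simp⟩
  · rintro τ' t' ⟨h0, ψ, ⟨h, rt', hi, -⟩, ht'⟩
    simp only [Term.eval_lt, Term.eval_var, hi.head, ite_eq_right_iff, one_ne_zero,
      imp_false] at h0
    obtain rfl : h = τ'.var 28 := le_antisymm hi.le (by omega)
    refine ⟨?_, hi.result hT h1 h2⟩
    simp at ht' ⊢
    omega

end

end SeqRVA

namespace SeqRVA

open Relation

/-! ### Coloring the states of an automaton -/

/-- The edges of the table `T` of an automaton with `K` letters. -/
def TableEdge (T : ℕ → ℕ) (K p q : ℕ) : Prop := ∃ a < K, T (p * K + a) = q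

/-- A coloring of the states in `D`, a set of states that is closed under successors. -/
structure Colored (N K : ℕ) (T acc : ℕ → ℕ) (D : ℕ → Prop) (col bit : ℕ → ℕ) : Prop where
  closed : ∀ x < N, D x → ∀ a < K, D (T (x * K + a)) ∧ col (T (x * K + a)) ≤ col x
  bit : ∀ x < N, D x → bit x = col x % 2
  parity : ∀ x < N, D x → TransGen (TableEdge T K) x x → (col x % 2 = 1 ↔ acc x ≠ 0)
  min : ∀ x < N, D x → col x ≠ 0 → ∃ y < N, D y ∧ ReflTransGen (TableEdge T K) x y ∧
    TransGen (TableEdge T K) y y ∧ col y = col x ∧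
    (col x = 1 ∨ ∃ z < N, D z ∧ ReflTransGen (TableEdge T K) y z ∧ col z + 1 = col x)

section

variable {N K : ℕ} {T acc : ℕ → ℕ}

theorem Colored.reach (hT : ∀ p < N, ∀ a < K, T (p * K + a) < N) {D : ℕ → Prop} {col bit : ℕ → ℕ}
    (h : Colored N K T acc D col bit) {x y : ℕ} (hx : x < N) (hD : D x)
    (hr : ReflTransGen (TableEdge T K) x y) : y < N ∧ D y := by
  induction hr with
  | refl => exact ⟨hx, hD⟩
  | tail _ hyz ih =>
    obtain ⟨a, ha, rfl⟩ := hyz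
    exact ⟨hT _ ih.1 a ha, (h.closed _ ih.1 ih.2 a ha).1⟩

/-- Color a strongly connected set `G` all of whose successors outside of `G` are colored. -/
theorem Colored.extend (hT : ∀ p < N, ∀ a < K, T (p * K + a) < N)
    {D G : ℕ → Prop} {col bit : ℕ → ℕ} {m c : ℕ}
    (h : Colored N K T acc D col bit) (hG : ∀ x, G x → x < N ∧ ¬ D x)
    (hGG : ∀ x y, G x → G y → ReflTransGen (TableEdge T K) x y)
    (hsucc : ∀ x, G x → ∀ a < K, G (T (x * K + a)) ∨ D (T (x * K + a)))
    (hm : ∀ x, G x → ∀ a < K, D (T (x * K + a)) → col (T (x * K + a)) ≤ m)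
    (hm' : m = 0 ∨ ∃ x a, G x ∧ a < K ∧ D (T (x * K + a)) ∧ col (T (x * K + a)) = m)
    (hc : c = m ∨ c = m + 1 ∧ ∃ x a, G x ∧ a < K ∧ G (T (x * K + a)))
    (hacc : (∃ x a, G x ∧ a < K ∧ G (T (x * K + a))) → ∀ x, G x → (c % 2 = 1 ↔ acc x ≠ 0))
    {D' : ℕ → Prop} {col' bit' : ℕ → ℕ} (hD' : ∀ x, D' x ↔ G x ∨ D x)
    (hcol : ∀ x, G x → col' x = c) (hcol' : ∀ x, ¬ G x → col' x = col x)
    (hbit : ∀ x, G x → bit' x = c % 2) (hbit' : ∀ x, ¬ G x → bit' x = bit x) :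
    Colored N K T acc D' col' bit' := by
  have hDG : ∀ x, D x → ¬ G x := fun x hx hg => (hG x hg).2 hx
  have hold : ∀ x, D x → col' x = col x := fun x hx => hcol' x (hDG x hx)
  have hmin : ∀ x < N, D x → ∀ x', ReflTransGen (TableEdge T K) x' x → col x ≠ 0 →
      ∃ y < N, D' y ∧ ReflTransGen (TableEdge T K) x' y ∧
        TransGen (TableEdge T K) y y ∧ col' y = col x ∧
        (col x = 1 ∨ ∃ z < N, D' z ∧ ReflTransGen (TableEdge T K) y z ∧ col' z + 1 = col x) := by
    intro x hx hD x' hx' h0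
    obtain ⟨y, hy, hDy, hxy, hyy, hc, hz⟩ := h.min x hx hD h0
    refine ⟨y, hy, (hD' y).2 (.inr hDy), hx'.trans hxy, hyy, by rw [hold y hDy, hc], ?_⟩
    rcases hz with hz | ⟨z, hz, hDz, hyz, hcz⟩
    · exact .inl hz
    · exact .inr ⟨z, hz, (hD' z).2 (.inr hDz), hyz, by rw [hold z hDz, hcz]⟩
  refine ⟨?_, ?_, ?_, ?_⟩
  · intro x hx hD a ha
    rcases (hD' x).1 hD with hg | hd
    · rw [hcol x hg]
      rcases hsucc x hg a ha with hg' | hd'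
      · exact ⟨(hD' _).2 (.inl hg'), (hcol _ hg').le⟩
      · refine ⟨(hD' _).2 (.inr hd'), ?_⟩
        rw [hold _ hd']
        have := hm x hg a ha hd'
        omega
    · obtain ⟨h1, h2⟩ := h.closed x hx hd a ha
      exact ⟨(hD' _).2 (.inr h1), by rwa [hold _ h1, hold _ hd]⟩
  · intro x hx hD
    rcases (hD' x).1 hD with hg | hd
    · rw [hcol x hg, hbit x hg]
    · rw [hcol' x (hDG x hd), hbit' x (hDG x hd), h.bit x hx hd]
  · intro x hx hD hxx
    rcases (hD' x).1 hD with hg | hd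
    · rw [hcol x hg]
      refine hacc ?_ x hg
      obtain ⟨z, ⟨a, ha, rfl⟩, hzx⟩ := TransGen.head'_iff.1 hxx
      rcases hsucc x hg a ha with hg' | hd'
      · exact ⟨x, a, hg, ha, hg'⟩
      · exact absurd (h.reach hT (hT x hx a ha) hd' hzx).2 (hG x hg).2
    · rw [hold x hd]
      exact h.parity x hx hd hxx
  · intro x hx hD h0
    rcases (hD' x).1 hD with hg | hd
    · rw [hcol x hg] at h0 ⊢
      -- With color `m`, the witness is that of a colored successor of color `m`. With color `m +
      -- 1`, the inner edge closes a cycle through `x` itself, and below it lies a successor of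
      -- color `m`, unless `m = 0`.
      rcases hc with rfl | ⟨rfl, x₁, a, hg₁, ha, hg₂⟩
      · rcases hm' with rfl | ⟨x₁, a, hg₁, ha, hd, rfl⟩
        · exact absurd rfl h0
        · exact hmin _ (hT _ (hG _ hg₁).1 a ha) hd x ((hGG x x₁ hg hg₁).tail ⟨a, ha, rfl⟩) h0
      · refine ⟨x, hx, hD, .refl, ?_, hcol x hg, ?_⟩
        · exact (TransGen.tail' (hGG x x₁ hg hg₁) ⟨a, ha, rfl⟩).trans_left (hGG _ x hg₂ hg)
        · rcases hm' with rfl | ⟨x₂, a₂, hg₂, ha₂, hd, rfl⟩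
          · exact .inl rfl
          · exact .inr ⟨_, hT _ (hG _ hg₂).1 a₂ ha₂, (hD' _).2 (.inr hd),
              (hGG x x₂ hg hg₂).tail ⟨a₂, ha₂, rfl⟩, by rw [hold _ hd]⟩
    · rw [hold x hd] at h0 ⊢
      exact hmin x hx hd x .refl h0

end

/-- The state of a depth-first search. The stack `S` has `nS` entries, and `I` gives their
positions plus one (`0` for the states not yet visited, `N + 1` for those that have left the
stack). It is divided into segments that start at the positions `B 1, …, B nB`, and the positions
plus one of the states with unexplored letters are among `Ts 1, …, Ts nT`. The first `e x` letters
of state `x` are explored. -/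
structure Search (N K : ℕ) (T S I B Ts e : ℕ → ℕ) (nS nB nT : ℕ) : Prop where
  stack : ∀ i < nS, S i < N ∧ I (S i) = i + 1
  index : ∀ x < N, I x ≠ 0 → (I x ≤ nS ∧ S (I x - 1) = x) ∨ I x = N + 1
  ts_zero : Ts 0 = 0
  ts_mono : ∀ k l, k < l → l ≤ nT → Ts k < Ts l
  ts_le : ∀ k ≤ nT, k ≤ Ts k ∧ Ts k ≤ nS
  b_mono : ∀ k l, 1 ≤ k → k < l → l ≤ nB → B k < B l
  b_lt : ∀ k, 1 ≤ k → k ≤ nB → k ≤ B k + 1 ∧ B k < nS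
  b_one : 0 < nS → 0 < nB ∧ B 1 = 0
  unexplored : ∀ i < nS, e (S i) < K → ∃ k ≤ nT, Ts k = i + 1
  reach : ∀ i < nS, ∀ j < nS, (∀ k, 1 ≤ k → k ≤ nB → B k ≤ i → B k ≤ j) →
    ReflTransGen (TableEdge T K) (S i) (S j)
  explored : ∀ i < nS, ∀ a < e (S i), ∀ k, 1 ≤ k → k ≤ nB → B k ≤ i → B k < I (T (S i * K + a))
  unvisited : ∀ x < N, I x = 0 → e x = 0

section

variable {N K : ℕ} {T S I B Ts e : ℕ → ℕ} {nS nB nT : ℕ}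

theorem Search.init (N K : ℕ) (T S B : ℕ → ℕ) :
    Search N K T S (fun _ => 0) B (fun _ => 0) (fun _ => 0) 0 0 0 where
  stack := by simp
  index := by simp
  ts_zero := rfl
  ts_mono := by omega
  ts_le := by simp
  b_mono := by omega
  b_lt := by omega
  b_one := by simp
  unexplored := by simp
  reach := by simp
  explored := by simp
  unvisited := by simp

/-- The positions in `I` show that the stack has no repetitions, and `w` is missing from it. -/
theorem Search.lt (h : Search N K T S I B Ts e nS nB nT) {w : ℕ} (hw : w < N) (h0 : I w = 0) :
    nS < N := by
  have hinj : Set.InjOn S (Finset.range nS) := by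
    intro i hi j hj hij
    have h1 := (h.stack i (by simpa using hi)).2
    have h2 := (h.stack j (by simpa using hj)).2
    rw [hij] at h1
    omega
  have hsub : (Finset.range nS).image S ⊆ (Finset.range N).erase w := by
    intro x hx
    obtain ⟨i, hi, rfl⟩ := Finset.mem_image.1 hx
    obtain ⟨h1, h2⟩ := h.stack i (by simpa using hi)
    simp only [Finset.mem_erase, Finset.mem_range]
    exact ⟨by rintro rfl; omega, h1⟩
  have := Finset.card_le_card hsub
  rw [Finset.card_image_of_injOn hinj, Finset.card_range,
    Finset.card_erase_of_mem (by simpa using hw), Finset.card_range] at this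
  omega

theorem Search.le (h : Search N K T S I B Ts e nS nB nT) : nS ≤ N := by
  have hinj : Set.InjOn S (Finset.range nS) := by
    intro i hi j hj hij
    have h1 := (h.stack i (by simpa using hi)).2
    have h2 := (h.stack j (by simpa using hj)).2
    rw [hij] at h1
    omega
  have hsub : (Finset.range nS).image S ⊆ Finset.range N := by
    intro x hx
    obtain ⟨i, hi, rfl⟩ := Finset.mem_image.1 hx
    simpa using (h.stack i (by simpa using hi)).1
  have := Finset.card_le_card hsub
  rwa [Finset.card_image_of_injOn hinj, Finset.card_range, Finset.card_range] at this

/-- Push the state `w`, which can be reached from all states of the stack. -/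
theorem Search.push (h : Search N K T S I B Ts e nS nB nT) {w : ℕ} (hw : w < N) (h0 : I w = 0)
    (hr : ∀ i < nS, ReflTransGen (TableEdge T K) (S i) w) :
    Search N K T (Function.update S nS w) (Function.update I w (nS + 1))
      (Function.update B (nB + 1) nS) (Function.update Ts (nT + 1) (nS + 1)) e
      (nS + 1) (nB + 1) (nT + 1) := by
  have hlt := h.lt hw h0
  have hS : ∀ i < nS, Function.update S nS w i = S i := fun i hi =>
    Function.update_of_ne (by omega) _ _
  have hSw : ∀ i < nS, S i ≠ w := by
    rintro i hi rfl
    have := (h.stack i hi).2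
    omega
  have hB : ∀ k ≤ nB, Function.update B (nB + 1) nS k = B k := fun k hk =>
    Function.update_of_ne (by omega) _ _
  have hTs : ∀ k ≤ nT, Function.update Ts (nT + 1) (nS + 1) k = Ts k := fun k hk =>
    Function.update_of_ne (by omega) _ _
  refine ⟨?_, ?_, ?_, ?_, ?_, ?_, ?_, ?_, ?_, ?_, ?_, ?_⟩
  · intro i hi
    rcases Nat.lt_succ_iff_lt_or_eq.1 hi with hi | rfl
    · rw [hS i hi, Function.update_of_ne (hSw i hi)]
      exact h.stack i hi
    · simp [hw]
  · intro x hx hxI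
    by_cases hxw : x = w
    · subst hxw
      simp
    · rw [Function.update_of_ne hxw] at hxI ⊢
      rcases h.index x hx hxI with ⟨h1, h2⟩ | h1
      · exact .inl ⟨by omega, by rw [hS _ (by omega), h2]⟩
      · exact .inr h1
  · rw [hTs 0 (by omega), h.ts_zero]
  · intro k l hkl hl
    rcases Nat.le_succ_iff.1 hl with hl | rfl
    · rw [hTs k (by omega), hTs l hl]
      exact h.ts_mono k l hkl hl
    · rw [hTs k (by omega), Function.update_self]
      have := h.ts_le k (by omega)
      omega
  · intro k hk
    rcases Nat.le_succ_iff.1 hk with hk | rfl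
    · rw [hTs k hk]
      have := h.ts_le k hk
      omega
    · rw [Function.update_self]
      have := h.ts_le nT le_rfl
      omega
  · intro k l hk hkl hl
    rcases Nat.le_succ_iff.1 hl with hl | rfl
    · rw [hB k (by omega), hB l hl]
      exact h.b_mono k l hk hkl hl
    · rw [hB k (by omega), Function.update_self]
      exact (h.b_lt k hk (by omega)).2
  · intro k hk hl
    rcases Nat.le_succ_iff.1 hl with hl | rfl
    · rw [hB k hl]
      have := h.b_lt k hk hl
      omega
    · rw [Function.update_self]
      rcases Nat.eq_zero_or_pos nB with h1 | h1
      · omega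
      · have := h.b_lt nB h1 le_rfl
        omega
  · intro _
    refine ⟨by omega, ?_⟩
    rcases Nat.eq_zero_or_pos nS with h1 | h1
    · subst h1
      rcases Nat.eq_zero_or_pos nB with h2 | h2
      · subst h2
        simp
      · have := h.b_lt 1 le_rfl h2
        omega
    · obtain ⟨h2, h3⟩ := h.b_one h1
      rw [hB 1 h2, h3]
  · intro i hi he
    rcases Nat.lt_succ_iff_lt_or_eq.1 hi with hi | rfl
    · rw [hS i hi] at he
      obtain ⟨k, hk, hk'⟩ := h.unexplored i hi he
      exact ⟨k, by omega, by rw [hTs k hk, hk']⟩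
    · exact ⟨nT + 1, le_rfl, by simp⟩
  · intro i hi j hj hij
    rcases Nat.lt_succ_iff_lt_or_eq.1 hj with hj | rfl
    · have hi : i < nS := by
        by_contra hi
        have := hij (nB + 1) (by omega) le_rfl (by simp; omega)
        simp at this
        omega
      rw [hS i hi, hS j hj]
      refine h.reach i hi j hj fun k hk hk' hki => ?_
      have := hij k hk (by omega)
      rw [hB k hk'] at this
      exact this hki
    · rw [Function.update_self]
      rcases Nat.lt_succ_iff_lt_or_eq.1 hi with hi | rfl
      · rw [hS i hi]
        exact hr i hi
      · rw [Function.update_self]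
  · intro i hi a ha k hk hk' hki
    rcases Nat.lt_succ_iff_lt_or_eq.1 hi with hi | rfl
    · rw [hS i hi] at ha ⊢
      rcases Nat.le_succ_iff.1 hk' with hk' | rfl
      · rw [hB k hk'] at hki ⊢
        have h1 := h.explored i hi a ha k hk hk' hki
        by_cases hTw : T (S i * K + a) = w
        · rw [hTw, Function.update_self]
          have := h.b_lt k hk hk'
          omega
        · rwa [Function.update_of_ne hTw]
      · rw [Function.update_self] at hki
        omega
    · rw [Function.update_self, h.unvisited w hw h0] at ha
      omega
  · intro x hx hxI
    have hxw : x ≠ w := by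
      rintro rfl
      simp at hxI
    rw [Function.update_of_ne hxw] at hxI
    exact h.unvisited x hx hxI

/-- The state on top of the stack of unexplored states reaches and is reached from everything in
the last segment; all states of the stack reach it. -/
theorem Search.reach_top (h : Search N K T S I B Ts e nS nB nT) (hlt : B nB < Ts nT) {i : ℕ}
    (hi : i < nS) : ReflTransGen (TableEdge T K) (S i) (S (Ts nT - 1)) := by
  have h1 := h.ts_le nT le_rfl
  refine h.reach i hi _ (by omega) fun k hk hk' _ => ?_
  rcases Nat.lt_or_ge k nB with h2 | h2
  · have := h.b_mono k nB hk h2 le_rfl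
    omega
  · obtain rfl : k = nB := by omega
    omega

/-- Merge the last segments after finding an edge to the state `w` of the stack. -/
theorem Search.merge (h : Search N K T S I B Ts e nS nB nT) (hlt : B nB < Ts nT) {w : ℕ}
    (hxw : TableEdge T K (S (Ts nT - 1)) w) (hw : w < N) (hIw : I w ≠ 0) {nB' : ℕ} (h1 : 1 ≤ nB')
    (hle : nB' ≤ nB) (hB : ∀ k, nB' < k → k ≤ nB → I w ≤ B k) :
    Search N K T S I B Ts e nS nB' nT := by
  refine ⟨h.stack, h.index, h.ts_zero, h.ts_mono, h.ts_le,
    fun k l hk hkl hl => h.b_mono k l hk hkl (by omega), fun k hk hk' => h.b_lt k hk (by omega),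
    fun h0 => ⟨by omega, (h.b_one h0).2⟩, h.unexplored, ?_,
    fun i hi a ha k hk hk' => h.explored i hi a ha k hk (by omega), h.unvisited⟩
  intro i hi j hj hij
  by_cases hold : ∀ k, 1 ≤ k → k ≤ nB → B k ≤ i → B k ≤ j
  · exact h.reach i hi j hj hold
  · push Not at hold
    obtain ⟨k, hk, hk', hki, hkj⟩ := hold
    have hk2 : nB' < k := by
      by_contra h2
      have := hij k hk (by omega) hki
      omega
    have hIk := hB k hk2 hk'
    have hkS := (h.b_lt k hk hk').2
    have hn := h.le
    -- The new case is a way back inside the merged segments: from `S i` to the top unexplored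
    -- state, along the new edge to `w`, and from there to `S j`. A `w` that has left the stack is
    -- impossible here, because `I w ≤ B k < nS ≤ N`.
    obtain ⟨h3, h4⟩ | h3 := h.index w hw hIw
    · refine ((h.reach_top hlt hi).tail hxw).trans ?_
      rw [← h4]
      refine h.reach _ (by omega) j hj fun l hl hl' hlw => hij l hl ?_ (by omega)
      by_contra h2
      have := hB l (by omega) hl'
      omega
    · omega

/-- Mark the next letter of the state at position `i` as explored. -/
theorem Search.mark (h : Search N K T S I B Ts e nS nB nT) {i : ℕ} (hi : i < nS)
    (he : e (S i) < K)
    (hw : ∀ k, 1 ≤ k → k ≤ nB → B k ≤ i → B k < I (T (S i * K + e (S i)))) :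
    Search N K T S I B Ts (Function.update e (S i) (e (S i) + 1)) nS nB nT := by
  have hinj : ∀ j < nS, S j = S i → j = i := by
    intro j hj hji
    have h1 := (h.stack i hi).2
    have h2 := (h.stack j hj).2
    rw [hji] at h2
    omega
  refine ⟨h.stack, h.index, h.ts_zero, h.ts_mono, h.ts_le, h.b_mono, h.b_lt, h.b_one, ?_, h.reach,
    ?_, ?_⟩
  · intro j hj hej
    by_cases hji : S j = S i
    · obtain rfl := hinj j hj hji
      exact h.unexplored j hj he
    · rw [Function.update_of_ne hji] at hej
      exact h.unexplored j hj hej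
  · intro j hj a ha
    by_cases hji : S j = S i
    · obtain rfl := hinj j hj hji
      rw [Function.update_self] at ha
      rcases Nat.lt_succ_iff_lt_or_eq.1 ha with ha | rfl
      · exact h.explored j hj a ha
      · exact hw
    · rw [Function.update_of_ne hji] at ha
      exact h.explored j hj a ha
  · intro y hy hyI
    have hyx : y ≠ S i := by
      rintro rfl
      have := (h.stack i hi).2
      omega
    rw [Function.update_of_ne hyx]
    exact h.unvisited y hy hyI

/-- Drop an explored state from the stack of unexplored states. -/
theorem Search.drop (h : Search N K T S I B Ts e nS nB nT) (hlt : B nB < Ts nT)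
    (he : K ≤ e (S (Ts nT - 1))) : Search N K T S I B Ts e nS nB (nT - 1) := by
  have hts := h.ts_le nT le_rfl
  refine ⟨h.stack, h.index, h.ts_zero, fun k l hkl hl => h.ts_mono k l hkl (by omega),
    fun k hk => h.ts_le k (by omega), h.b_mono, h.b_lt, h.b_one, ?_, h.reach, h.explored,
    h.unvisited⟩
  intro i hi hei
  obtain ⟨k, hk, hki⟩ := h.unexplored i hi hei
  refine ⟨k, ?_, hki⟩
  by_contra hk'
  obtain rfl : k = nT := by omega
  rw [hki, Nat.add_sub_cancel] at he
  omega

/-- The positions of the last segment are explored. -/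
theorem Search.explored_last (h : Search N K T S I B Ts e nS nB nT) (hge : Ts nT ≤ B nB) {i : ℕ}
    (hi : i < nS) (hBi : B nB ≤ i) : K ≤ e (S i) := by
  by_contra he
  obtain ⟨k, hk, hki⟩ := h.unexplored i hi (by omega)
  rcases Nat.lt_or_ge k nT with h2 | h2
  · have := h.ts_mono k nT h2 le_rfl
    omega
  · obtain rfl : k = nT := by omega
    omega

theorem Search.reach_last (h : Search N K T S I B Ts e nS nB nT) {i j : ℕ}
    (hi : i < nS) (hj : j < nS) (hBj : B nB ≤ j) :
    ReflTransGen (TableEdge T K) (S i) (S j) := by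
  refine h.reach i hi j hj fun k hk hk' _ => ?_
  rcases Nat.lt_or_ge k nB with h2 | h2
  · have := h.b_mono k nB hk h2 le_rfl
    omega
  · obtain rfl : k = nB := by omega
    omega

/-- Successors of the last segment belong to it or have left the stack. -/
theorem Search.succ_last (hT : ∀ p < N, ∀ a < K, T (p * K + a) < N)
    (h : Search N K T S I B Ts e nS nB nT) (hge : Ts nT ≤ B nB) {i a : ℕ}
    (hi : i < nS) (hBi : B nB ≤ i) (ha : a < K) :
    (∃ j, B nB ≤ j ∧ j < nS ∧ T (S i * K + a) = S j) ∨ I (T (S i * K + a)) = N + 1 := by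
  have h1 := (h.b_one (by omega)).1
  have h2 := h.explored i hi a (by have := h.explored_last hge hi hBi; omega) nB h1 le_rfl hBi
  rcases h.index _ (hT _ (h.stack i hi).1 a ha) (by omega) with ⟨h3, h4⟩ | h3
  · exact .inl ⟨_, by omega, by omega, h4.symm⟩
  · exact .inr h3

/-- Remove the last segment from the stack. -/
theorem Search.pop (h : Search N K T S I B Ts e nS nB nT) (hS : 0 < nS) (hge : Ts nT ≤ B nB)
    {I' : ℕ → ℕ} (hI : ∀ i < nS, B nB ≤ i → I' (S i) = N + 1)
    (hI' : ∀ x, (∀ i < nS, B nB ≤ i → S i ≠ x) → I' x = I x) :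
    Search N K T S I' B Ts e (B nB) (nB - 1) nT := by
  have hB1 := h.b_one hS
  have hBS := (h.b_lt nB hB1.1 le_rfl).2
  have hn := h.le
  have hI2 : ∀ i < B nB, I' (S i) = I (S i) := by
    intro i hi
    refine hI' _ fun j hj hBj heq => ?_
    have h1 := (h.stack i (by omega)).2
    have h2 := (h.stack j hj).2
    rw [heq] at h2
    omega
  -- Leaving the stack only raises an index, to `N + 1`. The lower bounds on the targets of explored
  -- edges therefore survive, and no state becomes unvisited.
  have hIle : ∀ x, I x ≤ I' x := by
    intro x
    by_cases hex : ∃ i < nS, B nB ≤ i ∧ S i = x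
    · obtain ⟨i, hi, hBi, rfl⟩ := hex
      rw [hI i hi hBi, (h.stack i hi).2]
      omega
    · push Not at hex
      exact (hI' x hex).ge
  refine ⟨?_, ?_, h.ts_zero, h.ts_mono, ?_, fun k l hk hkl hl => h.b_mono k l hk hkl (by omega),
    ?_, ?_, fun i hi => h.unexplored i (by omega), ?_, ?_, ?_⟩
  · intro i hi
    rw [hI2 i hi]
    exact h.stack i (by omega)
  · intro x hx hxI
    by_cases hex : ∃ i < nS, B nB ≤ i ∧ S i = x
    · obtain ⟨i, hi, hBi, rfl⟩ := hex
      exact .inr (hI i hi hBi)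
    · push Not at hex
      rw [hI' x hex] at hxI ⊢
      rcases h.index x hx hxI with ⟨h1, h2⟩ | h1
      · refine .inl ⟨?_, h2⟩
        by_contra h3
        exact hex (I x - 1) (by omega) (by omega) h2
      · exact .inr h1
  · intro k hk
    refine ⟨(h.ts_le k hk).1, ?_⟩
    rcases Nat.lt_or_ge k nT with h2 | h2
    · have := h.ts_mono k nT h2 le_rfl
      omega
    · obtain rfl : k = nT := by omega
      omega
  · intro k hk hk'
    exact ⟨(h.b_lt k hk (by omega)).1, h.b_mono k nB hk (by omega) le_rfl⟩
  · intro h0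
    refine ⟨?_, hB1.2⟩
    by_contra h2
    obtain rfl : nB = 1 := by omega
    omega
  · intro i hi j hj hij
    refine h.reach i (by omega) j (by omega) fun k hk hk' hki => ?_
    rcases Nat.lt_or_ge k nB with h2 | h2
    · exact hij k hk (by omega) hki
    · obtain rfl : k = nB := by omega
      omega
  · intro i hi a ha k hk hk' hki
    exact (h.explored i (by omega) a ha k hk (by omega) hki).trans_le (hIle _)
  · intro x hx hxI
    have := hIle x
    exact h.unvisited x hx (by omega)

end

end SeqRVA

/-! ### The potential of the search, and its steps in memory. -/

namespace SeqRVA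

open Ram Relation

/-- The part of the potential of a search that depends on the positions `I` and on the numbers `e`
of explored letters. -/
def weight (N K : ℕ) (I e : ℕ → ℕ) : ℕ :=
  ∑ x ∈ Finset.range N, (100 * (K - e x) + (if I x = 0 then 400 else 0) +
    if I x = N + 1 then 0 else 200 * (K + 1))

/-- The released 400 equals the 100 and 300 that the new entries for unexplored states and for
segments add to `potential`. So a push is neutral, and its own cost is paid by the explored letter
or by the advance of variable 19. -/
theorem weight_push {N K : ℕ} {I e : ℕ → ℕ} {w k : ℕ} (hw : w < N) (h0 : I w = 0) (hk : k < N) :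
    weight N K (Function.update I w (k + 1)) e + 400 = weight N K I e := by
  unfold weight
  rw [← Finset.add_sum_erase _ _ (Finset.mem_range.2 hw),
    ← Finset.add_sum_erase (Finset.range N) (fun x => 100 * (K - e x) +
      (if I x = 0 then 400 else 0) + if I x = N + 1 then 0 else 200 * (K + 1))
      (Finset.mem_range.2 hw)]
  rw [Finset.sum_congr rfl (g := fun x => 100 * (K - e x) +
      (if I x = 0 then 400 else 0) + if I x = N + 1 then 0 else 200 * (K + 1))]
  · have h2 : k ≠ N := by omega
    simp [h0, h2]
    omega
  · intro x hx
    rw [Function.update_of_ne (Finset.mem_erase.1 hx).1]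

theorem weight_explore {N K : ℕ} {I e : ℕ → ℕ} {x : ℕ} (hx : x < N) (he : e x < K) :
    weight N K I (Function.update e x (e x + 1)) + 100 = weight N K I e := by
  unfold weight
  rw [← Finset.add_sum_erase _ _ (Finset.mem_range.2 hx),
    ← Finset.add_sum_erase (Finset.range N) (fun x => 100 * (K - e x) +
      (if I x = 0 then 400 else 0) + if I x = N + 1 then 0 else 200 * (K + 1))
      (Finset.mem_range.2 hx)]
  rw [Finset.sum_congr rfl (g := fun x => 100 * (K - e x) +
      (if I x = 0 then 400 else 0) + if I x = N + 1 then 0 else 200 * (K + 1))]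
  · simp only [Function.update_self]
    omega
  · intro y hy
    rw [Function.update_of_ne (Finset.mem_erase.1 hy).1]

theorem weight_remove {N K : ℕ} {I e : ℕ → ℕ} {x : ℕ} (hx : x < N) (h0 : I x ≠ 0)
    (h1 : I x ≠ N + 1) :
    weight N K (Function.update I x (N + 1)) e + 200 * (K + 1) = weight N K I e := by
  unfold weight
  rw [← Finset.add_sum_erase _ _ (Finset.mem_range.2 hx),
    ← Finset.add_sum_erase (Finset.range N) (fun x => 100 * (K - e x) +
      (if I x = 0 then 400 else 0) + if I x = N + 1 then 0 else 200 * (K + 1))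
      (Finset.mem_range.2 hx)]
  rw [Finset.sum_congr rfl (g := fun x => 100 * (K - e x) +
      (if I x = 0 then 400 else 0) + if I x = N + 1 then 0 else 200 * (K + 1))]
  · simp [h0, h1]
    omega
  · intro y hy
    rw [Function.update_of_ne (Finset.mem_erase.1 hy).1]

/-- The state of the search that is stored in memory. -/
structure SearchState (N K : ℕ) (T acc : ℕ → ℕ) (σ : Store) : Prop where
  size : σ.var 4 = N
  letters : σ.var 5 = K
  table : σ.arr 2 = T
  accept : σ.arr 3 = acc
  search : Search N K T (σ.arr 4) (σ.arr 5) (σ.arr 7) (σ.arr 8) (σ.arr 9) (σ.var 16) (σ.var 17)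
    (σ.var 18)
  colored : Colored N K T acc (fun x => σ.arr 5 x = N + 1) (σ.arr 10) (σ.arr 11)
  visited : ∀ x < σ.var 19, σ.arr 5 x ≠ 0
  le : σ.var 19 ≤ N

/-- The potential of a search. -/
def potential (N K : ℕ) (σ : Store) : ℕ :=
  100 * (N - σ.var 19) + weight N K (σ.arr 5) (σ.arr 9) + 100 * σ.var 18 + 300 * σ.var 17

/-- Push the state in variable `21`. -/
def pushProgram : Program := block [
  .write 4 (.var 16) (.var 21),
  .assign 16 (.var 16 + .lit 1),
  .write 5 (.var 21) (.var 16),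
  .assign 17 (.var 17 + .lit 1),
  .write 7 (.var 17) (.var 16 - .lit 1),
  .assign 18 (.var 18 + .lit 1),
  .write 8 (.var 18) (.var 16)]

/-- Merge the last segments until the state in variable `21` belongs to the last segment or to an
earlier one. -/
def mergeProgram : Program :=
  .loop (.lt (.read 5 (.var 21)) (.read 7 (.var 17) + .lit 1)) (.assign 17 (.var 17 - .lit 1))

/-- Take account of the edge from the state at position number `25` with the letter number `26`. -/
def edgeProgram : Program := block [
  .assign 21 (.read 2 (.read 4 (.var 25) * .var 5 + .var 26)),
  .ite (.lt (.var 4) (.read 5 (.var 21)))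
    (.ite (.lt (.var 22) (.read 10 (.var 21)))
      (block [.assign 22 (.read 10 (.var 21)), .assign 23 (.read 11 (.var 21))])
      .skip)
    (.assign 24 (.lit 1)),
  .assign 26 (.var 26 + .lit 1)]

/-- Compute the greatest color `22` of the colored successors of the last segment, its parity `23`
and whether the segment has an inner edge `24`. -/
def scanProgram : Program := block [
  .assign 25 (.read 7 (.var 17)),
  .assign 26 (.lit 0),
  .assign 22 (.lit 0),
  .assign 23 (.lit 0),
  .assign 24 (.lit 0),
  .loop (.lt (.var 25) (.var 16))
    (.ite (.lt (.var 26) (.var 5)) edgeProgram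
      (block [.assign 25 (.var 25 + .lit 1), .assign 26 (.lit 0)]))]

/-- Compute the color `22` of the last segment and its parity `23`. -/
def chooseProgram : Program :=
  .ite (.var 24)
    (block [
      .assign 26 (.lt (.lit 0) (.read 3 (.read 4 (.read 7 (.var 17))))),
      .assign 22 (.var 22 + (.lit 1 - .eq (.var 23) (.var 26))),
      .assign 23 (.var 26)])
    .skip

/-- Color the last segment and remove it from the stack. -/
def paintProgram : Program := block [
  .assign 25 (.read 7 (.var 17)),
  .loop (.lt (.var 25) (.var 16)) (block [
    .assign 21 (.read 4 (.var 25)),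
    .write 5 (.var 21) (.var 4 + .lit 1),
    .write 10 (.var 21) (.var 22),
    .write 11 (.var 21) (.var 23),
    .assign 25 (.var 25 + .lit 1)]),
  .assign 16 (.read 7 (.var 17)),
  .assign 17 (.var 17 - .lit 1)]

/-- Explore the next letter of the state on top of the stack of unexplored states. -/
def exploreProgram : Program := block [
  .assign 20 (.read 4 (.read 8 (.var 18) - .lit 1)),
  .ite (.lt (.read 9 (.var 20)) (.var 5))
    (block [
      .assign 21 (.read 2 (.var 20 * .var 5 + .read 9 (.var 20))),
      .ite (.read 5 (.var 21)) mergeProgram pushProgram,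
      .write 9 (.var 20) (.read 9 (.var 20) + .lit 1)])
    (.assign 18 (.var 18 - .lit 1))]

/-- Start a search from state number `19` unless it was visited. -/
def startProgram : Program := block [
  .assign 21 (.var 19),
  .ite (.read 5 (.var 21)) .skip pushProgram,
  .assign 19 (.var 19 + .lit 1)]

/-- Color the states of the automaton. -/
def colorProgram : Program := block [
  .assign 16 (.lit 0),
  .assign 17 (.lit 0),
  .assign 18 (.lit 0),
  .assign 19 (.lit 0),
  .loop (.lt (.var 19) (.var 4) + .var 16)
    (.ite (.var 16)
      (.ite (.lt (.read 7 (.var 17)) (.read 8 (.var 18))) exploreProgram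
        (block [scanProgram, chooseProgram, paintProgram]))
      startProgram)]

section

variable {N K : ℕ} {T acc : ℕ → ℕ}

theorem Search.segments_le {S I B Ts e : ℕ → ℕ} {nS nB nT : ℕ}
    (h : Search N K T S I B Ts e nS nB nT) : nB ≤ nS := by
  rcases Nat.eq_zero_or_pos nB with h1 | h1
  · omega
  · have := h.b_lt nB h1 le_rfl
    omega

theorem push_run (S : ℕ) (hS : N < S) {σ : Store} (h : SearchState N K T acc σ)
    (hw : σ.var 21 < N) (h0 : σ.arr 5 (σ.var 21) = 0)
    (hr : ∀ i < σ.var 16, ReflTransGen (TableEdge T K) (σ.arr 4 i) (σ.var 21)) :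
    Run S pushProgram σ fun τ t => SearchState N K T acc τ ∧ t ≤ 40 ∧
      potential N K τ ≤ potential N K σ ∧ τ.arr 5 (σ.var 21) = σ.var 16 + 1 ∧
      (∀ i < σ.var 16, τ.arr 4 i = σ.arr 4 i) ∧ τ.var 16 = σ.var 16 + 1 := by
  have hlt := h.search.lt hw h0
  have hB := h.search.segments_le
  have hTs := h.search.ts_le _ le_rfl
  simp only [pushProgram, run_block_cons, run_block_nil, run_assign, run_write]
  refine ⟨by simp; omega, by simp, by simp; omega, by simp, by simp; omega, by simp,
    by simp; omega, ?_, ?_, ?_, ?_, ?_, ?_⟩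
  · refine ⟨by simpa using h.size, by simpa using h.letters, by simpa using h.table,
      by simpa using h.accept, ?_, ?_, ?_, by simpa using h.le⟩
    · have := h.search.push hw h0 hr
      simpa using this
    · have hD : ∀ x, Function.update (σ.arr 5) (σ.var 21) (σ.var 16 + 1) x = N + 1 ↔
          σ.arr 5 x = N + 1 := by
        intro x
        by_cases hx : x = σ.var 21
        · subst hx
          simp [h0]
          omega
        · simp [hx]
      simpa [hD] using h.colored
    · intro x hx
      simp at hx ⊢
      by_cases hxw : x = σ.var 21
      · simp [hxw]
      · simpa [hxw] using h.visited x hx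
  · simp
  · have := weight_push (K := K) (e := σ.arr 9) hw h0 hlt
    simp [potential]
    omega
  · simp
  · intro i hi
    have : i ≠ σ.var 16 := by omega
    simp [this]
  · simp

theorem SearchState.mark {σ : Store} (h : SearchState N K T acc σ) {i x : ℕ} (hi : i < σ.var 16)
    (hx : σ.arr 4 i = x) (he : σ.arr 9 x < K)
    (hw : ∀ k, 1 ≤ k → k ≤ σ.var 17 → σ.arr 7 k ≤ i →
      σ.arr 7 k < σ.arr 5 (T (x * K + σ.arr 9 x))) :
    SearchState N K T acc (σ.setArr 9 x (σ.arr 9 x + 1)) ∧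
      potential N K (σ.setArr 9 x (σ.arr 9 x + 1)) + 100 = potential N K σ := by
  subst hx
  refine ⟨⟨by simpa using h.size, by simpa using h.letters, by simpa using h.table,
    by simpa using h.accept, by simpa using h.search.mark hi he hw, by simpa using h.colored,
    by simpa using h.visited, by simpa using h.le⟩, ?_⟩
  have := weight_explore (I := σ.arr 5) (h.search.stack i hi).1 he
  simp [potential]
  omega

/-- The first segment starts at position 0, so the loop stops there at the latest. If the target has
left the stack, its index `N + 1` exceeds every boundary and nothing is merged. Each of the
iterations costs 20, against the 300 released by a removed boundary. -/
theorem merge_run (S : ℕ) (hS : N < S) {σ : Store} (h : SearchState N K T acc σ)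
    (hw : σ.var 21 < N) (h0 : σ.arr 5 (σ.var 21) ≠ 0) (h1 : 0 < σ.var 16) :
    Run S mergeProgram σ fun τ t => ∃ k, τ = σ.setVar 17 k ∧ 1 ≤ k ∧ k ≤ σ.var 17 ∧
      σ.arr 7 k < σ.arr 5 (σ.var 21) ∧
      (∀ l, k < l → l ≤ σ.var 17 → σ.arr 5 (σ.var 21) ≤ σ.arr 7 l) ∧
      t + 20 * k ≤ 20 * σ.var 17 + 10 := by
  have hB := h.search.segments_le
  have hn := h.search.le
  have hB1 := h.search.b_one h1
  refine (run_loop (fun τ φ => ∃ k, τ = σ.setVar 17 k ∧ 1 ≤ k ∧ k ≤ σ.var 17 ∧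
    (∀ l, k < l → l ≤ σ.var 17 → σ.arr 5 (σ.var 21) ≤ σ.arr 7 l) ∧ φ = 20 * k) ?_ ?_
    (φ := 20 * σ.var 17) ?_).imp ?_
  · rintro _ _ ⟨k, rfl, hk, hk', -, -⟩
    simp
    omega
  · rintro _ _ ⟨k, rfl, hk, hk', hl, rfl⟩ hc
    simp at hc
    simp only [run_assign]
    have hk1 : k ≠ 1 := by
      rintro rfl
      omega
    refine ⟨by simp, _, ⟨k - 1, by simp [setVar_setVar], by omega, by omega, ?_, rfl⟩, ?_⟩
    · intro l hl1 hl2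
      rcases Nat.lt_or_ge k l with h2 | h2
      · exact hl l h2 hl2
      · obtain rfl : l = k := by omega
        omega
    · simp
      omega
  · exact ⟨_, (setVar_self σ 17).symm, hB1.1, le_rfl, by omega, rfl⟩
  · rintro _ t ⟨hc, _, ⟨k, rfl, hk, hk', hl, rfl⟩, ht⟩
    simp at hc ht
    exact ⟨k, rfl, hk, hk', by omega, hl, by omega⟩

/-- A new letter pays 100, as does dropping a fully explored state. The spare 20 covers the tests of
the surrounding loop. -/
theorem explore_run (hT : ∀ p < N, ∀ a < K, T (p * K + a) < N) (S : ℕ) (hS : N < S)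
    (hNK : N * K ≤ S) {σ : Store} (h : SearchState N K T acc σ)
    (hlt : σ.arr 7 (σ.var 17) < σ.arr 8 (σ.var 18)) :
    Run S exploreProgram σ fun τ t => SearchState N K T acc τ ∧
      t + 20 + potential N K τ ≤ potential N K σ := by
  have hB := h.search.segments_le
  have hts := h.search.ts_le _ le_rfl
  have hn := h.search.le
  obtain ⟨hxN, hxI⟩ := h.search.stack (σ.arr 8 (σ.var 18) - 1) (by omega)
  set x := σ.arr 4 (σ.arr 8 (σ.var 18) - 1) with hx
  have hT0 : σ.var 18 ≠ 0 := by
    intro h0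
    rw [h0, h.search.ts_zero] at hlt
    omega
  simp only [exploreProgram, run_block_cons, run_block_nil, run_assign, run_ite]
  refine ⟨by simp; omega, by simp [← hx]; omega, ?_, ?_⟩
  · intro he
    simp [← hx, h.letters] at he
    have hwN := hT x hxN _ he
    have hidx := mul_add_lt hxN he
    have hσ : ((σ.setVar 20 ((Term.read 4 (.read 8 (.var 18) - .lit 1)).eval σ)).setVar 21
        ((Term.read 2 (.var 20 * .var 5 + .read 9 (.var 20))).eval
          (σ.setVar 20 ((Term.read 4 (.read 8 (.var 18) - .lit 1)).eval σ)))) =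
        (σ.setVar 20 x).setVar 21 (T (x * K + σ.arr 9 x)) := by
      simp [← hx, h.letters, h.table]
    rw [hσ]
    have hρ : SearchState N K T acc ((σ.setVar 20 x).setVar 21 (T (x * K + σ.arr 9 x))) :=
      ⟨by simpa using h.size, by simpa using h.letters, by simpa using h.table,
      by simpa using h.accept, by simpa using h.search, by simpa using h.colored,
      by simpa using h.visited, by simpa using h.le⟩
    have hpot : potential N K ((σ.setVar 20 x).setVar 21 (T (x * K + σ.arr 9 x))) =
      potential N K σ := by simp [potential]
    have hedge : TableEdge T K x (T (x * K + σ.arr 9 x)) := ⟨_, he, rfl⟩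
    refine ⟨by simp [← hx, h.letters]; omega, by simp; omega, ?_, ?_⟩
    · intro h0
      simp at h0
      refine (merge_run S hS hρ (by simpa using hwN) (by simpa using h0)
        (by simp; omega)).imp ?_
      rintro _ t ⟨k, rfl, hk, hk', hB1, hB2, ht⟩
      simp only [run_write]
      simp at hk' hB1 hB2 ht
      have hτ : SearchState N K T acc
          (((σ.setVar 20 x).setVar 21 (T (x * K + σ.arr 9 x))).setVar 17 k) := by
        refine ⟨by simpa using h.size, by simpa using h.letters, by simpa using h.table,
          by simpa using h.accept, ?_, by simpa using h.colored,
          by simpa using h.visited, by simpa using h.le⟩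
        simpa using h.search.merge hlt hedge hwN h0 hk hk' hB2
      obtain ⟨h1, h2⟩ := hτ.mark (i := σ.arr 8 (σ.var 18) - 1) (x := x) (by simp; omega)
        (by simp [← hx]) (by simpa using he) (by
          intro l hl hl' _
          simp at hl' ⊢
          rcases Nat.lt_or_ge l k with h2 | h2
          · have := h.search.b_mono l k hl h2 hk'
            omega
          · obtain rfl : l = k := by omega
            exact hB1)
      refine ⟨by simp; omega, by simpa using h1, ?_⟩
      simp [potential] at h2 hpot ⊢
      omega
    · intro h0
      simp at h0
      refine (push_run S hS hρ (by simpa using hwN) (by simpa using h0) ?_).frame.imp ?_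
      · intro i hi
        simp at hi ⊢
        exact (h.search.reach_top hlt hi).tail hedge
      · rintro τ t ⟨⟨hτ, ht, hp, hI, hS4, hS16⟩, hvar, harr⟩
        simp only [run_write]
        have g20 := hvar 20 rfl
        have g9 := harr 9 rfl
        simp at g20 g9 hI hS4 hS16
        have hxx := hS4 (σ.arr 8 (σ.var 18) - 1) (by omega)
        obtain ⟨h1, h2⟩ := hτ.mark (i := σ.arr 8 (σ.var 18) - 1) (x := x) (by omega)
          (by rw [hxx]) (by rwa [g9]) (by
            intro l hl hl' _
            have := hτ.search.b_lt l hl hl'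
            rw [g9, hI]
            omega)
        refine ⟨by simp [g20]; omega, by simpa [g20] using h1, ?_⟩
        simp [g20]
        omega
  · intro he
    simp [← hx, h.letters] at he
    refine ⟨by simp, ⟨by simpa using h.size, by simpa using h.letters, by simpa using h.table,
      by simpa using h.accept, ?_, by simpa using h.colored, by simpa using h.visited,
      by simpa using h.le⟩, ?_⟩
    · have := h.search.drop hlt he
      simpa using this
    · simp [potential]
      omega

theorem start_run (S : ℕ) (hS : N < S) {σ : Store} (h : SearchState N K T acc σ)
    (h0 : σ.var 16 = 0) (hlt : σ.var 19 < N) :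
    Run S startProgram σ fun τ t => SearchState N K T acc τ ∧
      t + 20 + potential N K τ ≤ potential N K σ := by
  have hρ : SearchState N K T acc (σ.setVar 21 (σ.var 19)) :=
    ⟨by simpa using h.size, by simpa using h.letters, by simpa using h.table,
    by simpa using h.accept, by simpa using h.search, by simpa using h.colored,
    by simpa using h.visited, by simpa using h.le⟩
  have hnext : ∀ τ : Store, SearchState N K T acc τ → τ.var 19 < N → τ.arr 5 (τ.var 19) ≠ 0 →
      SearchState N K T acc (τ.setVar 19 (τ.var 19 + 1)) ∧
      potential N K (τ.setVar 19 (τ.var 19 + 1)) + 100 = potential N K τ := by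
    intro τ h h1 h2
    refine ⟨⟨by simpa using h.size, by simpa using h.letters, by simpa using h.table,
      by simpa using h.accept, by simpa using h.search, by simpa using h.colored, ?_,
      by simp; omega⟩, ?_⟩
    · intro x hx
      simp at hx ⊢
      rcases Nat.lt_or_eq_of_le hx with hx | rfl
      · exact h.visited x hx
      · exact h2
    · simp [potential]
      omega
  simp only [startProgram, run_block_cons, run_block_nil, run_assign, run_ite, run_skip]
  refine ⟨by simp, by simp; omega, ?_, ?_⟩
  · intro h1
    simp at h1
    obtain ⟨h2, h3⟩ := hnext _ hρ (by simpa using hlt) (by simpa using h1)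
    refine ⟨by simp, by simpa using h2, ?_⟩
    simp [potential] at h3 ⊢
    omega
  · intro h1
    simp at h1
    refine (push_run S hS hρ (by simpa using hlt) (by simpa using h1) (by simp [h0])).frame.imp ?_
    rintro τ t ⟨⟨hτ, ht, hp, hI, -, -⟩, hvar, -⟩
    have g19 := hvar 19 rfl
    simp at g19 hI
    obtain ⟨h2, h3⟩ := hnext τ hτ (by omega) (by rw [g19]; omega)
    refine ⟨by simp, by simpa using h2, ?_⟩
    simp [potential] at h3 hp ⊢
    omega

end

end SeqRVA

/-! ### Scanning the outgoing edges of a completed segment. -/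

namespace SeqRVA

open Ram Relation

section

variable {N K : ℕ} {T acc : ℕ → ℕ}

/-- The edges of the segment `S b, …, S (n - 1)` with property `P` are taken into account: `m` is
the greatest color of their colored targets, `mb` is its parity, and `inn` tells whether some target
is not colored. -/
structure Scanned (N K : ℕ) (T S I col : ℕ → ℕ) (b n : ℕ) (P : ℕ → ℕ → Prop) (m mb inn : ℕ) :
    Prop where
  all : ∀ i a, b ≤ i → i < n → a < K → P i a →
    (I (T (S i * K + a)) = N + 1 → col (T (S i * K + a)) ≤ m) ∧
    (I (T (S i * K + a)) ≠ N + 1 → inn ≠ 0)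
  parity : mb = m % 2
  max : m = 0 ∨ ∃ i a, b ≤ i ∧ i < n ∧ a < K ∧ I (T (S i * K + a)) = N + 1 ∧
    col (T (S i * K + a)) = m
  inner : inn ≠ 0 → ∃ i a, b ≤ i ∧ i < n ∧ a < K ∧ I (T (S i * K + a)) ≠ N + 1

theorem Scanned.congr {S I col : ℕ → ℕ} {b n : ℕ} {P P' : ℕ → ℕ → Prop} {m mb inn : ℕ}
    (h : Scanned N K T S I col b n P m mb inn)
    (hP : ∀ i a, i < n → a < K → P' i a → P i a) : Scanned N K T S I col b n P' m mb inn :=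
  ⟨fun i a hb hn ha hp => h.all i a hb hn ha (hP i a hn ha hp), h.parity, h.max, h.inner⟩

/-- The memory during the scan of the last segment. -/
structure ScanState (N K : ℕ) (T : ℕ → ℕ) (σ τ : Store) (j a : ℕ) : Prop where
  arr : τ.arr = σ.arr
  var : ∀ x < 21, τ.var x = σ.var x
  pos : τ.var 25 = j
  letter : τ.var 26 = a
  pos_ge : σ.arr 7 (σ.var 17) ≤ j
  pos_le : j ≤ σ.var 16
  letter_le : a ≤ K
  scanned : Scanned N K T (σ.arr 4) (σ.arr 5) (σ.arr 10) (σ.arr 7 (σ.var 17)) (σ.var 16)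
    (fun i c => i < j ∨ i = j ∧ c < a) (τ.var 22) (τ.var 23) (τ.var 24)

theorem edge_run (hT : ∀ p < N, ∀ a < K, T (p * K + a) < N) (S : ℕ) (hS : N < S)
    (hNK : N * K ≤ S) {σ τ : Store} (h : SearchState N K T acc σ) {j a : ℕ}
    (hs : ScanState N K T σ τ j a) (hj : j < σ.var 16) (ha : a < K) :
    Run S edgeProgram τ fun τ' t => ScanState N K T σ τ' j (a + 1) ∧ t ≤ 60 := by
  obtain ⟨harr, hvar, h25, h26, hge, -, -, hscan⟩ := hs
  have hn := h.search.le
  have h4 := hvar 4 (by omega)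
  have h5 := hvar 5 (by omega)
  rw [h.size] at h4
  rw [h.letters] at h5
  have hx := (h.search.stack j hj).1
  have hidx := mul_add_lt hx ha
  have hw := hT _ hx a ha
  -- No index exceeds `N + 1`, so the test whether it is greater than `N` recognizes exactly the
  -- states that have left the stack, which are the colored ones.
  have hIle : σ.arr 5 (T (σ.arr 4 j * K + a)) ≤ N + 1 := by
    by_cases h0 : σ.arr 5 (T (σ.arr 4 j * K + a)) = 0
    · omega
    · have := h.search.index _ hw h0
      omega
  have hbit := h.colored.bit _ hw
  have hP : ∀ {i c : ℕ}, (i < j ∨ i = j ∧ c ≤ a) →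
      (i < j ∨ i = j ∧ c < a) ∨ (i = j ∧ c = a) := by omega
  simp only [edgeProgram, run_block_cons, run_block_nil, run_assign, run_ite, run_skip]
  refine ⟨by simp [harr, h25, h26, h5]; omega, by simp [harr, h25, h26, h5, h.table]; omega, ?_, ?_⟩
  · intro hI
    simp [harr, h25, h26, h5, h4, h.table] at hI
    refine ⟨by simp [harr, h25, h26, h5, h.table]; omega, ?_, ?_⟩
    · intro hc
      simp [harr, h25, h26, h5, h.table] at hc
      refine ⟨by simp [harr, h25, h26, h5, h.table]; omega,
        by simp [harr, h25, h26, h5, h.table]; omega, by simp, ⟨by simp [harr], ?_, by simp [h25],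
        by simp [h26], hge, hj.le, ha, ?_⟩, by simp⟩
      · intro x hx
        have e1 : x ≠ 21 := by omega
        have e2 : x ≠ 22 := by omega
        have e3 : x ≠ 23 := by omega
        have e4 : x ≠ 26 := by omega
        simp [e1, e2, e3, e4, hvar x hx]
      · simp [harr, h25, h26, h5, h.table]
        refine ⟨?_, hbit (by omega), .inr ⟨j, a, hge, hj, ha, by omega, rfl⟩, hscan.inner⟩
        intro i c hi hi' hc' hp
        rcases hP hp with hp | ⟨rfl, rfl⟩
        · obtain ⟨h1, h2⟩ := hscan.all i c hi hi' hc' hp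
          exact ⟨fun h3 => (h1 h3).trans hc.le, h2⟩
        · exact ⟨fun _ => le_rfl, fun h3 => absurd (by omega) h3⟩
    · intro hc
      simp [harr, h25, h26, h5, h.table] at hc
      refine ⟨by simp, ⟨by simp [harr], ?_, by simp [h25], by simp [h26], hge, hj.le, ha, ?_⟩,
        by simp⟩
      · intro x hx
        have e1 : x ≠ 21 := by omega
        have e4 : x ≠ 26 := by omega
        simp [e1, e4, hvar x hx]
      · simp
        refine ⟨?_, hscan.parity, hscan.max, hscan.inner⟩
        intro i c hi hi' hc' hp
        rcases hP hp with hp | ⟨rfl, rfl⟩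
        · exact hscan.all i c hi hi' hc' hp
        · exact ⟨fun _ => hc, fun h3 => absurd (by omega) h3⟩
  · intro hI
    simp [harr, h25, h26, h5, h4, h.table] at hI
    refine ⟨by simp, by simp, ⟨by simp [harr], ?_, by simp [h25], by simp [h26], hge, hj.le, ha,
      ?_⟩, by simp⟩
    · intro x hx
      have e1 : x ≠ 21 := by omega
      have e2 : x ≠ 24 := by omega
      have e4 : x ≠ 26 := by omega
      simp [e1, e2, e4, hvar x hx]
    · simp
      refine ⟨?_, hscan.parity, hscan.max, fun _ => ⟨j, a, hge, hj, ha, by omega⟩⟩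
      intro i c hi hi' hc' hp
      rcases hP hp with hp | ⟨rfl, rfl⟩
      · exact ⟨(hscan.all i c hi hi' hc' hp).1, fun _ => one_ne_zero⟩
      · exact ⟨fun h3 => absurd h3 (by omega), fun _ => one_ne_zero⟩

theorem scan_run (hT : ∀ p < N, ∀ a < K, T (p * K + a) < N) (S : ℕ) (hS : N < S)
    (hNK : N * K ≤ S) {σ : Store} (h : SearchState N K T acc σ) (h0 : 0 < σ.var 16) :
    Run S scanProgram σ fun τ t => τ.arr = σ.arr ∧ (∀ x < 21, τ.var x = σ.var x) ∧
      Scanned N K T (σ.arr 4) (σ.arr 5) (σ.arr 10) (σ.arr 7 (σ.var 17)) (σ.var 16)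
        (fun _ _ => True) (τ.var 22) (τ.var 23) (τ.var 24) ∧
      t ≤ 100 * ((σ.var 16 - σ.arr 7 (σ.var 17)) * (K + 1)) + 30 := by
  have hn := h.search.le
  have hB := h.search.segments_le
  have hB1 := h.search.b_lt _ (h.search.b_one h0).1 le_rfl
  set b := σ.arr 7 (σ.var 17) with hb
  simp only [scanProgram, run_block_cons, run_block_nil, run_assign]
  refine ⟨by simp; omega, by simp, by simp, by simp, by simp, ?_⟩
  refine (run_loop (fun τ φ => ∃ j a, ScanState N K T σ τ j a ∧
    φ = 100 * ((σ.var 16 - j) * (K + 1)) - 100 * a + (if j < σ.var 16 then 0 else 100 * a)) ?_ ?_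
    (φ := 100 * ((σ.var 16 - b) * (K + 1))) ?_).imp ?_
  · intros; simp
  · rintro τ φ ⟨j, a, hs, rfl⟩ hc
    have g16 := hs.var 16 (by omega)
    have g5 := hs.var 5 (by omega)
    simp only [Term.eval_lt, Term.eval_var, hs.pos, g16, ne_eq, ite_eq_right_iff, one_ne_zero,
      imp_false, not_not] at hc
    obtain ⟨r, hr⟩ : ∃ r, σ.var 16 - j = r + 1 := ⟨σ.var 16 - j - 1, by omega⟩
    have haK := hs.letter_le
    simp only [run_ite, run_block_cons, run_block_nil, run_assign]
    refine ⟨by simp, ?_, ?_⟩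
    · intro ha
      simp [hs.letter, g5, h.letters] at ha
      refine (edge_run hT S hS hNK h hs hc ha).imp ?_
      rintro τ' t ⟨hs', ht⟩
      refine ⟨_, ⟨j, a + 1, hs', rfl⟩, ?_⟩
      rw [hr, Nat.add_mul, one_mul, if_pos hc]
      simp
      omega
    · intro ha
      simp [hs.letter, g5, h.letters] at ha
      obtain rfl : a = K := by omega
      refine ⟨by simp, by simp, _, ⟨j + 1, 0, ⟨by simp [hs.arr], ?_, by simp [hs.pos], by simp,
        ?_, hc, by simp, ?_⟩, rfl⟩, ?_⟩
      · intro x hx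
        have e1 : x ≠ 25 := by omega
        have e2 : x ≠ 26 := by omega
        simp [e1, e2, hs.var x hx]
      · have := hs.pos_ge
        omega
      · simp
        exact hs.scanned.congr fun i c _ hc' hp => by omega
      · rw [if_pos hc, hr, show σ.var 16 - (j + 1) = r by omega, Nat.add_mul, one_mul]
        simp
        omega
  · refine ⟨b, 0, ⟨by simp, ?_, by simp [hb], by simp, le_rfl, hB1.2.le, by simp, ?_⟩, by simp⟩
    · intro x hx
      have e1 : x ≠ 25 := by omega
      have e2 : x ≠ 26 := by omega
      have e3 : x ≠ 22 := by omega
      have e4 : x ≠ 23 := by omega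
      have e5 : x ≠ 24 := by omega
      simp [e1, e2, e3, e4, e5]
    · simp
      exact ⟨fun i c hi hi' hc hp => by omega, by simp, by simp, by simp⟩
  · rintro τ t ⟨hc, ψ, ⟨j, a, hs, -⟩, ht⟩
    have g16 := hs.var 16 (by omega)
    simp only [Term.eval_lt, Term.eval_var, hs.pos, g16, ite_eq_right_iff, one_ne_zero,
      imp_false] at hc
    refine ⟨hs.arr, hs.var, hs.scanned.congr fun i c hi _ _ => by omega, ?_⟩
    simp at ht ⊢
    omega

end

end SeqRVA

/-! ### Coloring a completed component and removing it. -/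

namespace SeqRVA

open Ram Relation

section

variable {N K : ℕ} {T acc : ℕ → ℕ}

/-- With an inner edge, the color is the least number that is not below the successor colors and has
the required parity. One representative determines this parity by weakness. Parities are carried
along because no instruction computes remainders. -/
theorem choose_run (S : ℕ) (hS : N < S) {σ τ : Store} (h : SearchState N K T acc σ)
    (h0 : 0 < σ.var 16) (harr : τ.arr = σ.arr) (hvar : ∀ x < 21, τ.var x = σ.var x)
    (hpar : τ.var 23 = τ.var 22 % 2) :
    Run S chooseProgram τ fun τ' t => τ'.arr = σ.arr ∧ (∀ x < 21, τ'.var x = σ.var x) ∧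
      (τ'.var 22 = τ.var 22 ∨ τ'.var 22 = τ.var 22 + 1 ∧ τ.var 24 ≠ 0) ∧
      τ'.var 23 = τ'.var 22 % 2 ∧
      (τ.var 24 ≠ 0 → (τ'.var 22 % 2 = 1 ↔ acc (σ.arr 4 (σ.arr 7 (σ.var 17))) ≠ 0)) ∧
      t ≤ 40 := by
  have hn := h.search.le
  have hB := h.search.segments_le
  have hB1 := h.search.b_lt _ (h.search.b_one h0).1 le_rfl
  have hx := (h.search.stack _ hB1.2).1
  have h17 := hvar 17 (by omega)
  simp only [chooseProgram, run_block_cons, run_block_nil, run_assign, run_ite, run_skip]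
  refine ⟨by simp, ?_, ?_⟩
  · intro hi
    simp at hi
    refine ⟨by simp [harr, h17]; omega, by simp, by simp, by simp [harr], ?_, ?_, ?_, ?_, by simp⟩
    · intro x hx
      have e1 : x ≠ 22 := by omega
      have e2 : x ≠ 23 := by omega
      have e3 : x ≠ 26 := by omega
      simp [e1, e2, e3, hvar x hx]
    · simp [harr, h17, h.accept, hi, hpar]
      split_ifs <;> omega
    · simp [harr, h17, h.accept, hpar]
      split_ifs <;> omega
    · simp [harr, h17, h.accept, hpar]
      split_ifs <;> omega
  · intro hi
    simp at hi
    exact ⟨harr, hvar, by simp, hpar, fun h => absurd hi h, by simp⟩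

/-- The memory while the last segment is painted up to position `j`. -/
structure PaintState (N K : ℕ) (σ τ : Store) (c j : ℕ) : Prop where
  arr : ∀ a, a ≠ 5 → a ≠ 10 → a ≠ 11 → τ.arr a = σ.arr a
  var : ∀ x < 21, τ.var x = σ.var x
  pos : τ.var 25 = j
  color : τ.var 22 = c
  parity : τ.var 23 = c % 2
  pos_ge : σ.arr 7 (σ.var 17) ≤ j
  pos_le : j ≤ σ.var 16
  new : ∀ i < j, σ.arr 7 (σ.var 17) ≤ i → τ.arr 5 (σ.arr 4 i) = N + 1 ∧
    τ.arr 10 (σ.arr 4 i) = c ∧ τ.arr 11 (σ.arr 4 i) = c % 2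
  old : ∀ x, (∀ i < j, σ.arr 7 (σ.var 17) ≤ i → σ.arr 4 i ≠ x) → τ.arr 5 x = σ.arr 5 x ∧
    τ.arr 10 x = σ.arr 10 x ∧ τ.arr 11 x = σ.arr 11 x
  weight : weight N K (τ.arr 5) (σ.arr 9) + 200 * ((j - σ.arr 7 (σ.var 17)) * (K + 1)) =
    weight N K (σ.arr 5) (σ.arr 9)

theorem paint_run (S : ℕ) (hS : N < S) {σ τ : Store} {c : ℕ} (h : SearchState N K T acc σ)
    (h0 : 0 < σ.var 16) (harr : τ.arr = σ.arr) (hvar : ∀ x < 21, τ.var x = σ.var x)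
    (hc : τ.var 22 = c) (hpar : τ.var 23 = c % 2) :
    Run S paintProgram τ fun τ' t => ∃ ρ, PaintState N K σ ρ c (σ.var 16) ∧
      τ' = (ρ.setVar 16 (σ.arr 7 (σ.var 17))).setVar 17 (σ.var 17 - 1) ∧
      t ≤ 40 * (σ.var 16 - σ.arr 7 (σ.var 17)) + 30 := by
  have hn := h.search.le
  have hB := h.search.segments_le
  have hB1 := h.search.b_lt _ (h.search.b_one h0).1 le_rfl
  set b := σ.arr 7 (σ.var 17) with hb
  have h17 := hvar 17 (by omega)
  simp only [paintProgram, run_block_cons, run_block_nil, run_assign]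
  refine ⟨by simp [h17]; omega, ?_⟩
  refine (run_loop (fun τ φ => ∃ j, PaintState N K σ τ c j ∧ φ = 40 * (σ.var 16 - j)) ?_ ?_
    (φ := 40 * (σ.var 16 - b)) ?_).imp ?_
  · intros; simp
  · rintro τ φ ⟨j, hs, rfl⟩ hlt
    have g16 := hs.var 16 (by omega)
    have g4 := hs.var 4 (by omega)
    rw [h.size] at g4
    simp only [Term.eval_lt, Term.eval_var, hs.pos, g16, ne_eq, ite_eq_right_iff, one_ne_zero,
      imp_false, not_not] at hlt
    have harr4 := hs.arr 4 (by omega) (by omega) (by omega)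
    obtain ⟨hx, hxI⟩ := h.search.stack j hlt
    have hne : ∀ i < j, σ.arr 4 i ≠ σ.arr 4 j := by
      intro i hi heq
      have := (h.search.stack i (by omega)).2
      rw [heq] at this
      omega
    have hold := (hs.old (σ.arr 4 j) fun i hi _ => hne i hi).1
    have hge := hs.pos_ge
    have hp := hs.pos
    have hcol := hs.color
    have hpa := hs.parity
    have hweight := weight_remove (K := K) (e := σ.arr 9) (I := τ.arr 5) hx (by omega) (by omega)
    have hw2 := hs.weight
    rw [← hb] at hw2
    simp only [run_block_cons, run_block_nil, run_assign, run_write]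
    refine ⟨by simp [hp]; omega, by simp [hp, harr4]; omega, by simp [hp, harr4]; omega,
      by simp [hp, harr4]; omega, by simp, _, ⟨j + 1, ⟨?_, ?_, by simp [hp], by simp [hcol],
      by simp [hpa], by omega, hlt, ?_, ?_, ?_⟩, rfl⟩, by simp; omega⟩
    · intro a h1 h2 h3
      simp [h1, h2, h3, hs.arr a h1 h2 h3]
    · intro x hx
      have e1 : x ≠ 25 := by omega
      have e2 : x ≠ 21 := by omega
      simp [e1, e2, hs.var x hx]
    · intro i hi hbi
      rcases Nat.lt_succ_iff_lt_or_eq.1 hi with hi | rfl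
      · have := hs.new i hi hbi
        simpa [hp, harr4, hne i hi] using this
      · simp [hp, harr4, g4, hcol, hpa]
    · intro x hx
      have h1 := hx j (by omega) hge
      have h2 := hs.old x fun i hi => hx i (by omega)
      simpa [hp, harr4, h1.symm] using h2
    · simp [hp, harr4, g4]
      rw [show j + 1 - b = (j - b) + 1 by omega, Nat.add_mul, one_mul]
      omega
  · refine ⟨b, ⟨by simp [harr], ?_, by simp [harr, h17, hb], by simpa using hc,
      by simpa using hpar, le_rfl, hB1.2.le, by omega, by simp [harr], by simp [harr, ← hb]⟩, rfl⟩
    intro x hx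
    have e1 : x ≠ 25 := by omega
    simp [e1, hvar x hx]
  · rintro ρ t ⟨hlt, ψ, ⟨j, hs, -⟩, ht⟩
    have g16 := hs.var 16 (by omega)
    have g17 := hs.var 17 (by omega)
    have g7 := hs.arr 7 (by omega) (by omega) (by omega)
    simp only [Term.eval_lt, Term.eval_var, hs.pos, g16, ite_eq_right_iff, one_ne_zero,
      imp_false] at hlt
    have hle := hs.pos_le
    obtain rfl : j = σ.var 16 := by omega
    refine ⟨by simp [g17]; omega, by simp, ρ, hs, by simp [g7, g17, hb], ?_⟩
    simp at ht ⊢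
    omega

/-- When no unexplored state lies in the last segment, the segment is strongly connected and its
successors lie in it or are colored, so `Colored.extend` applies. Each removed state releases `200 *
(K + 1)`, enough to scan its `K` edges and to paint it; the removed boundary releases 300 for the
fixed costs. -/
theorem segment_run (hT : ∀ p < N, ∀ a < K, T (p * K + a) < N)
    (hacc : ∀ x < N, ∀ y < N, ReflTransGen (TableEdge T K) x y → ReflTransGen (TableEdge T K) y x →
      (acc x ≠ 0 ↔ acc y ≠ 0))
    (S : ℕ) (hS : N < S) (hNK : N * K ≤ S) {σ : Store} (h : SearchState N K T acc σ)
    (h0 : 0 < σ.var 16) (hge : σ.arr 8 (σ.var 18) ≤ σ.arr 7 (σ.var 17)) :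
    Run S (block [scanProgram, chooseProgram, paintProgram]) σ fun τ t =>
      SearchState N K T acc τ ∧ t + 30 + potential N K τ ≤ potential N K σ := by
  have hn := h.search.le
  have hB0 := (h.search.b_one h0).1
  have hB1 := h.search.b_lt _ hB0 le_rfl
  set b := σ.arr 7 (σ.var 17) with hb
  simp only [run_block_cons, run_block_nil]
  refine (scan_run hT S hS hNK h h0).imp ?_
  rintro τ₁ t₁ ⟨harr₁, hvar₁, hscan, ht₁⟩
  refine (choose_run S hS h h0 harr₁ hvar₁ hscan.parity).imp ?_
  rintro τ₂ t₂ ⟨harr₂, hvar₂, hc, hpar, hcacc, ht₂⟩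
  refine (paint_run S hS h h0 harr₂ hvar₂ rfl hpar).imp ?_
  rintro _ t₃ ⟨ρ, hs, rfl, ht₃⟩
  have hvar := hs.var
  have harr := hs.arr
  have hin : ∀ i < σ.var 16, b ≤ i → ∀ a < K, σ.arr 5 (T (σ.arr 4 i * K + a)) ≠ N + 1 →
      ∃ j, b ≤ j ∧ j < σ.var 16 ∧ T (σ.arr 4 i * K + a) = σ.arr 4 j := fun i hi hbi a ha hI =>
    (h.search.succ_last hT hge hi hbi ha).resolve_right hI
  have hG : ∀ i < σ.var 16, σ.arr 5 (σ.arr 4 i) ≠ N + 1 := by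
    intro i hi
    have := (h.search.stack i hi).2
    omega
  refine ⟨⟨?_, ?_, ?_, ?_, ?_, ?_, ?_, ?_⟩, ?_⟩
  · simpa [hvar] using h.size
  · simpa [hvar] using h.letters
  · simpa [harr] using h.table
  · simpa [harr] using h.accept
  · have := h.search.pop h0 hge (I' := ρ.arr 5) (fun i hi hbi => (hs.new i hi hbi).1)
      fun x hx => (hs.old x fun i hi hbi => hx i hi hbi).1
    simpa [hvar, harr] using this
  · refine h.colored.extend hT (G := fun x => ∃ i, b ≤ i ∧ i < σ.var 16 ∧ σ.arr 4 i = x)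
      (m := τ₁.var 22) (c := τ₂.var 22) ?_ ?_ ?_ ?_ ?_ ?_ ?_ ?_ ?_ ?_ ?_ ?_
    · rintro _ ⟨i, hbi, hi, rfl⟩
      exact ⟨(h.search.stack i hi).1, hG i hi⟩
    · rintro _ _ ⟨i, hbi, hi, rfl⟩ ⟨j, hbj, hj, rfl⟩
      exact h.search.reach_last hi hj hbj
    · rintro _ ⟨i, hbi, hi, rfl⟩ a ha
      rcases h.search.succ_last hT hge hi hbi ha with ⟨j, h1, h2, h3⟩ | h1
      · exact .inl ⟨j, h1, h2, h3.symm⟩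
      · exact .inr h1
    · rintro _ ⟨i, hbi, hi, rfl⟩ a ha hI
      exact (hscan.all i a hbi hi ha trivial).1 hI
    · rcases hscan.max with h1 | ⟨i, a, hbi, hi, ha, hI, hcol⟩
      · exact .inl h1
      · exact .inr ⟨_, a, ⟨i, hbi, hi, rfl⟩, ha, hI, hcol⟩
    · rcases hc with h1 | ⟨h1, h2⟩
      · exact .inl h1
      · obtain ⟨i, a, hbi, hi, ha, hI⟩ := hscan.inner h2
        obtain ⟨j, hbj, hj, hij⟩ := hin i hi hbi a ha hI
        exact .inr ⟨h1, _, a, ⟨i, hbi, hi, rfl⟩, ha, j, hbj, hj, hij.symm⟩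
    · rintro ⟨_, a, ⟨i, hbi, hi, rfl⟩, ha, j, hbj, hj, hij⟩ _ ⟨l, hbl, hl, rfl⟩
      have h1 : τ₁.var 24 ≠ 0 := (hscan.all i a hbi hi ha trivial).2 (by rw [← hij]; exact hG j hj)
      rw [hcacc h1]
      exact hacc _ (h.search.stack _ hB1.2).1 _ (h.search.stack _ hl).1
        (h.search.reach_last hB1.2 hl hbl) (h.search.reach_last hl hB1.2 le_rfl)
    · intro x
      simp only [Store.setVar_arr]
      by_cases hx : ∃ i, b ≤ i ∧ i < σ.var 16 ∧ σ.arr 4 i = x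
      · obtain ⟨i, hbi, hi, rfl⟩ := hx
        exact iff_of_true (hs.new i hi hbi).1 (.inl ⟨i, hbi, hi, rfl⟩)
      · rw [(hs.old x fun i hi hbi heq => hx ⟨i, hbi, hi, heq⟩).1]
        simp only [hx, false_or]
    · rintro _ ⟨i, hbi, hi, rfl⟩
      exact (hs.new i hi hbi).2.1
    · rintro x hx
      exact (hs.old x fun i hi hbi heq => hx ⟨i, hbi, hi, heq⟩).2.1
    · rintro _ ⟨i, hbi, hi, rfl⟩
      exact (hs.new i hi hbi).2.2
    · rintro x hx
      exact (hs.old x fun i hi hbi heq => hx ⟨i, hbi, hi, heq⟩).2.2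
  · intro x hx
    simp [hvar] at hx ⊢
    by_cases hx' : ∃ i, b ≤ i ∧ i < σ.var 16 ∧ σ.arr 4 i = x
    · obtain ⟨i, hbi, hi, rfl⟩ := hx'
      rw [(hs.new i hi hbi).1]
      omega
    · rw [(hs.old x fun i hi hbi heq => hx' ⟨i, hbi, hi, heq⟩).1]
      exact h.visited x hx
  · simpa [hvar] using h.le
  · have hw := hs.weight
    have hKpos : σ.var 16 - b ≤ (σ.var 16 - b) * (K + 1) := Nat.le_mul_of_pos_right _ (by omega)
    simp only [← hb] at hw ht₁ ht₃
    simp [potential, hvar, harr]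
    omega

theorem weight_init (N K : ℕ) : weight N K (fun _ => 0) (fun _ => 0) = N * (300 * K + 600) := by
  simp [weight]
  left
  omega

theorem color_run (hT : ∀ p < N, ∀ a < K, T (p * K + a) < N)
    (hacc : ∀ x < N, ∀ y < N, ReflTransGen (TableEdge T K) x y → ReflTransGen (TableEdge T K) y x →
      (acc x ≠ 0 ↔ acc y ≠ 0))
    (S : ℕ) (hS : N < S) (hNK : N * K ≤ S) {σ : Store} (h4 : σ.var 4 = N) (h5 : σ.var 5 = K)
    (hT2 : σ.arr 2 = T) (hacc3 : σ.arr 3 = acc) (h0 : ∀ a, 4 ≤ a → σ.arr a = fun _ => 0) :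
    Run S colorProgram σ fun τ t => t ≤ N * (300 * K + 700) + 20 ∧
      Colored N K T acc (fun x => x < N) (τ.arr 10) (τ.arr 11) := by
  simp only [colorProgram, run_block_cons, run_block_nil, run_assign]
  refine ⟨by simp, by simp, by simp, by simp, ?_⟩
  refine (run_loop (fun τ φ => SearchState N K T acc τ ∧ φ = potential N K τ) ?_ ?_
    (φ := N * (300 * K + 700)) ?_).imp ?_
  · intros; simp
  · rintro τ _ ⟨h, rfl⟩ hc
    simp only [Term.eval_add, Term.eval_lt, Term.eval_var, h.size] at hc
    have hn := h.search.le
    have hB := h.search.segments_le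
    have hts := h.search.ts_le _ le_rfl
    simp only [run_ite]
    refine ⟨by simp, ?_, ?_⟩
    · intro h16
      simp at h16
      refine ⟨by simp; omega, ?_, ?_⟩
      · intro hlt
        refine (explore_run hT S hS hNK h (by by_contra h1; exact hlt (if_neg h1))).imp ?_
        rintro τ' t ⟨h', ht⟩
        refine ⟨_, ⟨h', rfl⟩, ?_⟩
        simp
        omega
      · intro hlt
        refine (segment_run hT hacc S hS hNK h (by omega)
          (by by_contra h1; exact one_ne_zero ((if_pos (not_le.1 h1)).symm.trans hlt))).imp ?_
        rintro τ' t ⟨h', ht⟩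
        refine ⟨_, ⟨h', rfl⟩, ?_⟩
        simp
        omega
    · intro h16
      simp at h16
      have hlt : τ.var 19 < N := by
        by_contra h1
        simp [h16, h1] at hc
      refine (start_run S hS h h16 hlt).imp ?_
      rintro τ' t ⟨h', ht⟩
      refine ⟨_, ⟨h', rfl⟩, ?_⟩
      simp
      omega
  · refine ⟨⟨by simpa using h4, by simpa using h5, by simpa using hT2, by simpa using hacc3, ?_, ?_,
      by simp, by simp⟩, ?_⟩
    · simpa [h0] using Search.init N K T (fun _ => 0) (fun _ => 0)
    · simp [h0]
      exact ⟨by simp, by simp, by simp, by simp⟩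
    · simp [potential, h0, weight_init]
      ring
  · rintro τ t ⟨hc, _, ⟨h, rfl⟩, ht⟩
    simp only [Term.eval_add, Term.eval_lt, Term.eval_var, h.size, Nat.add_eq_zero_iff,
      ite_eq_right_iff, one_ne_zero, imp_false] at hc
    refine ⟨by simp at ht ⊢; omega, ?_⟩
    -- At the end all states have been visited and the stack is empty, so every state has left it
    -- and is colored.
    have hD : ∀ x < N, τ.arr 5 x = N + 1 := by
      intro x hx
      have := h.search.index x hx (h.visited x (by omega))
      have := h.visited x (by omega)
      omega
    have hcol := h.colored
    refine ⟨fun x hx _ a ha => ⟨hT x hx a ha, (hcol.closed x hx (hD x hx) a ha).2⟩,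
      fun x hx _ => hcol.bit x hx (hD x hx), fun x hx _ => hcol.parity x hx (hD x hx), ?_⟩
    intro x hx _ hx0
    obtain ⟨y, hy, -, h1, h2, h3, h4⟩ := hcol.min x hx (hD x hx) hx0
    refine ⟨y, hy, hy, h1, h2, h3, h4.imp_right ?_⟩
    rintro ⟨z, hz, -, h5⟩
    exact ⟨z, hz, hz, h5⟩

end

end SeqRVA

namespace SeqRVA

open Ram Relation

/-! ### The decision procedure -/

/-- The table `T` and the array `acc` present the automaton with transition function `δ` and set of
accepting states `F`, with the states numbered by `code`. -/
structure Presents {Q : Type*} {K : ℕ} (N : ℕ) (δ : Q → Fin K → Q) (F : Set Q) (code : Q → ℕ)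
    (T acc : ℕ → ℕ) : Prop where
  inj : Function.Injective code
  lt : ∀ x, code x < N
  surj : ∀ p < N, ∃ x, code x = p
  step : ∀ x (a : Fin K), T (code x * K + a) = code (δ x a)
  accept : ∀ x, acc (code x) ≠ 0 ↔ x ∈ F

section

variable {Q : Type*} {N K : ℕ} {δ : Q → Fin K → Q} {F : Set Q} {code : Q → ℕ} {T acc : ℕ → ℕ}

theorem Presents.table_lt (h : Presents N δ F code T acc) : ∀ p < N, ∀ a < K, T (p * K + a) < N := by
  intro p hp a ha
  obtain ⟨x, rfl⟩ := h.surj p hp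
  exact (h.step x ⟨a, ha⟩).trans_lt (h.lt _)

theorem Presents.edge (h : Presents N δ F code T acc) {x y : Q} :
    TableEdge T K (code x) (code y) ↔ Edge δ x y := by
  constructor
  · rintro ⟨a, ha, hxy⟩
    exact ⟨⟨a, ha⟩, h.inj ((h.step x ⟨a, ha⟩).symm.trans hxy)⟩
  · rintro ⟨a, rfl⟩
    exact ⟨a, a.isLt, h.step x a⟩

theorem Presents.exists_edge (h : Presents N δ F code T acc) {x : Q} {p : ℕ}
    (hp : TableEdge T K (code x) p) : ∃ y, code y = p := by
  obtain ⟨a, ha, rfl⟩ := hp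
  exact ⟨_, (h.step x ⟨a, ha⟩).symm⟩

theorem Presents.reach (h : Presents N δ F code T acc) {x y : Q} :
    ReflTransGen (TableEdge T K) (code x) (code y) ↔ ReflTransGen (Edge δ) x y := by
  constructor
  · intro hr
    suffices H : ∀ p, ReflTransGen (TableEdge T K) (code x) p →
        ∃ z, code z = p ∧ ReflTransGen (Edge δ) x z by
      obtain ⟨z, hz, hxz⟩ := H _ hr
      rwa [← h.inj hz]
    intro p hp
    induction hp with
    | refl => exact ⟨x, rfl, .refl⟩
    | tail _ he ih =>
      obtain ⟨z, rfl, hz⟩ := ih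
      obtain ⟨w, rfl⟩ := h.exists_edge he
      exact ⟨w, rfl, hz.tail (h.edge.1 he)⟩
  · intro hr
    exact ReflTransGen.lift code (fun _ _ => h.edge.2) _ _ hr

theorem Presents.transGen (h : Presents N δ F code T acc) {x y : Q} :
    TransGen (TableEdge T K) (code x) (code y) ↔ TransGen (Edge δ) x y := by
  simp only [TransGen.head'_iff]
  constructor
  · rintro ⟨p, hp, hr⟩
    obtain ⟨z, rfl⟩ := h.exists_edge hp
    exact ⟨z, h.edge.1 hp, h.reach.1 hr⟩
  · rintro ⟨z, hz, hr⟩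
    exact ⟨code z, h.edge.2 hz, h.reach.2 hr⟩

theorem Presents.foldl (h : Presents N δ F code T acc) (x : Q) (u : List (Fin K)) :
    (u.map Fin.val).foldl (tableStep T K) (code x) = code (u.foldl δ x) := by
  induction u generalizing x with
  | nil => rfl
  | cons a u ih =>
    rw [List.map_cons, List.foldl_cons, List.foldl_cons, ← ih, tableStep, h.step]

theorem Presents.acc_iff (h : Presents N δ F code T acc) (hF : WeakSet δ F) : ∀ x < N, ∀ y < N,
    ReflTransGen (TableEdge T K) x y → ReflTransGen (TableEdge T K) y x →
    (acc x ≠ 0 ↔ acc y ≠ 0) := by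
  intro p hp q hq hpq hqp
  obtain ⟨x, rfl⟩ := h.surj p hp
  obtain ⟨y, rfl⟩ := h.surj q hq
  rw [h.accept, h.accept]
  exact hF.mem_iff (h.reach.1 hpq) (h.reach.1 hqp)

theorem Presents.isColoring (h : Presents N δ F code T acc) {col bit : ℕ → ℕ}
    (hc : Colored N K T acc (fun x => x < N) col bit) : IsColoring δ F fun x => col (code x) := by
  refine ⟨?_, ?_, ?_⟩
  · intro x a
    rw [← h.step]
    exact (hc.closed _ (h.lt x) (h.lt x) a a.isLt).2
  · intro x hx
    rw [← h.accept]
    exact hc.parity _ (h.lt x) (h.lt x) (h.transGen.2 hx)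
  · intro x hx
    obtain ⟨p, hp, -, h1, h2, h3, h4⟩ := hc.min _ (h.lt x) (h.lt x) hx
    obtain ⟨y, rfl⟩ := h.surj p hp
    refine ⟨y, h.reach.1 h1, h.transGen.1 h2, h3, h4.imp_right ?_⟩
    rintro ⟨q, hq, -, h5, h6⟩
    obtain ⟨z, rfl⟩ := h.surj q hq
    exact ⟨z, h.reach.1 h5, h6⟩

/-- This links the computation to the languages: the bits compared by the equivalence test are the
parities of a coloring of the presented automaton. -/
theorem Presents.forall_accepts_iff [Finite Q] (h : Presents N δ F code T acc) (hF : WeakSet δ F)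
    {col bit : ℕ → ℕ} (hc : Colored N K T acc (fun x => x < N) col bit) (x y : Q) :
    (∀ w, Accepts δ F x w ↔ Accepts δ F y w) ↔ ∀ u : List ℕ, (∀ a ∈ u, a < K) →
      bit (u.foldl (tableStep T K) (code x)) = bit (u.foldl (tableStep T K) (code y)) := by
  rw [(h.isColoring hc).forall_accepts_iff hF]
  have hbit : ∀ z, bit (code z) = col (code z) % 2 := fun z => hc.bit _ (h.lt z) (h.lt z)
  constructor
  · intro hxy u hu
    obtain ⟨v, rfl⟩ : ∃ v : List (Fin K), v.map Fin.val = u :=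
      ⟨u.pmap (fun a ha => ⟨a, ha⟩) hu, by simp [List.map_pmap]⟩
    rw [h.foldl, h.foldl, hbit, hbit]
    exact hxy v
  · intro hxy u
    have := hxy (u.map Fin.val) (by simp)
    rwa [h.foldl, h.foldl, hbit, hbit] at this

end

/-- The decision procedure. -/
def decideProgram : Program := block [
  initProgram,
  tableProgram,
  colorProgram,
  .assign 30 (.lit 0),
  .assign 31 (.var 2 * .var 1),
  compareProgram,
  .assign 0 (.var 29)]

theorem decide_run {b d n : ℕ} (M : BuchiAutomaton (Fin n) (WithStar (Fin b))) (hb : 2 ≤ b)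
    (hd : 1 ≤ d) (hM : M.IsWeak) : Run (10 * n * d * (2 * b)) decideProgram (input b d n M)
      fun τ t => (IsSeqRVA d M → τ.var 0 = 1) ∧ (¬ IsSeqRVA d M → τ.var 0 = 0) ∧
        t ≤ 50000 * (n * d * b) * (Nat.log 2 (10 * n * d) + 1) := by
  have hn : 0 < n := M.start.pos
  have hnd : 0 < n * d := Nat.mul_pos hn hd
  have hN : 10 * n * d = 10 * (n * d) := by ring
  have hNK : 10 * n * d * (2 * b) = 20 * (n * d * b) := by ring
  have hmb : n * d * 2 ≤ n * d * b := Nat.mul_le_mul_left _ hb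
  have hdm : d ≤ n * d := Nat.le_mul_of_pos_left _ hn
  -- The inequality must be strict: the arrays of segment boundaries and of unexplored positions are
  -- indexed from 1, so address `N` may be used.
  have hlt : 10 * n * d < 10 * n * d * (2 * b) := by omega
  simp only [decideProgram, run_block_cons, run_block_nil]
  refine (init_run M hb hd ⟨0, by omega⟩ rfl _ le_rfl).imp ?_
  rintro τ₁ t₁ ⟨henv, hvar, harr, ht₁⟩
  set qz := (List.replicate d (some (⟨0, by omega⟩ : Fin b))).foldl M.step M.start with hqz
  refine (table_run M _ le_rfl qz hb hd τ₁ henv hvar).frame.imp ?_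
  rintro τ₂ t₂ ⟨⟨henv₂, htab, ht₂⟩, -, harr₂⟩
  have hP : Presents (10 * n * d) (bigStep M qz) (bigAccept d M) stateCode (τ₂.arr 2)
      (τ₂.arr 3) := by
    refine ⟨stateCode_inj, stateCode_lt, fun p hp => exists_stateCode hp, fun x a => ?_,
      fun x => ?_⟩
    · exact (htab x).1 a (mul_add_lt (stateCode_lt x) a.isLt)
    · exact (htab x).2 (Nat.mul_lt_mul_of_pos_right (stateCode_lt x) (by omega))
  have hF := weakSet_bigAccept M qz (d := d) (weakSet_of_isWeak hM)
  have hz : ∀ a, 4 ≤ a → τ₂.arr a = fun _ => 0 := by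
    intro a ha
    rw [harr₂ a, harr a (by omega)]
    simp [Program.writes, tableProgram, entryProgram, nextProgram, block]
    omega
  refine (color_run hP.table_lt (hP.acc_iff hF) _ hlt le_rfl henv₂.size henv₂.letters rfl rfl
    hz).frame.imp ?_
  rintro τ₃ t₃ ⟨⟨ht₃, hcol⟩, hvar₃, harr₃⟩
  have g1 := (hvar₃ 1 rfl).trans henv₂.dim
  have g2 := (hvar₃ 2 rfl).trans henv₂.states
  have g5 := (hvar₃ 5 rfl).trans henv₂.letters
  have gT := harr₃ 2 rfl
  have g12 := (harr₃ 12 rfl).trans (hz 12 (by omega))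
  have g13 := (harr₃ 13 rfl).trans (hz 13 (by omega))
  simp only [run_assign]
  refine ⟨by simp, by simp, ?_⟩
  refine (compare_run hP.table_lt (10 * n * d * (2 * b)) hlt.le le_rfl (s₁ := 0) (s₂ := n * d)
    (bit := τ₃.arr 11) (by simpa using g5) (by simpa using gT) (by simp) (by simpa using g12)
    (by simpa using g13) (by simp) (by simp [g1, g2]) (by omega) (by omega)).imp ?_
  rintro τ₄ t₄ ⟨ht₄, hres⟩
  -- Any states of kinds 0 and 1 can serve as start states; these two have the numbers 0 and `n * d`
  -- loaded into the variables 30 and 31.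
  have hiff := hP.forall_accepts_iff hF hcol ((0, ⟨0, hn⟩, ⟨0, hd⟩) : Fin 10 × Fin n × Fin d)
    (1, ⟨0, hn⟩, ⟨0, hd⟩)
  rw [forall_accepts_iff_isSeqRVA M qz hb hd ⟨0, by omega⟩ rfl hqz rfl rfl] at hiff
  have hc0 : stateCode ((0, ⟨0, hn⟩, ⟨0, hd⟩) : Fin 10 × Fin n × Fin d) = 0 := by simp [stateCode]
  have hc1 : stateCode ((1, ⟨0, hn⟩, ⟨0, hd⟩) : Fin 10 × Fin n × Fin d) = n * d := by
    simp [stateCode]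
  rw [hc0, hc1] at hiff
  refine ⟨by simp, ?_, ?_, ?_⟩
  · intro hR
    rcases hres with ⟨h1, -⟩ | ⟨-, u, hu, hne⟩
    · simpa using h1
    · exact absurd (hiff.1 hR u hu) hne
  · intro hR
    rcases hres with ⟨-, h1⟩ | ⟨h1, -⟩
    · exact absurd (hiff.2 h1) hR
    · simpa using h1
  · have e1 : 10 * n * d * (300 * (2 * b) + 700) = 6000 * (n * d * b) + 7000 * (n * d) := by ring
    have e2 : 10 * n * d * (2 * b * (16 * Nat.log 2 (10 * n * d) + 150) + 30) =
      320 * (n * d * b * Nat.log 2 (10 * n * d)) + 3000 * (n * d * b) + 300 * (n * d) := by ring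
    have e3 : 50000 * (n * d * b) * (Nat.log 2 (10 * n * d) + 1) =
      50000 * (n * d * b * Nat.log 2 (10 * n * d)) + 50000 * (n * d * b) := by ring
    have h1 : Nat.log 2 (10 * n * d) ≤ n * d * b * Nat.log 2 (10 * n * d) :=
      Nat.le_mul_of_pos_left _ (by omega)
    rw [hNK] at ht₂
    rw [e1] at ht₃
    rw [e2] at ht₄
    rw [e3]
    simp only [Term.time_lit, Term.time_mul, Term.time_var]
    omega

/-- The factor 10 adds at most 4 since `10 ≤ 16`, and passing to the natural logarithm costs a
factor of at most 2 since `log 2 > 1/2`. -/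
theorem log_le {m : ℕ} (hm : 0 < m) : (Nat.log 2 (10 * m) : ℝ) + 1 ≤ 5 * (1 + Real.log m) := by
  have h1 : Nat.log 2 (10 * m) ≤ Nat.log 2 m + 4 := by
    rw [show Nat.log 2 m + 4 = Nat.log 2 m + 1 + 1 + 1 + 1 from rfl,
      ← Nat.log_mul_base (by omega) (by omega), ← Nat.log_mul_base (by omega) (by omega),
      ← Nat.log_mul_base (by omega) (by omega), ← Nat.log_mul_base (by omega) (by omega)]
    exact Nat.log_mono_right (by omega)
  have h2 := Real.natLog_le_logb m 2
  have h3 : (0 : ℝ) ≤ Real.log m := Real.log_natCast_nonneg m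
  have h4 : Real.logb 2 m ≤ 2 * Real.log m := by
    have := Real.log_two_gt_d9
    rw [Real.logb, div_le_iff₀ (by linarith)]
    nlinarith
  have h5 : (Nat.log 2 (10 * m) : ℝ) ≤ Nat.log 2 m + 4 := by exact_mod_cast h1
  push_cast at h2
  linarith

end SeqRVA

theorem mainTheorem2 :
    ∃ (p : Ram.Program) (C : ℕ), ∀ (b d n : ℕ) (M : BuchiAutomaton (Fin n) (WithStar (Fin b))),
      2 ≤ b → 1 ≤ d → M.IsWeak →
      ∃ (τ : Ram.Store) (t s : ℕ), Ram.Exec p (Ram.input b d n M) τ t s ∧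
        (IsSeqRVA d M → τ.var 0 = 1) ∧
        (¬ IsSeqRVA d M → τ.var 0 = 0) ∧
        (t : ℝ) ≤ C * (n * d * (1 + Real.log (n * d)) * b) ∧
        s ≤ C * (n * d * b) := by
  refine ⟨SeqRVA.decideProgram, 250000, fun b d n M hb hd hM => ?_⟩
  obtain ⟨τ, t, s, hrun, hs, h1, h0, ht⟩ := SeqRVA.decide_run M hb hd hM
  refine ⟨τ, t, s, hrun, h1, h0, ?_, ?_⟩
  · have hnd : 0 < n * d := Nat.mul_pos M.start.pos hd
    have hlog := SeqRVA.log_le hnd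
    rw [← mul_assoc] at hlog
    have ht' : (t : ℝ) ≤ 50000 * (n * d * b) * (Nat.log 2 (10 * n * d) + 1) := by exact_mod_cast ht
    push_cast at hlog
    calc (t : ℝ) ≤ 50000 * (n * d * b) * (Nat.log 2 (10 * n * d) + 1) := ht'
      _ ≤ 50000 * (n * d * b) * (5 * (1 + Real.log (n * d))) :=
        mul_le_mul_of_nonneg_left hlog (by positivity)
      _ = (250000 : ℕ) * (n * d * (1 + Real.log (n * d)) * b) := by
        push_cast
        ring
  · have : 10 * n * d * (2 * b) = 20 * (n * d * b) := by ring
    omega
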